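/- An instance of Min-Sum Dissatisfaction consists of a finite set $K$ of agents, a finite set $V$ of items, a directed acyclic graph $G_i=(V_i,A_i)$ with $V_i\subseteq V$ for each agent $i\in K$ (the preference graph of $i$), and an integer $d$. For $u,v\in V_i$, item $u$ is dominated by item $v$ if there is a directed path (possibly of length $0$) from $v$ to $u$ in $G_i$. An allocation is a function $\pi\colon K\to 2^V$ with pairwise disjoint values. The dissatisfaction $\delta_\pi(i)$ of agent $i$ is the number of items of $V_i$ that are not dominated (in $G_i$) by any item of $\pi(i)$. The question is whether there is an allocation $\pi$ with $\sum_{i\in K}\delta_\pi(i)\le d$. A junction vertex of $G_i$ is a vertex of $G_i$ whose in-degree or out-degree in $G_i$ is greater than $1$. Let $J_i$ be the set of junction vertices of $G_i$, and let $\gamma=\sum_{i\in K}|J_i|$ be the total number of junction vertices, counted with multiplicity over all preference graphs. **Theorem.** Min-Sum Dissatisfaction is fixed-parameter tractable with respect to $\gamma$. That is, there are an algorithm (a program of a random access machine with unit-cost addition and subtraction), a computable function $f\colon\mathbb N\to\mathbb N$ and a constant $c$ such that, on every instance $I$ of encoding length $|I|$ with parameter $\gamma=\gamma(I)$, the algorithm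 halts after at most $f(\gamma)\cdot|I|^{c}$ steps with the correct answer to the question above. -/

import Mathlib

/-! ### Machine model: a random access machine with unit-cost instructions

The machine has registers `reg 0, reg 1, …` that a program names directly (a program mentions only
finitely many of them) and a memory `mem 0, mem 1, …` that is addressed indirectly through
registers. All cells hold natural numbers. The only arithmetic is addition and truncated
subtraction, so that in `t` steps a number gains at most `t` bits; hence unit-cost running time on
this machine and Turing machine running time are polynomially related. -/

namespace RAM

/-- A machine configuration: contents of the registers and of the memory. -/
structure State where
  reg : ℕ → ℕ
  mem : ℕ → ℕ

/-- `s.setReg r x` is `s` with the value `x` written to register `r`. -/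
def State.setReg (s : State) (r x : ℕ) : State :=
  { s with reg := Function.update s.reg r x }

/-- `s.setMem a x` is `s` with the value `x` written to memory cell `a`. -/
def State.setMem (s : State) (a x : ℕ) : State :=
  { s with mem := Function.update s.mem a x }

/-- Programs. The arguments `r`, `a`, `b` are register names. -/
inductive Program where
  /-- do nothing -/
  | skip
  /-- `reg r := x`, for a constant `x` -/
  | const (r x : ℕ)
  /-- `reg r := reg a` -/
  | move (r a : ℕ)
  /-- `reg r := reg a + reg b` -/
  | add (r a b : ℕ)
  /-- `reg r := max (reg a - reg b) 0` -/
  | sub (r a b : ℕ)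
  /-- `reg r := mem (reg a)` -/
  | load (r a : ℕ)
  /-- `mem (reg a) := reg b` -/
  | store (a b : ℕ)
  /-- run `p`, then `q` -/
  | seq (p q : Program)
  /-- if `reg r ≠ 0` then `p` else `q` -/
  | ite (r : ℕ) (p q : Program)
  /-- while `reg r ≠ 0` do `p` -/
  | loop (r : ℕ) (p : Program)

/-- `Exec p s t s'`: the program `p`, started in the state `s`, halts in the state `s'` after
exactly `t` steps. Every elementary instruction and every test of a register is one step. -/
inductive Exec : Program → State → ℕ → State → Prop where
  | skip (s : State) : Exec .skip s 1 s
  | const (s : State) (r x : ℕ) : Exec (.const r x) s 1 (s.setReg r x)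
  | move (s : State) (r a : ℕ) : Exec (.move r a) s 1 (s.setReg r (s.reg a))
  | add (s : State) (r a b : ℕ) : Exec (.add r a b) s 1 (s.setReg r (s.reg a + s.reg b))
  | sub (s : State) (r a b : ℕ) : Exec (.sub r a b) s 1 (s.setReg r (s.reg a - s.reg b))
  | load (s : State) (r a : ℕ) : Exec (.load r a) s 1 (s.setReg r (s.mem (s.reg a)))
  | store (s : State) (a b : ℕ) : Exec (.store a b) s 1 (s.setMem (s.reg a) (s.reg b))
  | seq {p q : Program} {s s₁ s₂ : State} {t₁ t₂ : ℕ} :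
      Exec p s t₁ s₁ → Exec q s₁ t₂ s₂ → Exec (.seq p q) s (t₁ + t₂) s₂
  | ite_true {p q : Program} {s s' : State} {r t : ℕ} :
      s.reg r ≠ 0 → Exec p s t s' → Exec (.ite r p q) s (t + 1) s'
  | ite_false {p q : Program} {s s' : State} {r t : ℕ} :
      s.reg r = 0 → Exec q s t s' → Exec (.ite r p q) s (t + 1) s'
  | loop_done {p : Program} {s : State} {r : ℕ} :
      s.reg r = 0 → Exec (.loop r p) s 1 s
  | loop_step {p : Program} {s s₁ s₂ : State} {r t₁ t₂ : ℕ} :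
      s.reg r ≠ 0 → Exec p s t₁ s₁ → Exec (.loop r p) s₁ t₂ s₂ →
        Exec (.loop r p) s (t₁ + t₂ + 1) s₂

/-- The initial state on the input `w`: the words of `w` stand in `mem 0, mem 1, …`, register `0`
holds the number of words, and everything else is `0`. -/
def init (w : List ℕ) : State where
  reg := fun r => if r = 0 then w.length else 0
  mem := fun a => w.getD a 0

/-- The length of an input in bits: each word counts with its number of binary digits,
plus one for a separator. -/
def bitLength (w : List ℕ) : ℕ :=
  (w.map fun x => Nat.size x + 1).sum

end RAM

/-! ### Parameterized problems and fixed-parameter tractability -/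

/-- A parameterized decision problem: a class of instances, their encoding as machine inputs,
the yes-instances, and the parameter of an instance. -/
structure ParameterizedProblem where
  Instance : Type
  encode : Instance → List ℕ
  yes : Instance → Prop
  param : Instance → ℕ

/-- Fixed-parameter tractability: a single program decides every instance `I` in at most
`f (param I) * |I| ^ c` steps, where `f` is a computable function and `c` is a constant. The answer
(`1` for yes, `0` for no) is left in register `0`. The program is given the encoded instance only,
not the value of the parameter. -/
def FixedParameterTractable (P : ParameterizedProblem) : Prop :=
  ∃ (p : RAM.Program) (f : ℕ → ℕ) (c : ℕ), Computable f ∧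
    ∀ I : P.Instance, ∃ (t : ℕ) (s : RAM.State),
      RAM.Exec p (RAM.init (P.encode I)) t s ∧
      t ≤ f (P.param I) * RAM.bitLength (P.encode I) ^ c ∧
      (P.yes I → s.reg 0 = 1) ∧ (¬ P.yes I → s.reg 0 = 0)

/-! ### Preference graphs, allocations and dissatisfaction -/

/-- A preference graph over the items `Fin n`: a directed acyclic graph whose vertex set is a
subset of the items. -/
structure PrefGraph (n : ℕ) where
  verts : Finset (Fin n)
  arcs : Finset (Fin n × Fin n)
  arcs_subset : arcs ⊆ verts ×ˢ verts
  /-- there is no closed walk of positive length, equivalently no cycle -/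
  acyclic : ∀ v : Fin n, ¬ Relation.TransGen (fun x y => (x, y) ∈ arcs) v v

namespace PrefGraph

variable {n : ℕ}

/-- There is a directed path (possibly of length `0`) from `u` to `v`. -/
def Reaches (G : PrefGraph n) (u v : Fin n) : Prop :=
  u ∈ G.verts ∧ v ∈ G.verts ∧ Relation.ReflTransGen (fun x y => (x, y) ∈ G.arcs) u v

/-- The predecessors of `v`: the vertices `u ≠ v` with a path from `u` to `v`. -/
def pred (G : PrefGraph n) (v : Fin n) : Set (Fin n) :=
  {u | u ≠ v ∧ G.Reaches u v}

/-- The vertex `u` is dominated by the vertex `v`. -/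
def Dominated (G : PrefGraph n) (u v : Fin n) : Prop :=
  u ∈ G.verts ∧ v ∈ G.verts ∧ (u = v ∨ v ∈ G.pred u)

open Classical in
/-- The dissatisfaction of an agent with preference graph `G` who receives the set `S` of items:
the number of items of `G` that are not dominated by any item of `S`. -/
noncomputable def dissatisfaction (G : PrefGraph n) (S : Finset (Fin n)) : ℕ :=
  (G.verts.filter fun u => ¬ ∃ v ∈ S, G.Dominated u v).card

def inDegree (G : PrefGraph n) (v : Fin n) : ℕ :=
  (G.arcs.filter fun a => a.2 = v).card

def outDegree (G : PrefGraph n) (v : Fin n) : ℕ :=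
  (G.arcs.filter fun a => a.1 = v).card

/-- The junction vertices: vertices with in-degree or out-degree greater than `1`. -/
def junctions (G : PrefGraph n) : Finset (Fin n) :=
  G.verts.filter fun v => 1 < G.inDegree v ∨ 1 < G.outDegree v

end PrefGraph

/-- An instance: finitely many agents and items (numbered), a preference graph for each agent,
and an integer threshold. -/
structure DissatisfactionInstance where
  numAgents : ℕ
  numItems : ℕ
  graph : Fin numAgents → PrefGraph numItems
  threshold : ℤ

namespace DissatisfactionInstance

/-- An allocation assigns pairwise disjoint sets of items to the agents. -/
def IsAllocation (I : DissatisfactionInstance)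
    (π : Fin I.numAgents → Finset (Fin I.numItems)) : Prop :=
  ∀ i j, i ≠ j → Disjoint (π i) (π j)

/-- There is an allocation whose total dissatisfaction is at most the threshold. -/
def MinSumYes (I : DissatisfactionInstance) : Prop :=
  ∃ π : Fin I.numAgents → Finset (Fin I.numItems), I.IsAllocation π ∧
    ((∑ i, (I.graph i).dissatisfaction (π i) : ℕ) : ℤ) ≤ I.threshold

/-- The total number of junction vertices over all preference graphs, with multiplicity. -/
def junctionNumber (I : DissatisfactionInstance) : ℕ :=
  ∑ i, (I.graph i).junctions.card

/-- The encoding of an instance: the number of agents, the number of items, the threshold as its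
positive and its negative part, and for each agent the indicator vector of the vertex set followed
by the adjacency matrix, row by row. -/
def encode (I : DissatisfactionInstance) : List ℕ :=
  [I.numAgents, I.numItems, I.threshold.toNat, (-I.threshold).toNat] ++
    (List.finRange I.numAgents).flatMap fun i =>
      ((List.finRange I.numItems).map fun v => if v ∈ (I.graph i).verts then 1 else 0) ++
      (List.finRange I.numItems).flatMap fun u =>
        (List.finRange I.numItems).map fun v => if (u, v) ∈ (I.graph i).arcs then 1 else 0

end DissatisfactionInstance

/-- Min-Sum Dissatisfaction, parameterized by the total number of junction vertices. -/
def minSumDissatisfaction : ParameterizedProblem where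
  Instance := DissatisfactionInstance
  encode := DissatisfactionInstance.encode
  yes := DissatisfactionInstance.MinSumYes
  param := DissatisfactionInstance.junctionNumber

/-! Consider one preference graph. A vertex that is not a junction has at most one incoming and at
most one outgoing arc, so the arcs between non-junctions (`Inner`) split the graph into
vertex-disjoint paths, each junction being a path by itself. A path of non-junctions can be left
only at its last vertex, and then towards a single junction (`Leads.unique`). Hence a walk stays on
its path or passes through the junction to which that path leads (`Walk.chain_or_leads`). For a set
`S` of received items let `L` be the set of junctions to which the paths through items of `S` lead.
A vertex is undominated exactly if it is not reachable from `L` and no item of `S` weakly precedes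
it on its own path.

All sets `L` together can be guessed in `2 ^ γ` ways. For fixed `L` the rest is an assignment
problem. The persons are all pairs of an agent and a vertex; the objects are the items and one
substitute per pair. The head of a path may take an item on the path, at the cost of the uncovered
vertices before it, or a substitute, at the cost of all uncovered vertices of the path. It remains
to enforce that every `l ∈ L` is dominated through some path leading to it. For this the substitutes
of elements of `L` are withdrawn, while the other substitutes of vertices leading to `l` may be
exchanged among these vertices. The vertices leading to `l` then have one substitute too few, so one
of them must take an item; conversely, a path that takes an item can hand its substitute to `l`. The
two directions are `PrefGraph.dissatisfaction_le` and `PrefGraph.exists_assignment`. The agents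
compete only for items, which gives `DissatisfactionInstance.minSumYes_iff`.

A cheapest assignment is found by an auction with price increment one. Its result is optimal up to
the number `P` of persons (`Auction.Invariant.optimal`), hence exactly optimal once all costs are
multiplied by `P + 1`, and it needs polynomially many rounds (`Auction.Invariant.terminates`).

The algorithm is written in a small language whose loops are bounded by parameters fixed in advance.
Its programs compile to machine programs whose running time is polynomial in the largest parameter
(`Expr.compile_spec`, `Cmd.compile_spec`). The largest parameter is bounded by a cubic polynomial in
the input length plus `2 ^ γ`, and such a time bound can be separated into a product `f γ * |I| ^
c`. -/

/-! ### A language of arrays and bounded loops, and its translation to machine programs -/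

namespace ArrayLang

open RAM Function

/-- Polynomially bounded functions. -/
def PolyBounded (T : ℕ → ℕ) : Prop := ∃ c d : ℕ, ∀ N, T N ≤ c * (N + 1) ^ d

theorem PolyBounded.const (c : ℕ) : PolyBounded fun _ => c := ⟨c, 0, fun N => by simp⟩

theorem PolyBounded.id : PolyBounded fun N => N := ⟨1, 1, fun N => by simp⟩

theorem PolyBounded.add {S T : ℕ → ℕ} (hS : PolyBounded S) (hT : PolyBounded T) :
    PolyBounded fun N => S N + T N := by
  obtain ⟨c, d, h⟩ := hS
  obtain ⟨c', d', h'⟩ := hT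
  refine ⟨c + c', d + d', fun N => ?_⟩
  have h1 : (N + 1) ^ d ≤ (N + 1) ^ (d + d') := Nat.pow_le_pow_right (by omega) (by omega)
  have h2 : (N + 1) ^ d' ≤ (N + 1) ^ (d + d') := Nat.pow_le_pow_right (by omega) (by omega)
  calc S N + T N ≤ c * (N + 1) ^ d + c' * (N + 1) ^ d' := add_le_add (h N) (h' N)
    _ ≤ c * (N + 1) ^ (d + d') + c' * (N + 1) ^ (d + d') := by gcongr
    _ = _ := by ring

theorem PolyBounded.mul {S T : ℕ → ℕ} (hS : PolyBounded S) (hT : PolyBounded T) :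
    PolyBounded fun N => S N * T N := by
  obtain ⟨c, d, h⟩ := hS
  obtain ⟨c', d', h'⟩ := hT
  refine ⟨c * c', d + d', fun N => ?_⟩
  calc S N * T N ≤ (c * (N + 1) ^ d) * (c' * (N + 1) ^ d') := Nat.mul_le_mul (h N) (h' N)
    _ = _ := by ring

/-! ### Running times of machine programs -/

/-- The program `p` leads from `s` to `s'` in at most `T` steps. -/
def Runs (p : Program) (s s' : State) (T : ℕ) : Prop := ∃ t ≤ T, Exec p s t s'

theorem Runs.mono {p : Program} {s s' : State} {T T' : ℕ} (h : Runs p s s' T) (hT : T ≤ T') :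
    Runs p s s' T' := by
  obtain ⟨t, ht, h⟩ := h
  exact ⟨t, ht.trans hT, h⟩

theorem Runs.seq {p q : Program} {s s₁ s₂ : State} {T₁ T₂ : ℕ} (hp : Runs p s s₁ T₁)
    (hq : Runs q s₁ s₂ T₂) : Runs (.seq p q) s s₂ (T₁ + T₂) := by
  obtain ⟨t, ht, h⟩ := hp
  obtain ⟨t', ht', h'⟩ := hq
  exact ⟨t + t', by omega, .seq h h'⟩

theorem Runs.ite {p q : Program} {s s' : State} {r T : ℕ}
    (h1 : s.reg r ≠ 0 → Runs p s s' T) (h0 : s.reg r = 0 → Runs q s s' T) :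
    Runs (.ite r p q) s s' (T + 1) := by
  by_cases h : s.reg r = 0
  · obtain ⟨t, ht, h'⟩ := h0 h
    exact ⟨t + 1, by omega, .ite_false h h'⟩
  · obtain ⟨t, ht, h'⟩ := h1 h
    exact ⟨t + 1, by omega, .ite_true h h'⟩

theorem runs_skip (s : State) : Runs .skip s s 1 := ⟨1, le_rfl, .skip s⟩

theorem runs_const (s : State) (r x : ℕ) : Runs (.const r x) s (s.setReg r x) 1 :=
  ⟨1, le_rfl, .const s r x⟩

theorem runs_move (s : State) (r a : ℕ) : Runs (.move r a) s (s.setReg r (s.reg a)) 1 :=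
  ⟨1, le_rfl, .move s r a⟩

theorem runs_add (s : State) (r a b : ℕ) :
    Runs (.add r a b) s (s.setReg r (s.reg a + s.reg b)) 1 :=
  ⟨1, le_rfl, .add s r a b⟩

theorem runs_sub (s : State) (r a b : ℕ) :
    Runs (.sub r a b) s (s.setReg r (s.reg a - s.reg b)) 1 :=
  ⟨1, le_rfl, .sub s r a b⟩

theorem runs_load (s : State) (r a : ℕ) :
    Runs (.load r a) s (s.setReg r (s.mem (s.reg a))) 1 :=
  ⟨1, le_rfl, .load s r a⟩

theorem runs_store (s : State) (a b : ℕ) :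
    Runs (.store a b) s (s.setMem (s.reg a) (s.reg b)) 1 :=
  ⟨1, le_rfl, .store s a b⟩

/-- A loop whose counter runs down to `0`. -/
theorem runs_loop {r : ℕ} {p : Program} {T : ℕ} (Inv : ℕ → State → Prop)
    (hr : ∀ j s, Inv j s → s.reg r = j)
    (hp : ∀ j s, Inv (j + 1) s → ∃ s', Inv j s' ∧ Runs p s s' T) :
    ∀ m s, Inv m s → ∃ s', Inv 0 s' ∧ Runs (.loop r p) s s' (m * (T + 1) + 1) := by
  intro m
  induction m with
  | zero => exact fun s h => ⟨s, h, 1, by omega, .loop_done (hr 0 s h)⟩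
  | succ m ih =>
    intro s h
    obtain ⟨s₁, h₁, t₁, ht₁, e₁⟩ := hp m s h
    obtain ⟨s₂, h₂, t₂, ht₂, e₂⟩ := ih s₁ h₁
    refine ⟨s₂, h₂, t₁ + t₂ + 1, ?_, .loop_step ?_ e₁ e₂⟩
    · rw [Nat.succ_mul]
      omega
    · rw [hr _ s h]
      omega

@[simp] theorem reg_setReg (s : State) (r x : ℕ) : (s.setReg r x).reg r = x := by
  simp [State.setReg]

theorem reg_setReg_of_ne (s : State) {r q : ℕ} (x : ℕ) (h : q ≠ r) :
    (s.setReg r x).reg q = s.reg q := by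
  simp [State.setReg, h]

@[simp] theorem mem_setReg (s : State) (r x : ℕ) : (s.setReg r x).mem = s.mem := rfl

@[simp] theorem reg_setMem (s : State) (a x : ℕ) : (s.setMem a x).reg = s.reg := rfl

/-! ### Syntax and semantics of the array language -/

/-- Sixteen unbounded arrays of natural numbers. -/
abbrev Arrays := Fin 16 → ℕ → ℕ

/-- Expressions over parameters, variables and arrays. -/
inductive Expr where
  | lit (c : ℕ)
  | par (r : Fin 16)
  | var (x : ℕ)
  | add (a b : Expr)
  | sub (a b : Expr)
  /-- `a` if `c ≠ 0`, else `b` -/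
  | ite (c a b : Expr)
  /-- the entry of the array `a` at `e` -/
  | get (a : Fin 16) (e : Expr)
  /-- the sum of `b` over all values of the variable `x` below the parameter `r` -/
  | sum (r : Fin 16) (x : ℕ) (b : Expr)

def Expr.eval (π : Fin 16 → ℕ) (A : Arrays) : Expr → (ℕ → ℕ) → ℕ
  | .lit c, _ => c
  | .par r, _ => π r
  | .var x, ρ => ρ x
  | .add a b, ρ => a.eval π A ρ + b.eval π A ρ
  | .sub a b, ρ => a.eval π A ρ - b.eval π A ρ
  | .ite c a b, ρ => if c.eval π A ρ ≠ 0 then a.eval π A ρ else b.eval π A ρ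
  | .get a e, ρ => A a (e.eval π A ρ)
  | .sum r x b, ρ => ∑ j ∈ Finset.range (π r), b.eval π A (update ρ x j)

/-- Commands that change arrays. -/
inductive Cmd where
  | skip
  | store (a : Fin 16) (i v : Expr)
  | seq (p q : Cmd)
  | ite (c : Expr) (p q : Cmd)
  /-- run `p` for all values of `x` below the parameter `r` -/
  | loop (r : Fin 16) (x : ℕ) (p : Cmd)
  | letin (x : ℕ) (e : Expr) (p : Cmd)

/-- `f (m - 1) (… (f 1 (f 0 A)))`. -/
def iter {α : Type*} (f : ℕ → α → α) (A : α) : ℕ → α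
  | 0 => A
  | m + 1 => f m (iter f A m)

def setArr (A : Arrays) (a : Fin 16) (i v : ℕ) : Arrays := update A a (update (A a) i v)

def Cmd.run (π : Fin 16 → ℕ) : Cmd → (ℕ → ℕ) → Arrays → Arrays
  | .skip, _, A => A
  | .store a i v, ρ, A => setArr A a (i.eval π A ρ) (v.eval π A ρ)
  | .seq p q, ρ, A => q.run π ρ (p.run π ρ A)
  | .ite c p q, ρ, A => if c.eval π A ρ ≠ 0 then p.run π ρ A else q.run π ρ A
  | .loop r x p, ρ, A => iter (fun j A => p.run π (update ρ x j) A) A (π r)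
  | .letin x e p, ρ, A => p.run π (update ρ x (e.eval π A ρ)) A

/-! ### Representation in the machine and compilation of expressions -/

/-- The scratch registers. -/
def scr (k : ℕ) : ℕ := 2 * (k + 16)

/-- The machine state `s` represents the parameters `π`, the variables `ρ` and the arrays `A`. -/
structure Represents (s : State) (π : Fin 16 → ℕ) (ρ : ℕ → ℕ) (A : Arrays) : Prop where
  par : ∀ r : Fin 16, s.reg (2 * r) = π r
  var : ∀ x, s.reg (2 * x + 1) = ρ x
  arr : ∀ (a : Fin 16) (x : ℕ), s.mem (π 0 + (16 * x + a)) = A a x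

theorem Represents.setReg_scr {s : State} {π : Fin 16 → ℕ} {ρ : ℕ → ℕ} {A : Arrays}
    (h : Represents s π ρ A) (k x : ℕ) : Represents (s.setReg (scr k) x) π ρ A where
  par r := by rw [reg_setReg_of_ne _ _ (by unfold scr; omega), h.par]
  var y := by rw [reg_setReg_of_ne _ _ (by unfold scr; omega), h.var]
  arr a y := by rw [mem_setReg, h.arr]

theorem Represents.setReg_var {s : State} {π : Fin 16 → ℕ} {ρ : ℕ → ℕ} {A : Arrays}
    (h : Represents s π ρ A) (y x : ℕ) :
    Represents (s.setReg (2 * y + 1) x) π (update ρ y x) A where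
  par r := by rw [reg_setReg_of_ne _ _ (by omega), h.par]
  var z := by
    by_cases hz : z = y
    · subst hz; simp
    · rw [reg_setReg_of_ne _ _ (by omega), h.var, update_of_ne hz]
  arr a y := by rw [mem_setReg, h.arr]

theorem scr_setReg_scr (s : State) {j k : ℕ} (x : ℕ) (h : j ≠ k) :
    (s.setReg (scr k) x).reg (scr j) = s.reg (scr j) :=
  reg_setReg_of_ne _ _ (by unfold scr; omega)

theorem scr_setReg_var (s : State) (j y x : ℕ) :
    (s.setReg (2 * y + 1) x).reg (scr j) = s.reg (scr j) :=
  reg_setReg_of_ne _ _ (by unfold scr; omega)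

theorem var_setReg_scr (s : State) (k y x : ℕ) :
    (s.setReg (scr k) x).reg (2 * y + 1) = s.reg (2 * y + 1) :=
  reg_setReg_of_ne _ _ (by unfold scr; omega)

theorem par_setReg_scr (s : State) (k x : ℕ) (r : Fin 16) :
    (s.setReg (scr k) x).reg (2 * r) = s.reg (2 * r) :=
  reg_setReg_of_ne _ _ (by unfold scr; omega)

/-- Turns an index in scratch register `k` into the address of that entry of the array `a`. -/
def addressProgram (a : Fin 16) (k : ℕ) : Program :=
  .seq (.add (scr k) (scr k) (scr k)) <| .seq (.add (scr k) (scr k) (scr k)) <|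
  .seq (.add (scr k) (scr k) (scr k)) <| .seq (.add (scr k) (scr k) (scr k)) <|
  .seq (.const (scr (k + 1)) a) <| .seq (.add (scr k) (scr k) (scr (k + 1)))
    (.add (scr k) (2 * (0 : Fin 16)) (scr k))

/-- Four doublings multiply the index by 16. The sixteen arrays are interleaved in the memory above
the base address, which is parameter 0. -/
theorem addressProgram_spec (a : Fin 16) (k : ℕ) {s : State} {π : Fin 16 → ℕ} {ρ : ℕ → ℕ}
    {A : Arrays} (h : Represents s π ρ A) :
    ∃ s', Runs (addressProgram a k) s s' 7 ∧ Represents s' π ρ A ∧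
      (∀ j < k, s'.reg (scr j) = s.reg (scr j)) ∧
      s'.reg (scr k) = π 0 + (16 * s.reg (scr k) + a) := by
  have h0 := h.par 0
  refine ⟨_, (runs_add _ _ _ _).seq <| (runs_add _ _ _ _).seq <| (runs_add _ _ _ _).seq <|
    (runs_add _ _ _ _).seq <| (runs_const _ _ _).seq <| (runs_add _ _ _ _).seq
    (runs_add _ _ _ _), ?_, ?_, ?_⟩
  · exact ((((((h.setReg_scr _ _).setReg_scr _ _).setReg_scr _ _).setReg_scr _ _).setReg_scr
      _ _).setReg_scr _ _).setReg_scr _ _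
  · intro j hj
    have h1 : j ≠ k := by omega
    have h2 : j ≠ k + 1 := by omega
    simp only [scr_setReg_scr _ _ h1, scr_setReg_scr _ _ h2]
  · simp only [reg_setReg, par_setReg_scr, h0,
      scr_setReg_scr _ _ (Nat.ne_of_lt (Nat.lt_succ_self k))]
    ring

/-- Translation of expressions: the value is left in scratch register `k`, lower scratch registers
are preserved. -/
def Expr.compile : Expr → ℕ → Program
  | .lit c, k => .const (scr k) c
  | .par r, k => .move (scr k) (2 * r)
  | .var x, k => .move (scr k) (2 * x + 1)
  | .add a b, k => .seq (a.compile k) (.seq (b.compile (k + 1))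
      (.add (scr k) (scr k) (scr (k + 1))))
  | .sub a b, k => .seq (a.compile k) (.seq (b.compile (k + 1))
      (.sub (scr k) (scr k) (scr (k + 1))))
  | .ite c a b, k => .seq (c.compile k) (.ite (scr k) (a.compile k) (b.compile k))
  | .get a e, k => .seq (e.compile k) (.seq (addressProgram a k) (.load (scr k) (scr k)))
  | .sum r x b, k =>
      .seq (.const (scr k) 0) <| .seq (.move (scr (k + 1)) (2 * x + 1)) <|
      .seq (.move (scr (k + 2)) (2 * r)) <| .seq (.const (2 * x + 1) 0) <|
      .seq (.const (scr (k + 3)) 1) <|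
      .seq (.loop (scr (k + 2)) <|
        .seq (b.compile (k + 4)) <| .seq (.add (scr k) (scr k) (scr (k + 4))) <|
        .seq (.add (2 * x + 1) (2 * x + 1) (scr (k + 3)))
          (.sub (scr (k + 2)) (scr (k + 2)) (scr (k + 3))))
      (.move (2 * x + 1) (scr (k + 1)))

/-- `p` evaluates `F` at scratch level `k` within time `T N` if no parameter exceeds `N`. -/
def Evaluates (p : Program) (k : ℕ) (T : ℕ → ℕ)
    (F : (Fin 16 → ℕ) → Arrays → (ℕ → ℕ) → ℕ) : Prop :=
  ∀ s π ρ A N, Represents s π ρ A → (∀ r, π r ≤ N) →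
    ∃ s', Runs p s s' (T N) ∧ Represents s' π ρ A ∧
      (∀ j < k, s'.reg (scr j) = s.reg (scr j)) ∧ s'.reg (scr k) = F π A ρ

theorem Expr.compile_sum_spec {b : Expr} {T : ℕ → ℕ}
    (hb : ∀ k, Evaluates (b.compile k) k T fun π A => b.eval π A) (r : Fin 16) (x k : ℕ) :
    Evaluates ((Expr.sum r x b).compile k) k (fun N => N * (T N + 3 + 1) + 1 + 6)
      fun π A => (Expr.sum r x b).eval π A := by
  intro s π ρ A N h hN
  -- After `i` summands, with `m` to go: register `k` accumulates, `k + 1` keeps the outer value of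
  -- `x`, `k + 2` counts down and `k + 3` holds the constant 1, so the body is compiled at level `k
  -- + 4`.
  let Inv : ℕ → State → Prop := fun m s' => ∃ i, i + m = π r ∧
    Represents s' π (update ρ x i) A ∧ (∀ j < k, s'.reg (scr j) = s.reg (scr j)) ∧
    s'.reg (scr k) = ∑ j ∈ Finset.range i, b.eval π A (update ρ x j) ∧
    s'.reg (scr (k + 1)) = ρ x ∧ s'.reg (scr (k + 2)) = m ∧ s'.reg (scr (k + 3)) = 1
  have hstep : ∀ m s', Inv (m + 1) s' → ∃ s'', Inv m s'' ∧
      Runs (.seq (b.compile (k + 4)) <| .seq (.add (scr k) (scr k) (scr (k + 4))) <|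
        .seq (.add (2 * x + 1) (2 * x + 1) (scr (k + 3)))
          (.sub (scr (k + 2)) (scr (k + 2)) (scr (k + 3)))) s' s'' (T N + 3) := by
    rintro m s' ⟨i, hi, hrep, hlow, hacc, hsave, hcnt, hone⟩
    obtain ⟨s₁, hr₁, hrep₁, hlow₁, hval₁⟩ := hb (k + 4) s' π _ A N hrep hN
    refine ⟨_, ⟨i + 1, by omega, ?_, ?_, ?_, ?_, ?_, ?_⟩, hr₁.seq <| (runs_add _ _ _ _).seq <|
      (runs_add _ _ _ _).seq (runs_sub _ _ _ _)⟩
    · have := (((hrep₁.setReg_scr k (s₁.reg (scr k) + s₁.reg (scr (k + 4)))).setReg_var x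
        (i + 1)).setReg_scr (k + 2) m)
      rw [update_idem] at this
      convert this using 2
      · congr 1
        rw [var_setReg_scr, hrep₁.var, scr_setReg_scr _ _ (by omega), hlow₁ _ (by omega), hone]
        simp
      · simp only [scr_setReg_var]
        rw [scr_setReg_scr _ _ (by omega), scr_setReg_scr _ _ (by omega), hlow₁ _ (by omega),
          hlow₁ _ (by omega), hcnt, hone]
        rfl
    · intro j hj
      rw [scr_setReg_scr _ _ (by omega), scr_setReg_var, scr_setReg_scr _ _ (by omega),
        hlow₁ _ (by omega), hlow j hj]
    · rw [scr_setReg_scr _ _ (by omega), scr_setReg_var, reg_setReg, hlow₁ _ (by omega), hacc,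
        hval₁, Finset.sum_range_succ]
    · rw [scr_setReg_scr _ _ (by omega), scr_setReg_var, scr_setReg_scr _ _ (by omega),
        hlow₁ _ (by omega), hsave]
    · simp only [reg_setReg, scr_setReg_var]
      rw [scr_setReg_scr _ _ (by omega), scr_setReg_scr _ _ (by omega), hlow₁ _ (by omega),
        hlow₁ _ (by omega), hcnt, hone]
      rfl
    · rw [scr_setReg_scr _ _ (by omega), scr_setReg_var, scr_setReg_scr _ _ (by omega),
        hlow₁ _ (by omega), hone]
  have hinit : Inv (π r) (((((s.setReg (scr k) 0).setReg (scr (k + 1)) (ρ x)).setReg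
      (scr (k + 2)) (π r)).setReg (2 * x + 1) 0).setReg (scr (k + 3)) 1) := by
    refine ⟨0, by omega, ?_, ?_, ?_, ?_, ?_, ?_⟩
    · exact ((((h.setReg_scr _ _).setReg_scr _ _).setReg_scr _ _).setReg_var _ _).setReg_scr _ _
    · intro j hj
      rw [scr_setReg_scr _ _ (by omega), scr_setReg_var, scr_setReg_scr _ _ (by omega),
        scr_setReg_scr _ _ (by omega), scr_setReg_scr _ _ (by omega)]
    · rw [scr_setReg_scr _ _ (by omega), scr_setReg_var, scr_setReg_scr _ _ (by omega),
        scr_setReg_scr _ _ (by omega), reg_setReg]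
      simp
    · rw [scr_setReg_scr _ _ (by omega), scr_setReg_var, scr_setReg_scr _ _ (by omega),
        reg_setReg]
    · rw [scr_setReg_scr _ _ (by omega), scr_setReg_var, reg_setReg]
    · rw [reg_setReg]
  obtain ⟨s₁, ⟨i, hi, hrep, hlow, hacc, hsave, -, -⟩, hrun⟩ := runs_loop (r := scr (k + 2)) Inv
    (fun j s' h => by obtain ⟨i, -, -, -, -, -, h, -⟩ := h; exact h) hstep _ _ hinit
  have hmul : π r * (T N + 3 + 1) ≤ N * (T N + 3 + 1) := Nat.mul_le_mul_right _ (hN r)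
  refine ⟨s₁.setReg (2 * x + 1) (s₁.reg (scr (k + 1))), ?_, ?_, ?_, ?_⟩
  · refine Runs.mono (.seq (runs_const _ _ _) <|
      .seq (s₁ := (s.setReg (scr k) 0).setReg (scr (k + 1)) (ρ x)) ?_ <| .seq ?_ <|
      .seq (runs_const _ _ _) <| .seq (runs_const _ _ _) <| .seq hrun (runs_move _ _ _))
      (show 1 + (1 + (1 + (1 + (1 + (π r * (T N + 3 + 1) + 1 + 1))))) ≤
        N * (T N + 3 + 1) + 1 + 6 by omega)
    · convert runs_move (s.setReg (scr k) 0) (scr (k + 1)) (2 * x + 1) using 2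
      rw [var_setReg_scr, h.var]
    · convert runs_move _ (scr (k + 2)) (2 * r) using 2
      rw [par_setReg_scr, par_setReg_scr, h.par]
  · have := hrep.setReg_var x (s₁.reg (scr (k + 1)))
    rwa [update_idem, hsave, update_eq_self, ← hsave] at this
  · intro j hj
    rw [scr_setReg_var, hlow j hj]
  · rw [scr_setReg_var, hacc]
    simp only [Expr.eval]
    rw [show i = π r by omega]

/-- Instructions have unit cost whatever the size of the numbers, and a sum has at most `N` terms;
so the time bounds are built from constants by addition and multiplication by `N`, independently of
the arrays. -/
theorem Expr.compile_spec (e : Expr) :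
    ∃ T, PolyBounded T ∧ ∀ k, Evaluates (e.compile k) k T fun π A => e.eval π A := by
  induction e with
  | lit c =>
    refine ⟨_, .const 1, fun k s π ρ A N h hN => ⟨_, runs_const _ _ _, h.setReg_scr _ _, ?_, ?_⟩⟩
    · exact fun j hj => scr_setReg_scr _ _ hj.ne
    · simp [Expr.eval]
  | par r =>
    refine ⟨_, .const 1, fun k s π ρ A N h hN => ⟨_, runs_move _ _ _, h.setReg_scr _ _, ?_, ?_⟩⟩
    · exact fun j hj => scr_setReg_scr _ _ hj.ne
    · simp [Expr.eval, h.par]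
  | var x =>
    refine ⟨_, .const 1, fun k s π ρ A N h hN => ⟨_, runs_move _ _ _, h.setReg_scr _ _, ?_, ?_⟩⟩
    · exact fun j hj => scr_setReg_scr _ _ hj.ne
    · simp [Expr.eval, h.var]
  | add a b iha ihb =>
    obtain ⟨T, hT, ha⟩ := iha
    obtain ⟨T', hT', hb⟩ := ihb
    refine ⟨_, hT.add (hT'.add (.const 1)), fun k s π ρ A N h hN => ?_⟩
    obtain ⟨s₁, r₁, h₁, l₁, v₁⟩ := ha k s π ρ A N h hN
    obtain ⟨s₂, r₂, h₂, l₂, v₂⟩ := hb (k + 1) s₁ π ρ A N h₁ hN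
    refine ⟨_, r₁.seq (r₂.seq (runs_add _ _ _ _)), h₂.setReg_scr _ _, fun j hj => ?_, ?_⟩
    · rw [scr_setReg_scr _ _ hj.ne, l₂ j (by omega), l₁ j hj]
    · rw [reg_setReg, l₂ k (by omega), v₁, v₂]
      simp only [Expr.eval]
  | sub a b iha ihb =>
    obtain ⟨T, hT, ha⟩ := iha
    obtain ⟨T', hT', hb⟩ := ihb
    refine ⟨_, hT.add (hT'.add (.const 1)), fun k s π ρ A N h hN => ?_⟩
    obtain ⟨s₁, r₁, h₁, l₁, v₁⟩ := ha k s π ρ A N h hN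
    obtain ⟨s₂, r₂, h₂, l₂, v₂⟩ := hb (k + 1) s₁ π ρ A N h₁ hN
    refine ⟨_, r₁.seq (r₂.seq (runs_sub _ _ _ _)), h₂.setReg_scr _ _, fun j hj => ?_, ?_⟩
    · rw [scr_setReg_scr _ _ hj.ne, l₂ j (by omega), l₁ j hj]
    · rw [reg_setReg, l₂ k (by omega), v₁, v₂]
      simp only [Expr.eval]
  | ite c a b ihc iha ihb =>
    obtain ⟨Tc, hTc, hc⟩ := ihc
    obtain ⟨T, hT, ha⟩ := iha
    obtain ⟨T', hT', hb⟩ := ihb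
    refine ⟨_, hTc.add ((hT.add hT').add (.const 1)), fun k s π ρ A N h hN => ?_⟩
    obtain ⟨s₁, r₁, h₁, l₁, v₁⟩ := hc k s π ρ A N h hN
    by_cases hv : c.eval π A ρ = 0
    · obtain ⟨s₂, r₂, h₂, l₂, v₂⟩ := hb k s₁ π ρ A N h₁ hN
      refine ⟨s₂, r₁.seq (.ite (fun h => absurd (v₁.trans hv) h) fun _ => r₂.mono (by omega)), h₂,
        fun j hj => (l₂ j hj).trans (l₁ j hj), ?_⟩
      simp [v₂, Expr.eval, hv]
    · obtain ⟨s₂, r₂, h₂, l₂, v₂⟩ := ha k s₁ π ρ A N h₁ hN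
      refine ⟨s₂, r₁.seq (.ite (fun _ => r₂.mono (by omega)) fun h => absurd (v₁.symm.trans h) hv),
        h₂, fun j hj => (l₂ j hj).trans (l₁ j hj), ?_⟩
      simp [v₂, Expr.eval, hv]
  | get a e ih =>
    obtain ⟨T, hT, he⟩ := ih
    refine ⟨_, hT.add (.const (7 + 1)), fun k s π ρ A N h hN => ?_⟩
    obtain ⟨s₁, r₁, h₁, l₁, v₁⟩ := he k s π ρ A N h hN
    obtain ⟨s₂, r₂, h₂, l₂, v₂⟩ := addressProgram_spec a k h₁
    refine ⟨_, r₁.seq (r₂.seq (runs_load _ _ _)), h₂.setReg_scr _ _, fun j hj => ?_, ?_⟩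
    · rw [scr_setReg_scr _ _ hj.ne, l₂ j hj, l₁ j hj]
    · rw [reg_setReg, v₂, h₂.arr, v₁]
      simp only [Expr.eval]
  | sum r x b ih =>
    obtain ⟨T, hT, hb⟩ := ih
    exact ⟨_, ((PolyBounded.id.mul ((hT.add (.const 3)).add (.const 1))).add (.const 1)).add
      (.const 6), fun k => compile_sum_spec hb r x k⟩

/-- Since `a < 16`, the number `16 * i + a` determines both `a` and `i`, so a store affects a single
array entry. -/
theorem Represents.setMem {s : State} {π : Fin 16 → ℕ} {ρ : ℕ → ℕ} {A : Arrays}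
    (h : Represents s π ρ A) (a : Fin 16) (i v : ℕ) :
    Represents (s.setMem (π 0 + (16 * i + a)) v) π ρ (setArr A a i v) where
  par r := h.par r
  var x := h.var x
  arr b x := by
    simp only [State.setMem, setArr, update_apply]
    by_cases hb : b = a
    · subst hb
      by_cases hx : x = i
      · simp [hx]
      · rw [if_neg (by omega), if_pos rfl, update_of_ne hx, h.arr]
    · rw [if_neg, if_neg hb, h.arr]
      have := Fin.val_ne_of_ne hb
      omega

/-! ### Compilation of commands -/

/-- Translation of commands: scratch registers below `k` are preserved. -/
def Cmd.compile : Cmd → ℕ → Program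
  | .skip, _ => .skip
  | .store a i v, k => .seq (i.compile k) <| .seq (addressProgram a k) <|
      .seq (v.compile (k + 1)) (.store (scr k) (scr (k + 1)))
  | .seq p q, k => .seq (p.compile k) (q.compile k)
  | .ite c p q, k => .seq (c.compile k) (.ite (scr k) (p.compile k) (q.compile k))
  | .loop r x p, k =>
      .seq (.move (scr k) (2 * x + 1)) <| .seq (.move (scr (k + 1)) (2 * r)) <|
      .seq (.const (2 * x + 1) 0) <| .seq (.const (scr (k + 2)) 1) <|
      .seq (.loop (scr (k + 1)) <|
        .seq (p.compile (k + 3)) <| .seq (.add (2 * x + 1) (2 * x + 1) (scr (k + 2)))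
          (.sub (scr (k + 1)) (scr (k + 1)) (scr (k + 2))))
      (.move (2 * x + 1) (scr k))
  | .letin x e p, k => .seq (e.compile k) <| .seq (.move (scr (k + 1)) (2 * x + 1)) <|
      .seq (.move (2 * x + 1) (scr k)) <| .seq (p.compile (k + 2))
        (.move (2 * x + 1) (scr (k + 1)))

/-- `p` transforms the arrays by `F` within time `T N` if no parameter exceeds `N`. -/
def Performs (p : Program) (k : ℕ) (T : ℕ → ℕ)
    (F : (Fin 16 → ℕ) → (ℕ → ℕ) → Arrays → Arrays) : Prop :=
  ∀ s π ρ A N, Represents s π ρ A → (∀ r, π r ≤ N) →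
    ∃ s', Runs p s s' (T N) ∧ Represents s' π ρ (F π ρ A) ∧
      (∀ j < k, s'.reg (scr j) = s.reg (scr j))

theorem Cmd.compile_loop_spec {p : Cmd} {T : ℕ → ℕ}
    (hp : ∀ k, Performs (p.compile k) k T fun π => p.run π) (r : Fin 16) (x k : ℕ) :
    Performs ((Cmd.loop r x p).compile k) k (fun N => N * (T N + 2 + 1) + 1 + 5)
      fun π => (Cmd.loop r x p).run π := by
  intro s π ρ A N h hN
  -- As for sums, but without an accumulator: `k` keeps the outer value of `x`, `k + 1` counts down,
  -- `k + 2` holds the constant 1.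
  let Inv : ℕ → State → Prop := fun m s' => ∃ i, i + m = π r ∧
    Represents s' π (update ρ x i) (iter (fun j A => p.run π (update ρ x j) A) A i) ∧
    (∀ j < k, s'.reg (scr j) = s.reg (scr j)) ∧
    s'.reg (scr k) = ρ x ∧ s'.reg (scr (k + 1)) = m ∧ s'.reg (scr (k + 2)) = 1
  have hstep : ∀ m s', Inv (m + 1) s' → ∃ s'', Inv m s'' ∧
      Runs (.seq (p.compile (k + 3)) <| .seq (.add (2 * x + 1) (2 * x + 1) (scr (k + 2)))
          (.sub (scr (k + 1)) (scr (k + 1)) (scr (k + 2)))) s' s'' (T N + 2) := by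
    rintro m s' ⟨i, hi, hrep, hlow, hsave, hcnt, hone⟩
    obtain ⟨s₁, hr₁, hrep₁, hlow₁⟩ := hp (k + 3) s' π _ _ N hrep hN
    refine ⟨_, ⟨i + 1, by omega, ?_, ?_, ?_, ?_, ?_⟩, hr₁.seq <|
      (runs_add _ _ _ _).seq (runs_sub _ _ _ _)⟩
    · have := (hrep₁.setReg_var x (i + 1)).setReg_scr (k + 1) m
      rw [update_idem] at this
      convert this using 2
      · congr 1
        rw [hrep₁.var, hlow₁ _ (by omega), hone]
        simp
      · simp only [scr_setReg_var]
        rw [hlow₁ _ (by omega), hlow₁ _ (by omega), hcnt, hone]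
        rfl
      · rfl
    · intro j hj
      rw [scr_setReg_scr _ _ (by omega), scr_setReg_var, hlow₁ _ (by omega), hlow j hj]
    · rw [scr_setReg_scr _ _ (by omega), scr_setReg_var, hlow₁ _ (by omega), hsave]
    · simp only [reg_setReg, scr_setReg_var]
      rw [hlow₁ _ (by omega), hlow₁ _ (by omega), hcnt, hone]
      rfl
    · rw [scr_setReg_scr _ _ (by omega), scr_setReg_var, hlow₁ _ (by omega), hone]
  have hinit : Inv (π r) ((((s.setReg (scr k) (ρ x)).setReg
      (scr (k + 1)) (π r)).setReg (2 * x + 1) 0).setReg (scr (k + 2)) 1) := by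
    refine ⟨0, by omega, ?_, ?_, ?_, ?_, ?_⟩
    · exact (((h.setReg_scr _ _).setReg_scr _ _).setReg_var _ _).setReg_scr _ _
    · intro j hj
      rw [scr_setReg_scr _ _ (by omega), scr_setReg_var, scr_setReg_scr _ _ (by omega),
        scr_setReg_scr _ _ (by omega)]
    · rw [scr_setReg_scr _ _ (by omega), scr_setReg_var, scr_setReg_scr _ _ (by omega),
        reg_setReg]
    · rw [scr_setReg_scr _ _ (by omega), scr_setReg_var, reg_setReg]
    · rw [reg_setReg]
  obtain ⟨s₁, ⟨i, hi, hrep, hlow, hsave, -, -⟩, hrun⟩ := runs_loop (r := scr (k + 1)) Inv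
    (fun j s' h => by obtain ⟨i, -, -, -, -, h, -⟩ := h; exact h) hstep _ _ hinit
  have hmul : π r * (T N + 2 + 1) ≤ N * (T N + 2 + 1) := Nat.mul_le_mul_right _ (hN r)
  refine ⟨s₁.setReg (2 * x + 1) (s₁.reg (scr k)), ?_, ?_, ?_⟩
  · refine Runs.mono (.seq (s₁ := s.setReg (scr k) (ρ x)) ?_ <| .seq ?_ <|
      .seq (runs_const _ _ _) <| .seq (runs_const _ _ _) <| .seq hrun (runs_move _ _ _))
      (show 1 + (1 + (1 + (1 + (π r * (T N + 2 + 1) + 1 + 1)))) ≤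
        N * (T N + 2 + 1) + 1 + 5 by omega)
    · convert runs_move s (scr k) (2 * x + 1) using 2
      rw [h.var]
    · convert runs_move _ (scr (k + 1)) (2 * r) using 2
      rw [par_setReg_scr, h.par]
  · have := hrep.setReg_var x (s₁.reg (scr k))
    obtain rfl : i = π r := by omega
    rwa [update_idem, hsave, update_eq_self, ← hsave] at this
  · intro j hj
    rw [scr_setReg_var, hlow j hj]

theorem Cmd.compile_spec (p : Cmd) :
    ∃ T, PolyBounded T ∧ ∀ k, Performs (p.compile k) k T fun π => p.run π := by
  induction p with
  | skip => exact ⟨_, .const 1, fun k s π ρ A N h hN => ⟨_, runs_skip s, h, fun _ _ => rfl⟩⟩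
  | store a i v =>
    obtain ⟨T, hT, hi⟩ := i.compile_spec
    obtain ⟨T', hT', hv⟩ := v.compile_spec
    refine ⟨_, hT.add ((PolyBounded.const 7).add (hT'.add (.const 1))),
      fun k s π ρ A N h hN => ?_⟩
    obtain ⟨s₁, r₁, h₁, l₁, v₁⟩ := hi k s π ρ A N h hN
    obtain ⟨s₂, r₂, h₂, l₂, v₂⟩ := addressProgram_spec a k h₁
    obtain ⟨s₃, r₃, h₃, l₃, v₃⟩ := hv (k + 1) s₂ π ρ A N h₂ hN
    refine ⟨_, r₁.seq (r₂.seq (r₃.seq (runs_store _ _ _))), ?_, fun j hj => ?_⟩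
    · rw [l₃ k (by omega), v₂, v₁, v₃]
      exact h₃.setMem _ _ _
    · rw [reg_setMem, l₃ j (by omega), l₂ j hj, l₁ j hj]
  | seq p q ihp ihq =>
    obtain ⟨T, hT, hp⟩ := ihp
    obtain ⟨T', hT', hq⟩ := ihq
    refine ⟨_, hT.add hT', fun k s π ρ A N h hN => ?_⟩
    obtain ⟨s₁, r₁, h₁, l₁⟩ := hp k s π ρ A N h hN
    obtain ⟨s₂, r₂, h₂, l₂⟩ := hq k s₁ π ρ _ N h₁ hN
    exact ⟨s₂, r₁.seq r₂, h₂, fun j hj => (l₂ j hj).trans (l₁ j hj)⟩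
  | ite c p q ihp ihq =>
    obtain ⟨Tc, hTc, hc⟩ := c.compile_spec
    obtain ⟨T, hT, hp⟩ := ihp
    obtain ⟨T', hT', hq⟩ := ihq
    refine ⟨_, hTc.add ((hT.add hT').add (.const 1)), fun k s π ρ A N h hN => ?_⟩
    obtain ⟨s₁, r₁, h₁, l₁, v₁⟩ := hc k s π ρ A N h hN
    by_cases hv : c.eval π A ρ = 0
    · obtain ⟨s₂, r₂, h₂, l₂⟩ := hq k s₁ π ρ A N h₁ hN
      refine ⟨s₂, r₁.seq (.ite (fun h => absurd (v₁.trans hv) h) fun _ => r₂.mono (by omega)), ?_,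
        fun j hj => (l₂ j hj).trans (l₁ j hj)⟩
      simpa [Cmd.run, hv] using h₂
    · obtain ⟨s₂, r₂, h₂, l₂⟩ := hp k s₁ π ρ A N h₁ hN
      refine ⟨s₂, r₁.seq (.ite (fun _ => r₂.mono (by omega)) fun h => absurd (v₁.symm.trans h) hv),
        ?_, fun j hj => (l₂ j hj).trans (l₁ j hj)⟩
      simpa [Cmd.run, hv] using h₂
  | loop r x p ih =>
    obtain ⟨T, hT, hp⟩ := ih
    exact ⟨_, ((PolyBounded.id.mul ((hT.add (.const 2)).add (.const 1))).add (.const 1)).add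
      (.const 5), fun k => compile_loop_spec hp r x k⟩
  | letin x e p ih =>
    obtain ⟨T, hT, he⟩ := e.compile_spec
    obtain ⟨T', hT', hp⟩ := ih
    refine ⟨_, hT.add ((PolyBounded.const 1).add ((PolyBounded.const 1).add
      (hT'.add (.const 1)))), fun k s π ρ A N h hN => ?_⟩
    obtain ⟨s₁, r₁, h₁, l₁, v₁⟩ := he k s π ρ A N h hN
    obtain ⟨s₂, r₂, h₂, l₂⟩ := hp (k + 2)
      ((s₁.setReg (scr (k + 1)) (s₁.reg (2 * x + 1))).setReg (2 * x + 1) (e.eval π A ρ)) π _ A N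
      ((h₁.setReg_scr _ _).setReg_var _ _) hN
    refine ⟨_, r₁.seq ((runs_move _ _ _).seq (.seq ?_ (r₂.seq (runs_move _ _ _)))), ?_,
      fun j hj => ?_⟩
    · convert runs_move (s₁.setReg (scr (k + 1)) (s₁.reg (2 * x + 1))) (2 * x + 1) (scr k) using 2
      rw [scr_setReg_scr _ _ (by omega), v₁]
    · have := h₂.setReg_var x (s₂.reg (scr (k + 1)))
      rw [l₂ _ (by omega), scr_setReg_var, reg_setReg, h₁.var, update_idem, update_eq_self] at this
      rwa [l₂ _ (by omega), scr_setReg_var, reg_setReg, h₁.var]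
    · rw [scr_setReg_var, l₂ j (by omega), scr_setReg_var, scr_setReg_scr _ _ (by omega), l₁ j hj]

/-! ### Sequences of phases with changing loop bounds -/

/-- A phase of a program either transforms the arrays or sets a parameter other than `0`. -/
inductive Phase where
  | cmd (p : Cmd)
  | set (r : Fin 15) (e : Expr)

/-- The effect of a phase on parameters and arrays; variables are `0` initially. -/
def Phase.run : Phase → (Fin 16 → ℕ) × Arrays → (Fin 16 → ℕ) × Arrays
  | .cmd p, (π, A) => (π, p.run π (fun _ => 0) A)
  | .set r e, (π, A) => (update π r.succ (e.eval π A fun _ => 0), A)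

def runPhases : List Phase → (Fin 16 → ℕ) × Arrays → (Fin 16 → ℕ) × Arrays
  | [], x => x
  | f :: l, x => runPhases l (f.run x)

/-- No parameter ever exceeds `N`. -/
def BoundedBy (N : ℕ) : List Phase → (Fin 16 → ℕ) × Arrays → Prop
  | [], x => ∀ r, x.1 r ≤ N
  | f :: l, x => (∀ r, x.1 r ≤ N) ∧ BoundedBy N l (f.run x)

theorem Phase.exists_program (f : Phase) : ∃ (p : Program) (T : ℕ → ℕ), PolyBounded T ∧
    ∀ s π A N, Represents s π (fun _ => 0) A → (∀ r, π r ≤ N) →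
      ∃ s', Runs p s s' (T N) ∧ Represents s' (f.run (π, A)).1 (fun _ => 0) (f.run (π, A)).2 := by
  cases f with
  | cmd p =>
    obtain ⟨T, hT, h⟩ := p.compile_spec
    refine ⟨p.compile 0, T, hT, fun s π A N hs hN => ?_⟩
    obtain ⟨s', h1, h2, -⟩ := h 0 s π _ A N hs hN
    exact ⟨s', h1, h2⟩
  | set r e =>
    obtain ⟨T, hT, h⟩ := e.compile_spec
    refine ⟨.seq (e.compile 0) (.move (2 * r.succ) (scr 0)), _, hT.add (.const 1),
      fun s π A N hs hN => ?_⟩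
    obtain ⟨s', h1, h2, -, h4⟩ := h 0 s π _ A N hs hN
    refine ⟨_, h1.seq (runs_move _ _ _), ?_, ?_, ?_⟩
    · intro q
      simp only [Phase.run]
      by_cases hq : q = r.succ
      · subst hq
        simp [h4]
      · have := Fin.val_ne_of_ne hq
        rw [reg_setReg_of_ne _ _ (by omega), update_of_ne hq, h2.par]
    · intro x
      rw [reg_setReg_of_ne _ _ (by omega), h2.var]
    · intro a x
      simp only [Phase.run]
      -- All array addresses are relative to parameter 0, which therefore must not change.
      rw [mem_setReg, update_of_ne (Fin.succ_ne_zero r).symm, h2.arr]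

theorem exists_program_phases (l : List Phase) : ∃ (p : Program) (T : ℕ → ℕ), PolyBounded T ∧
    ∀ s π A N, Represents s π (fun _ => 0) A → BoundedBy N l (π, A) →
      ∃ s', Runs p s s' (T N) ∧
        Represents s' (runPhases l (π, A)).1 (fun _ => 0) (runPhases l (π, A)).2 := by
  induction l with
  | nil => exact ⟨.skip, _, .const 1, fun s π A N hs hN => ⟨s, runs_skip s, hs⟩⟩
  | cons f l ih =>
    obtain ⟨p, T, hT, hp⟩ := f.exists_program
    obtain ⟨q, T', hT', hq⟩ := ih
    refine ⟨.seq p q, _, hT.add hT', fun s π A N hs hN => ?_⟩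
    obtain ⟨s₁, h₁, r₁⟩ := hp s π A N hs hN.1
    obtain ⟨s₂, h₂, r₂⟩ := hq s₁ _ _ N r₁ hN.2
    exact ⟨s₂, h₁.seq h₂, r₂⟩

end ArrayLang

/-! ### Minimum cost assignments by an auction -/

namespace Auction

open Function

/-- The invariants of the auction: `v p o` is the cost for person `p < P` of object `o < O`,
`owner o = p + 1` if `p` holds `o`, and `owner o = 0` if nobody holds `o`. -/
structure Invariant (P O C : ℕ) (v : ℕ → ℕ → ℕ) (price owner : ℕ → ℕ) : Prop where
  free : ∀ o < O, owner o = 0 → price o = 0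
  inj : ∀ o < O, ∀ o' < O, owner o ≠ 0 → owner o = owner o' → o = o'
  le : ∀ o < O, owner o ≤ P
  slack : ∀ p, ∀ o < O, owner o = p + 1 → ∀ o' < O, v p o + price o ≤ v p o' + price o' + 1
  bound : ∀ o < O, price o ≤ C + 1

theorem Invariant.init (P O C : ℕ) (v : ℕ → ℕ → ℕ) {price owner : ℕ → ℕ}
    (hp : ∀ o < O, price o = 0) (ho : ∀ o < O, owner o = 0) :
    Invariant P O C v price owner where
  free o h _ := hp o h
  inj o h _ _ h' := absurd (ho o h) h'
  le o h := by simp [ho o h]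
  slack p o h h' := by simp [ho o h] at h'
  bound o h := by simp [hp o h]

variable {P O C : ℕ} {v : ℕ → ℕ → ℕ} {price owner : ℕ → ℕ}

/-- If every object were owned, the `O ≥ P` objects would have different owners among the at most `P
- 1` persons other than `p`. -/
theorem Invariant.exists_free (h : Invariant P O C v price owner) (hPO : P ≤ O) {p : ℕ}
    (hp : p < P) (hfree : ∀ o < O, owner o ≠ p + 1) : ∃ o < O, owner o = 0 := by
  by_contra! hne
  have hcard : (Finset.range O).card ≤ ((Finset.Icc 1 P).erase (p + 1)).card := by
    refine Finset.card_le_card_of_injOn owner (fun o ho => ?_) (fun o ho o' ho' e => ?_)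
    · have ho : o < O := by simpa using ho
      have := hne o ho
      have := h.le o ho
      have := hfree o ho
      simp
      omega
    · have ho : o < O := by simpa using ho
      have ho' : o' < O := by simpa using ho'
      exact h.inj o ho o' ho' (hne o ho) e
  rw [Finset.card_erase_of_mem (by simp; omega)] at hcard
  simp at hcard
  omega

/-- The bidder takes a cheapest object, so raising its price by one leaves a slack of at most one.
For the owners of other objects the raise only relaxes the condition, and the previous owner of `o`
drops out. -/
theorem Invariant.step (h : Invariant P O C v price owner) (hPO : P ≤ O)
    (hC : ∀ p < P, ∀ o < O, v p o ≤ C) {p o : ℕ} (hp : p < P) (ho : o < O)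
    (hfree : ∀ o < O, owner o ≠ p + 1)
    (hmin : ∀ o' < O, v p o + price o ≤ v p o' + price o') :
    Invariant P O C v (update price o (price o + 1)) (update owner o (p + 1)) where
  free o' h' := by
    by_cases e : o' = o
    · simp [e]
    · simpa [update_of_ne e] using h.free o' h'
  inj o₁ h₁ o₂ h₂ := by
    by_cases e₁ : o₁ = o <;> by_cases e₂ : o₂ = o
    · simp [e₁, e₂]
    · subst e₁
      simp only [update_self, update_of_ne e₂]
      exact fun _ e => absurd e.symm (hfree o₂ h₂)
    · subst e₂
      simp only [update_self, update_of_ne e₁]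
      exact fun _ e => absurd e (hfree o₁ h₁)
    · simp only [update_of_ne e₁, update_of_ne e₂]
      exact h.inj o₁ h₁ o₂ h₂
  le o' h' := by
    by_cases e : o' = o
    · simp [e]
      omega
    · simpa [update_of_ne e] using h.le o' h'
  slack q o₁ h₁ hq o₂ h₂ := by
    have key : price o₂ ≤ update price o (price o + 1) o₂ := by
      by_cases e : o₂ = o
      · simp [e]
      · simp [update_of_ne e]
    by_cases e : o₁ = o
    · subst e
      obtain rfl : p = q := by simpa using hq
      have := hmin o₂ h₂
      simp only [update_self]
      omega
    · rw [update_of_ne e] at hq ⊢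
      have := h.slack q o₁ h₁ hq o₂ h₂
      omega
  bound o' h' := by
    by_cases e : o' = o
    · subst e
      -- A free object has price 0 and would cost the bidder at most `C`. The chosen object is no
      -- worse, so its price before the raise was at most `C`.
      obtain ⟨o₂, h₂, e₂⟩ := h.exists_free hPO hp hfree
      have h3 := hmin o₂ h₂
      have h4 := hC p hp o₂ h₂
      rw [h.free o₂ h₂ e₂] at h3
      simp only [update_self]
      omega
    · simpa [update_of_ne e] using h.bound o' h'

theorem sum_update_add_one (price : ℕ → ℕ) {o : ℕ} (ho : o < O) :
    ∑ x ∈ Finset.range O, update price o (price o + 1) x =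
      ∑ x ∈ Finset.range O, price x + 1 := by
  have ho : o ∈ Finset.range O := by simpa using ho
  rw [Finset.sum_update_of_mem ho, ← Finset.add_sum_erase _ _ ho, Finset.sdiff_singleton_eq_erase]
  omega

/-- After enough rounds every person holds an object. -/
theorem Invariant.terminates (hPO : P ≤ O) (hC : ∀ p < P, ∀ o < O, v p o ≤ C)
    (price owner : ℕ → ℕ → ℕ) (hp : ∀ o < O, price 0 o = 0) (ho : ∀ o < O, owner 0 o = 0)
    (hdone : ∀ t, (∀ p < P, ∃ o < O, owner t o = p + 1) →
      price (t + 1) = price t ∧ owner (t + 1) = owner t)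
    (hstep : ∀ t, (∃ p < P, ∀ o < O, owner t o ≠ p + 1) →
      ∃ p < P, (∀ o < O, owner t o ≠ p + 1) ∧ ∃ o < O,
        (∀ o' < O, v p o + price t o ≤ v p o' + price t o') ∧
        price (t + 1) = update (price t) o (price t o + 1) ∧
        owner (t + 1) = update (owner t) o (p + 1))
    {t : ℕ} (ht : O * (C + 1) < t) :
    Invariant P O C v (price t) (owner t) ∧ ∀ p < P, ∃ o < O, owner t o = p + 1 := by
  -- While somebody is unassigned, every round raises the sum of prices by exactly one, so this sum
  -- counts the rounds; it never exceeds `O * (C + 1)`.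
  have key : ∀ t, Invariant P O C v (price t) (owner t) ∧
      ((∀ p < P, ∃ o < O, owner t o = p + 1) ∨ ∑ o ∈ Finset.range O, price t o = t) := by
    intro t
    induction t with
    | zero =>
      exact ⟨.init P O C v hp ho, .inr (Finset.sum_eq_zero fun o h => hp o (by simpa using h))⟩
    | succ t ih =>
      obtain ⟨hinv, hs⟩ := ih
      by_cases hall : ∀ p < P, ∃ o < O, owner t o = p + 1
      · rw [(hdone t hall).1, (hdone t hall).2]
        exact ⟨hinv, .inl hall⟩
      · have hs := hs.resolve_left hall
        push Not at hall
        obtain ⟨p, hp, hfree, o, ho, hmin, e₁, e₂⟩ := hstep t hall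
        rw [e₁, e₂, sum_update_add_one _ ho, hs]
        exact ⟨hinv.step hPO hC hp ho hfree hmin, .inr rfl⟩
  obtain ⟨hinv, hs⟩ := key t
  refine ⟨hinv, hs.resolve_right fun hs => ?_⟩
  have : ∑ o ∈ Finset.range O, price t o ≤ ∑ o ∈ Finset.range O, (C + 1) :=
    Finset.sum_le_sum fun o h => hinv.bound o (by simpa using h)
  simp at this
  omega

/-- The final assignment is optimal up to the number of persons. -/
theorem Invariant.optimal (h : Invariant P O C v price owner) {α σ : ℕ → ℕ}
    (hα : ∀ p < P, α p < O ∧ owner (α p) = p + 1) (hσ : ∀ p < P, σ p < O)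
    (hinj : Set.InjOn σ (Set.Iio P)) :
    ∑ p ∈ Finset.range P, v p (α p) ≤ ∑ p ∈ Finset.range P, v p (σ p) + P := by
  have h1 : ∑ p ∈ Finset.range P, (v p (α p) + price (α p)) ≤
      ∑ p ∈ Finset.range P, (v p (σ p) + price (σ p) + 1) := by
    refine Finset.sum_le_sum fun p hp => ?_
    have hp : p < P := by simpa using hp
    exact h.slack p _ (hα p hp).1 (hα p hp).2 _ (hσ p hp)
  -- Objects that `α` does not use are free and have price 0, so the objects of `α` carry the whole
  -- price sum.
  have h2 : ∑ o ∈ Finset.range O, price o ≤ ∑ p ∈ Finset.range P, price (α p) := by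
    rw [← Finset.sum_image (f := price) (g := α)]
    · refine (Finset.sum_subset ?_ ?_).ge
      · intro o ho
        obtain ⟨p, hp, rfl⟩ := Finset.mem_image.1 ho
        simpa using (hα p (by simpa using hp)).1
      · intro o ho hno
        have ho : o < O := by simpa using ho
        refine h.free o ho ?_
        by_contra hne
        obtain ⟨p, hp⟩ := Nat.exists_eq_succ_of_ne_zero hne
        have hpP : p < P := by have := h.le o ho; omega
        refine hno (Finset.mem_image.2 ⟨p, by simpa using hpP, ?_⟩)
        exact h.inj _ (hα p hpP).1 o ho (by rw [(hα p hpP).2]; omega) ((hα p hpP).2.trans hp.symm)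
    · intro p hp q hq e
      have := (hα p (by simpa using hp)).2
      rw [e, (hα q (by simpa using hq)).2] at this
      omega
  have h3 : ∑ p ∈ Finset.range P, price (σ p) ≤ ∑ o ∈ Finset.range O, price o := by
    rw [← Finset.sum_image (f := price) (g := σ) (by simpa using hinj)]
    refine Finset.sum_le_sum_of_subset fun o ho => ?_
    obtain ⟨p, hp, rfl⟩ := Finset.mem_image.1 ho
    simpa using hσ p (by simpa using hp)
  simp only [Finset.sum_add_distrib, Finset.sum_const, Finset.card_range, smul_eq_mul,
    mul_one] at h1
  omega

end Auction

/-! ### Reduction to assignment problems -/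

namespace PrefGraph

open Relation

variable {n : ℕ} (G : PrefGraph n)

/-- Arcs between vertices that are not junctions. They form disjoint paths. -/
def Inner (u v : Fin n) : Prop := (u, v) ∈ G.arcs ∧ u ∉ G.junctions ∧ v ∉ G.junctions

def Chain (u v : Fin n) : Prop := ReflTransGen G.Inner u v

def Walk (u v : Fin n) : Prop := ReflTransGen (fun x y => (x, y) ∈ G.arcs) u v

/-- The first vertex of a path of inner arcs. -/
def IsHead (h : Fin n) : Prop := h ∈ G.verts ∧ ∀ u, ¬ G.Inner u h

/-- The path through `v` is the junction `l` itself or ends with an arc to `l`. -/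
def Leads (v l : Fin n) : Prop := v = l ∨ ∃ t, G.Chain v t ∧ t ∉ G.junctions ∧ (t, l) ∈ G.arcs

/-- `v` is reachable from `L`. -/
def Covered (L : Finset (Fin n)) (v : Fin n) : Prop := ∃ l ∈ L, G.Walk l v

open Classical in
/-- The cost of giving to the path with head `h` an item (left) or a substitute (right), if exactly
the vertices reachable from `L` need not be counted and every element of `L` has to be dominated
by means of a path leading to it. The value `M` stands for forbidden pairs. -/
noncomputable def agentCost (L : Finset (Fin n)) (M : ℕ) (h : Fin n) : Fin n ⊕ Fin n → ℕ
  | .inl v => if G.IsHead h ∧ G.Chain h v then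
      (Finset.univ.filter fun u => G.Chain h u ∧ G.Chain u v ∧ u ≠ v ∧ ¬ G.Covered L u).card else M
  | .inr u => if u ∉ L ∧ (u = h ∨ ∃ l ∈ L, G.Leads h l ∧ G.Leads u l) then
      if G.IsHead h then (Finset.univ.filter fun u => G.Chain h u ∧ ¬ G.Covered L u).card else 0
    else M

variable {G}

theorem left_mem {u v : Fin n} (h : (u, v) ∈ G.arcs) : u ∈ G.verts :=
  (Finset.mem_product.1 (G.arcs_subset h)).1

theorem right_mem {u v : Fin n} (h : (u, v) ∈ G.arcs) : v ∈ G.verts :=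
  (Finset.mem_product.1 (G.arcs_subset h)).2

theorem arc_right_unique {t a b : Fin n} (ht : t ∉ G.junctions) (ha : (t, a) ∈ G.arcs)
    (hb : (t, b) ∈ G.arcs) : a = b := by
  by_contra hab
  refine ht (Finset.mem_filter.2 ⟨left_mem ha, .inr (Finset.one_lt_card.2 ?_)⟩)
  exact ⟨_, Finset.mem_filter.2 ⟨ha, rfl⟩, _, Finset.mem_filter.2 ⟨hb, rfl⟩, by simp [hab]⟩

theorem arc_left_unique {t a b : Fin n} (ht : t ∉ G.junctions) (ha : (a, t) ∈ G.arcs)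
    (hb : (b, t) ∈ G.arcs) : a = b := by
  by_contra hab
  refine ht (Finset.mem_filter.2 ⟨right_mem ha, .inl (Finset.one_lt_card.2 ?_)⟩)
  exact ⟨_, Finset.mem_filter.2 ⟨ha, rfl⟩, _, Finset.mem_filter.2 ⟨hb, rfl⟩, by simp [hab]⟩

theorem Chain.walk {u v : Fin n} (h : G.Chain u v) : G.Walk u v :=
  ReflTransGen.mono (fun _ _ h => h.1) _ _ h

/-- Inner arcs start at non-junctions, so a path can be continued in only one way. -/
theorem Chain.total_right {a b c : Fin n} (hb : G.Chain a b) (hc : G.Chain a c) :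
    G.Chain b c ∨ G.Chain c b :=
  ReflTransGen.total_of_right_unique (fun _ _ _ h h' => arc_right_unique h.2.1 h.1 h'.1) hb hc

theorem Chain.total_left {a b c : Fin n} (hb : G.Chain b a) (hc : G.Chain c a) :
    G.Chain b c ∨ G.Chain c b := by
  have := ReflTransGen.total_of_right_unique (r := Function.swap G.Inner)
    (fun _ _ _ h h' => arc_left_unique h.2.2 h.1 h'.1) (reflTransGen_swap.2 hb)
    (reflTransGen_swap.2 hc)
  exact (this.imp reflTransGen_swap.1 reflTransGen_swap.1).symm

/-- Inner arcs avoid junctions, so a junction is a path by itself. -/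
theorem Chain.eq_of_left_junction {a b : Fin n} (h : G.Chain a b) (ha : a ∈ G.junctions) :
    a = b := by
  rcases ReflTransGen.cases_head h with h | ⟨c, h, -⟩
  · exact h
  · exact absurd ha h.2.1

theorem Chain.eq_of_right_junction {a b : Fin n} (h : G.Chain a b) (hb : b ∈ G.junctions) :
    a = b := by
  rcases ReflTransGen.cases_tail h with h | ⟨c, -, h⟩
  · exact h.symm
  · exact absurd hb h.2.2

/-- The only arc leaving `t` goes to a junction and is not inner, so the path ends at `t`. -/
theorem Chain.eq_of_exit {t l v : Fin n} (h : G.Chain t v) (ht : t ∉ G.junctions)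
    (hl : l ∈ G.junctions) (harc : (t, l) ∈ G.arcs) : t = v := by
  rcases ReflTransGen.cases_head h with h | ⟨c, h, -⟩
  · exact h
  · exact absurd (arc_right_unique ht h.1 harc ▸ hl) h.2.2

theorem Walk.antisymm {u v : Fin n} (h : G.Walk u v) (h' : G.Walk v u) : u = v := by
  rcases reflTransGen_iff_eq_or_transGen.1 h with e | e
  · exact e.symm
  · exact absurd (e.trans_left h') (G.acyclic u)

theorem Chain.mem_verts {u v : Fin n} (h : G.Chain u v) (hu : u ∈ G.verts) : v ∈ G.verts := by
  rcases ReflTransGen.cases_tail h with e | ⟨c, -, h⟩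
  · exact e ▸ hu
  · exact right_mem h.1

theorem IsHead.eq_of_chain {h v : Fin n} (hh : G.IsHead h) (hc : G.Chain v h) : v = h := by
  rcases ReflTransGen.cases_tail hc with e | ⟨c, -, e⟩
  · exact e.symm
  · exact absurd e (hh.2 c)

theorem IsHead.unique {h h' v : Fin n} (hh : G.IsHead h) (hh' : G.IsHead h') (hc : G.Chain h v)
    (hc' : G.Chain h' v) : h = h' := by
  rcases hc.total_left hc' with e | e
  · exact hh'.eq_of_chain e
  · exact (hh.eq_of_chain e).symm

/-- Going back along inner arcs terminates, because the graph is finite and acyclic. -/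
theorem exists_isHead {v : Fin n} (hv : v ∈ G.verts) : ∃ h, G.IsHead h ∧ G.Chain h v := by
  have hwf : WellFounded (TransGen fun x y => (x, y) ∈ G.arcs) :=
    haveI : Std.Irrefl (TransGen fun x y => (x, y) ∈ G.arcs) := ⟨G.acyclic⟩
    Finite.wellFounded_of_trans_of_irrefl _
  induction v using hwf.induction with
  | h v ih =>
    by_cases hh : ∀ u, ¬ G.Inner u v
    · exact ⟨v, ⟨hv, hh⟩, .refl⟩
    · push Not at hh
      obtain ⟨u, hu⟩ := hh
      obtain ⟨h, h1, h2⟩ := ih u (.single hu.1) (left_mem hu.1)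
      exact ⟨h, h1, ReflTransGen.tail h2 hu⟩

/-- Two exits from the path through `v` would both be its last vertex, and that vertex has only one
outgoing arc. -/
theorem Leads.unique {v l l' : Fin n} (hl : l ∈ G.junctions) (hl' : l' ∈ G.junctions)
    (h : G.Leads v l) (h' : G.Leads v l') : l = l' := by
  rcases h with rfl | ⟨t, h1, h2, h3⟩ <;> rcases h' with rfl | ⟨t', h1', h2', h3'⟩
  · rfl
  · exact absurd hl (h1'.eq_of_left_junction hl ▸ h2')
  · exact absurd hl' (h1.eq_of_left_junction hl' ▸ h2)
  · have : t = t' := by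
      rcases h1.total_right h1' with e | e
      · exact e.eq_of_exit h2 hl h3
      · exact (e.eq_of_exit h2' hl' h3').symm
    subst this
    exact arc_right_unique h2 h3 h3'

theorem Leads.of_chain {h v l : Fin n} (hl : l ∈ G.junctions) (hc : G.Chain h v)
    (hv : G.Leads v l) : G.Leads h l := by
  rcases hv with rfl | ⟨t, h1, h2, h3⟩
  · exact .inl (hc.eq_of_right_junction hl)
  · exact .inr ⟨t, ReflTransGen.trans hc h1, h2, h3⟩

theorem Leads.walk {h v l : Fin n} (hl : l ∈ G.junctions) (hc : G.Chain h v)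
    (hh : G.Leads h l) : G.Walk v l := by
  rcases hh with rfl | ⟨t, h1, h2, h3⟩
  · exact hc.eq_of_left_junction hl ▸ .refl
  · rcases h1.total_right hc with e | e
    · exact e.eq_of_exit h2 hl h3 ▸ .single h3
    · exact e.walk.tail h3

/-- A walk stays on a path or passes through the junction to which the path leads. -/
theorem Walk.chain_or_leads {w u : Fin n} (h : G.Walk w u) :
    G.Chain w u ∨ ∃ l ∈ G.junctions, G.Leads w l ∧ G.Walk l u := by
  induction h using ReflTransGen.head_induction_on with
  | refl => exact .inl .refl
  | @head w w' harc hwalk ih =>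
    by_cases hw : w ∈ G.junctions
    · exact .inr ⟨w, hw, .inl rfl, .head harc hwalk⟩
    by_cases hw' : w' ∈ G.junctions
    · exact .inr ⟨w', hw', .inr ⟨w, .refl, hw, harc⟩, hwalk⟩
    have hi : G.Inner w w' := ⟨harc, hw, hw'⟩
    rcases ih with ih | ⟨l, hl, hlead, hlu⟩
    · exact .inl (.head hi ih)
    · exact .inr ⟨l, hl, hlead.of_chain hl (.single hi), hlu⟩

theorem dominated_iff {u v : Fin n} (hu : u ∈ G.verts) (hv : v ∈ G.verts) :
    G.Dominated u v ↔ G.Walk v u := by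
  unfold Dominated pred Reaches Walk
  constructor
  · rintro ⟨-, -, rfl | ⟨-, -, -, h⟩⟩
    · exact .refl
    · exact h
  · intro h
    by_cases e : u = v
    · exact ⟨hu, hv, .inl e⟩
    · exact ⟨hu, hv, .inr ⟨Ne.symm e, hv, hu, h⟩⟩

theorem Walk.mem_left {u v : Fin n} (h : G.Walk u v) (hv : v ∈ G.verts) : u ∈ G.verts := by
  rcases ReflTransGen.cases_head h with rfl | ⟨c, h, -⟩
  · exact hv
  · exact left_mem h

/-! ### Dissatisfaction of one agent as the cost of an assignment -/

open Classical in
theorem dissatisfaction_eq (S : Finset (Fin n)) :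
    G.dissatisfaction S = (G.verts.filter fun u => ∀ v ∈ S, ¬ G.Walk v u).card := by
  unfold dissatisfaction
  congr 1
  refine Finset.filter_congr fun u hu => ?_
  push Not
  refine forall₂_congr fun v _ => not_congr ?_
  constructor
  · intro h
    exact (dominated_iff hu h.2.1).1 h
  · intro h
    exact (dominated_iff hu (h.mem_left hu)).2 h

theorem junctions_subset : G.junctions ⊆ G.verts := Finset.filter_subset _ _

open Classical in
/-- An assignment without forbidden pairs bounds the dissatisfaction. -/
theorem dissatisfaction_le {L : Finset (Fin n)} (hL : L ⊆ G.junctions) {M : ℕ}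
    {σ : Fin n → Fin n ⊕ Fin n} (hσ : Function.Injective σ)
    (hM : ∀ h, G.agentCost L M h (σ h) < M) :
    G.dissatisfaction (Finset.univ.filter fun v => ∃ h, σ h = .inl v) ≤
      ∑ h, G.agentCost L M h (σ h) := by
  have hitem : ∀ h v, σ h = .inl v → G.IsHead h ∧ G.Chain h v := by
    intro h v e
    by_contra hne
    have := hM h
    rw [e, agentCost, if_neg hne] at this
    exact lt_irrefl _ this
  have hsub : ∀ h u, σ h = .inr u → u ∉ L ∧ (u = h ∨ ∃ l ∈ L, G.Leads h l ∧ G.Leads u l) := by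
    intro h u e
    by_contra hne
    have := hM h
    rw [e, agentCost, if_neg hne] at this
    exact lt_irrefl _ this
  -- Pigeonhole: if no assigned item reached `l`, all vertices leading to `l`, including `l` itself,
  -- would hold different substitutes from among these vertices, but the substitute of `l` is
  -- withdrawn.
  have hdom : ∀ l ∈ L, ∃ h v, σ h = .inl v ∧ G.Walk v l := by
    intro l hl
    by_contra! hno
    have hlead : ∀ h, G.Leads h l → ∃ u, σ h = .inr u ∧ u ∉ L ∧ G.Leads u l := by
      intro h hh
      cases e : σ h with
      | inl v => exact absurd (hh.walk (hL hl) (hitem h v e).2) (hno h v e)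
      | inr u =>
        obtain ⟨h1, rfl | ⟨l', h2, h3, h4⟩⟩ := hsub h u e
        · exact ⟨_, rfl, h1, hh⟩
        -- A path leads to one junction only, so an exchange at `l'` is an exchange at `l`.
        · obtain rfl := hh.unique (hL hl) (hL h2) h3
          exact ⟨u, rfl, h1, h4⟩
    choose! f hf1 hf2 hf3 using hlead
    have : (Finset.univ.filter fun h => G.Leads h l).card ≤
        ((Finset.univ.filter fun h => G.Leads h l).erase l).card := by
      refine Finset.card_le_card_of_injOn f (fun h hh => ?_) fun h hh h' hh' e => ?_
      · have hh : G.Leads h l := by simpa using hh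
        simp only [Finset.coe_erase, Finset.coe_filter, Finset.mem_univ, true_and, Set.mem_sdiff,
          Set.mem_ofPred_eq, Set.mem_singleton_iff]
        exact ⟨hf3 h hh, fun e => hf2 h hh (e ▸ hl)⟩
      · have hh : G.Leads h l := by simpa using hh
        have hh' : G.Leads h' l := by simpa using hh'
        exact hσ ((hf1 h hh).trans (e ▸ (hf1 h' hh').symm))
    have hmem : l ∈ Finset.univ.filter fun h => G.Leads h l :=
      Finset.mem_filter.2 ⟨Finset.mem_univ _, .inl rfl⟩
    have := Finset.card_erase_lt_of_mem hmem
    omega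
  rw [dissatisfaction_eq]
  set U := G.verts.filter fun u => ∀ v ∈ Finset.univ.filter fun v => ∃ h, σ h = .inl v,
    ¬ G.Walk v u with hU
  -- Each element of `L` is dominated by an assigned item, hence so is everything reachable from it.
  have hcov : ∀ u ∈ U, ¬ G.Covered L u := by
    rintro u hu ⟨l, hl, hlu⟩
    obtain ⟨h, v, e, hv⟩ := hdom l hl
    exact (Finset.mem_filter.1 hu).2 v (by simpa using ⟨h, e⟩) (hv.trans hlu)
  -- Every undominated vertex is charged to the head of its path.
  have hle : ∀ h, (U.filter fun u => G.IsHead h ∧ G.Chain h u).card ≤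
      G.agentCost L M h (σ h) := by
    intro h
    by_cases hh : G.IsHead h
    · cases e : σ h with
      | inl v =>
        rw [agentCost, if_pos (hitem h v e)]
        refine Finset.card_le_card fun u hu => ?_
        obtain ⟨hu, -, hc⟩ := Finset.mem_filter.1 hu
        have hvu : ¬ G.Walk v u := (Finset.mem_filter.1 hu).2 v (by simpa using ⟨h, e⟩)
        refine Finset.mem_filter.2 ⟨Finset.mem_univ _, hc, ?_, ?_, hcov u hu⟩
        · exact (hc.total_right (hitem h v e).2).resolve_right fun h => hvu h.walk
        · rintro rfl
          exact hvu .refl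
      | inr v =>
        rw [agentCost, if_pos (hsub h v e), if_pos hh]
        refine Finset.card_le_card fun u hu => ?_
        obtain ⟨hu, -, hc⟩ := Finset.mem_filter.1 hu
        exact Finset.mem_filter.2 ⟨Finset.mem_univ _, hc, hcov u hu⟩
    · simp [hh]
  calc U.card ≤ (Finset.univ.biUnion fun h => U.filter fun u => G.IsHead h ∧ G.Chain h u).card := by
        refine Finset.card_le_card fun u hu => ?_
        obtain ⟨h, hh⟩ := exists_isHead (Finset.mem_filter.1 hu).1
        exact Finset.mem_biUnion.2 ⟨h, Finset.mem_univ _, Finset.mem_filter.2 ⟨hu, hh⟩⟩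
    _ ≤ ∑ h, (U.filter fun u => G.IsHead h ∧ G.Chain h u).card := Finset.card_biUnion_le
    _ ≤ _ := Finset.sum_le_sum fun h _ => hle h

/-- The vertices on a path from `h` are linearly ordered, so an element of `S` that is minimal for
reachability precedes all the others. -/
theorem exists_first {h : Fin n} {S : Finset (Fin n)} (hS : ∃ v ∈ S, G.Chain h v) :
    ∃ v ∈ S, G.Chain h v ∧ ∀ w ∈ S, G.Chain h w → G.Chain v w := by
  have hwf : WellFounded (TransGen fun x y => (x, y) ∈ G.arcs) :=
    haveI : Std.Irrefl (TransGen fun x y => (x, y) ∈ G.arcs) := ⟨G.acyclic⟩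
    Finite.wellFounded_of_trans_of_irrefl _
  obtain ⟨v, hv, hmin⟩ := hwf.has_min {v | v ∈ S ∧ G.Chain h v} hS
  refine ⟨v, hv.1, hv.2, fun w hw hc => ?_⟩
  rcases hv.2.total_right hc with e | e
  · exact e
  · rcases reflTransGen_iff_eq_or_transGen.1 e.walk with rfl | e
    · exact .refl
    · exact absurd e (hmin w ⟨hw, hc⟩)

open Classical in
/-- The dissatisfaction with a set of items is attained by an assignment. -/
theorem exists_assignment (G : PrefGraph n) (S : Finset (Fin n)) (M : ℕ) :
    ∃ L ⊆ G.junctions, ∃ σ : Fin n → Fin n ⊕ Fin n, Function.Injective σ ∧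
      (∀ h v, σ h = .inl v → v ∈ S) ∧
      ∑ h, G.agentCost L M h (σ h) ≤ G.dissatisfaction S := by
  set L := G.junctions.filter fun l => ∃ v ∈ S, v ∈ G.verts ∧ G.Leads v l with hLdef
  have hL : L ⊆ G.junctions := Finset.filter_subset _ _
  let Gets : Fin n → Prop := fun h => G.IsHead h ∧ ∃ v ∈ S, G.Chain h v
  have hfirst : ∀ h, Gets h → ∃ v ∈ S, G.Chain h v ∧ ∀ w ∈ S, G.Chain h w → G.Chain v w :=
    fun h hh => exists_first hh.2
  choose! item hitemS hitemC hitemF using hfirst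
  have hwit : ∀ l ∈ L, ∃ h, Gets h ∧ G.Leads h l := by
    intro l hl
    obtain ⟨hJ, v, hvS, hvV, hlead⟩ := Finset.mem_filter.1 hl
    obtain ⟨h, hh, hc⟩ := exists_isHead hvV
    exact ⟨h, ⟨hh, v, hvS, hc⟩, hlead.of_chain hJ hc⟩
  choose! wit hwitG hwitL using hwit
  -- A witness in `L` would be a junction, which leads only to itself; so it would be `l`, which
  -- gets no item.
  have hwitN : ∀ l ∈ L, ¬ Gets l → wit l ∉ L := by
    intro l hl hng hmem
    have : wit l = l := Leads.unique (hL hmem) (hL hl) (.inl rfl) (hwitL l hl)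
    exact hng (this ▸ hwitG l hl)
  -- The head of a path that meets `S` takes the first item there. An element of `L` without an item
  -- takes the substitute of its witness, which is not needed by the witness. All other vertices
  -- keep their own substitutes.
  let σ : Fin n → Fin n ⊕ Fin n := fun h =>
    if Gets h then .inl (item h) else if h ∈ L then .inr (wit h) else .inr h
  have hhead : ∀ l ∈ G.junctions, G.IsHead l := fun l hl =>
    ⟨junctions_subset hl, fun u hu => hu.2.2 hl⟩
  refine ⟨L, hL, σ, ?_, ?_, ?_⟩
  · intro h h' e
    simp only [σ] at e
    by_cases hg : Gets h <;> by_cases hg' : Gets h'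
    · simp only [if_pos hg, if_pos hg', Sum.inl.injEq] at e
      exact hg.1.unique hg'.1 (hitemC h hg) (e ▸ hitemC h' hg')
    · rw [if_pos hg, if_neg hg'] at e
      split_ifs at e
    · rw [if_neg hg, if_pos hg'] at e
      split_ifs at e
    · rw [if_neg hg, if_neg hg'] at e
      by_cases hl : h ∈ L <;> by_cases hl' : h' ∈ L
      · simp only [if_pos hl, if_pos hl', Sum.inr.injEq] at e
        exact Leads.unique (hL hl) (hL hl') (hwitL h hl) (e ▸ hwitL h' hl')
      · simp only [if_pos hl, if_neg hl', Sum.inr.injEq] at e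
        exact absurd (e ▸ hwitG h hl) hg'
      · simp only [if_neg hl, if_pos hl', Sum.inr.injEq] at e
        exact absurd (e ▸ hwitG h' hl') hg
      · simpa only [if_neg hl, if_neg hl', Sum.inr.injEq] using e
  · intro h v e
    simp only [σ] at e
    by_cases hg : Gets h
    · simp only [if_pos hg, Sum.inl.injEq] at e
      exact e ▸ hitemS h hg
    · rw [if_neg hg] at e
      split_ifs at e
  · rw [dissatisfaction_eq]
    set U := G.verts.filter fun u => ∀ v ∈ S, ¬ G.Walk v u with hU
    -- Suppose that `w ∈ S` dominates `u`. If `w` lies on the path of `u`, then `u` does not come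
    -- strictly before the first item. Otherwise the walk from `w` passes through a junction of `L`,
    -- so `u` is covered.
    have hundom : ∀ h u, G.IsHead h → G.Chain h u → ¬ G.Covered L u →
        (Gets h → G.Chain u (item h) ∧ u ≠ item h) → u ∈ U := by
      intro h u hh hc hcov hpos
      refine Finset.mem_filter.2 ⟨hc.mem_verts hh.1, fun w hw hwu => ?_⟩
      rcases hwu.chain_or_leads with hch | ⟨l, hl, hlead, hlu⟩
      · have hhw : G.Chain h w := by
          rcases hc.total_left hch with e | e
          · exact e
          · exact hh.eq_of_chain e ▸ .refl
        have hg : Gets h := ⟨hh, w, hw, hhw⟩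
        obtain ⟨h1, h2⟩ := hpos hg
        exact h2 (h1.walk.antisymm ((hitemF h hg w hw hhw).walk.trans hch.walk))
      · exact hcov ⟨l, Finset.mem_filter.2 ⟨hl, w, hw, hwu.mem_left (hc.mem_verts hh.1), hlead⟩,
          hlu⟩
    have hle : ∀ h, G.agentCost L M h (σ h) ≤
        (U.filter fun u => G.IsHead h ∧ G.Chain h u).card := by
      intro h
      by_cases hg : Gets h
      · simp only [σ, if_pos hg]
        rw [agentCost, if_pos ⟨hg.1, hitemC h hg⟩]
        refine Finset.card_le_card fun u hu => ?_
        obtain ⟨-, h1, h2, h3, h4⟩ := Finset.mem_filter.1 hu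
        exact Finset.mem_filter.2 ⟨hundom h u hg.1 h1 h4 fun _ => ⟨h2, h3⟩, hg.1, h1⟩
      · have : ∃ u, σ h = .inr u ∧
            (u ∉ L ∧ (u = h ∨ ∃ l ∈ L, G.Leads h l ∧ G.Leads u l)) := by
          by_cases hl : h ∈ L
          · exact ⟨wit h, by simp only [σ, if_neg hg, if_pos hl], hwitN h hl hg,
              .inr ⟨h, hl, .inl rfl, hwitL h hl⟩⟩
          · exact ⟨h, by simp only [σ, if_neg hg, if_neg hl], hl, .inl rfl⟩
        obtain ⟨u, hu, hcond⟩ := this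
        rw [hu, agentCost, if_pos hcond]
        split_ifs with hh
        · refine Finset.card_le_card fun u hu => ?_
          obtain ⟨-, h1, h2⟩ := Finset.mem_filter.1 hu
          exact Finset.mem_filter.2 ⟨hundom h u hh h1 h2 fun h => absurd h hg, hh, h1⟩
        · exact Nat.zero_le _
    calc ∑ h, G.agentCost L M h (σ h)
        ≤ ∑ h, (U.filter fun u => G.IsHead h ∧ G.Chain h u).card :=
          Finset.sum_le_sum fun h _ => hle h
      _ = (Finset.univ.biUnion fun h => U.filter fun u => G.IsHead h ∧ G.Chain h u).card := by
          refine (Finset.card_biUnion fun h _ h' _ hne => ?_).symm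
          refine Finset.disjoint_left.2 fun u hu hu' => hne ?_
          have h1 := (Finset.mem_filter.1 hu).2
          have h2 := (Finset.mem_filter.1 hu').2
          exact h1.1.unique h2.1 h1.2 h2.2
      _ ≤ U.card := Finset.card_le_card (Finset.biUnion_subset.2 fun h _ => Finset.filter_subset _ _)

end PrefGraph

/-! ### Combining the assignments of all agents -/

namespace DissatisfactionInstance

open Function

variable (I : DissatisfactionInstance)

/-- The cost of a pair of a person (an agent and a vertex) and an object (an item or a
substitute). -/
noncomputable def assignmentCost (L : Fin I.numAgents → Finset (Fin I.numItems)) (M : ℕ)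
    (p : Fin I.numAgents × Fin I.numItems) :
    Fin I.numItems ⊕ (Fin I.numAgents × Fin I.numItems) → ℕ
  | .inl v => (I.graph p.1).agentCost (L p.1) M p.2 (.inl v)
  | .inr q => if q.1 = p.1 then (I.graph p.1).agentCost (L p.1) M p.2 (.inr q.2) else M

/-- Substitutes are private to their agents, so the assignments of the agents can be merged if and
only if the items they use are disjoint, which is the condition on allocations. -/
theorem minSumYes_iff :
    I.MinSumYes ↔ ∃ L : Fin I.numAgents → Finset (Fin I.numItems),
      (∀ i, L i ⊆ (I.graph i).junctions) ∧
      ∃ σ : Fin I.numAgents × Fin I.numItems →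
        Fin I.numItems ⊕ (Fin I.numAgents × Fin I.numItems), Injective σ ∧
      ((∑ p, I.assignmentCost L (I.numAgents * I.numItems + 1) p (σ p) : ℕ) : ℤ) ≤
        I.threshold := by
  classical
  set M := I.numAgents * I.numItems + 1 with hMdef
  constructor
  · rintro ⟨π, hπ, hd⟩
    choose L hL τ hinj hS hsum using fun i => (I.graph i).exists_assignment (π i) M
    let σ : Fin I.numAgents × Fin I.numItems →
        Fin I.numItems ⊕ (Fin I.numAgents × Fin I.numItems) :=
      fun p => Sum.map id (fun u => (p.1, u)) (τ p.1 p.2)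
    have hcost : ∀ p, I.assignmentCost L M p (σ p) =
        (I.graph p.1).agentCost (L p.1) M p.2 (τ p.1 p.2) := by
      intro p
      simp only [σ]
      cases τ p.1 p.2 with
      | inl v => rfl
      | inr u => simp [assignmentCost]
    refine ⟨L, hL, σ, ?_, ?_⟩
    · rintro ⟨i, h⟩ ⟨j, h'⟩ e
      simp only [σ] at e
      cases e₁ : τ i h with
      | inl v =>
        cases e₂ : τ j h' with
        | inl v' =>
          rw [e₁, e₂] at e
          obtain rfl : v = v' := by simpa using e
          have hij : i = j := by
            by_contra hne
            exact Finset.disjoint_left.1 (hπ i j hne) (hS i h v e₁) (hS j h' v e₂)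
          subst hij
          rw [hinj i (e₁.trans e₂.symm)]
        | inr u' => simp [e₁, e₂] at e
      | inr u =>
        cases e₂ : τ j h' with
        | inl v' => simp [e₁, e₂] at e
        | inr u' =>
          rw [e₁, e₂] at e
          obtain ⟨rfl, rfl⟩ : i = j ∧ u = u' := by simpa using e
          rw [hinj i (e₁.trans e₂.symm)]
    · refine le_trans ?_ hd
      rw [Fintype.sum_prod_type]
      simp only [hcost]
      exact_mod_cast Finset.sum_le_sum fun i _ => hsum i
  · rintro ⟨L, hL, σ, hσ, hd⟩
    by_cases hM : ∀ p, I.assignmentCost L M p (σ p) < M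
    -- Without forbidden pairs each agent uses only items and its own substitutes, so `σ` splits
    -- into one assignment per agent.
    · have hown : ∀ p : Fin I.numAgents × Fin I.numItems, ∃ x : Fin I.numItems ⊕ Fin I.numItems,
          σ p = Sum.map id (fun u => (p.1, u)) x := by
        intro p
        cases e : σ p with
        | inl v => exact ⟨.inl v, rfl⟩
        | inr q =>
          have := hM p
          rw [e, assignmentCost] at this
          split_ifs at this with hq
          · exact ⟨.inr q.2, by simp [← hq]⟩
          · exact absurd this (lt_irrefl _)
      choose τ hτ using hown
      have hcost : ∀ p, I.assignmentCost L M p (σ p) =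
          (I.graph p.1).agentCost (L p.1) M p.2 (τ p) := by
        intro p
        rw [hτ p]
        cases τ p with
        | inl v => rfl
        | inr u => simp [assignmentCost]
      have hinj : ∀ i, Injective fun h => τ (i, h) := by
        intro i h h' e
        have : σ (i, h) = σ (i, h') := by
          rw [hτ, hτ]
          simp only at e
          rw [e]
        simpa using hσ this
      refine ⟨fun i => Finset.univ.filter fun v => ∃ h, τ (i, h) = .inl v, ?_, ?_⟩
      · intro i j hij
        refine Finset.disjoint_left.2 fun v hv hv' => hij ?_
        obtain ⟨h, hh⟩ : ∃ h, τ (i, h) = .inl v := by simpa using hv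
        obtain ⟨h', hh'⟩ : ∃ h, τ (j, h) = .inl v := by simpa using hv'
        have : σ (i, h) = σ (j, h') := by
          rw [hτ, hτ, hh, hh']
          rfl
        exact congrArg Prod.fst (hσ this)
      · refine le_trans ?_ hd
        rw [Fintype.sum_prod_type]
        simp only [hcost]
        refine Int.ofNat_le.2 (Finset.sum_le_sum fun i _ => ?_)
        refine PrefGraph.dissatisfaction_le (hL i) (hinj i) fun h => ?_
        rw [← hcost (i, h)]
        exact hM _
    -- A forbidden pair alone costs `M`, one more than the number of all pairs of an agent and an
    -- item; so a threshold that permits it is also met by the empty allocation.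
    · push Not at hM
      obtain ⟨p, hp⟩ := hM
      refine ⟨fun _ => ∅, fun _ _ _ => Finset.disjoint_empty_left _, le_trans ?_ hd⟩
      have h1 : ∑ i, (I.graph i).dissatisfaction ∅ ≤ I.numAgents * I.numItems := by
        calc ∑ i, (I.graph i).dissatisfaction ∅ ≤ ∑ _i : Fin I.numAgents, I.numItems :=
              Finset.sum_le_sum fun i _ => (Finset.card_filter_le _ _).trans
                ((Finset.card_le_univ _).trans (by simp))
          _ = _ := by simp
      have h2 := Finset.single_le_sum (f := fun p => I.assignmentCost L M p (σ p))
        (fun _ _ => Nat.zero_le _) (Finset.mem_univ p)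
      exact Int.ofNat_le.2 (h1.trans ((by omega : _ ≤ M).trans (hp.trans h2)))

end DissatisfactionInstance

/-! ### Derived expressions and commands -/

namespace ArrayLang

open Function

theorem iter_induction {α : Type*} {f : ℕ → α → α} {A : α} (Q : ℕ → α → Prop) (h0 : Q 0 A)
    {m : ℕ} (hs : ∀ j < m, ∀ B, Q j B → Q (j + 1) (f j B)) : Q m (iter f A m) := by
  induction m with
  | zero => exact h0
  | succ m ih => exact hs m (by omega) _ (ih fun j hj => hs j (by omega))

/-- The expression does not read the array `a`. -/
def Expr.avoids (a : Fin 16) : Expr → Bool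
  | .lit _ | .par _ | .var _ => true
  | .add x y | .sub x y => x.avoids a && y.avoids a
  | .ite c x y => c.avoids a && x.avoids a && y.avoids a
  | .get b e => b != a && e.avoids a
  | .sum _ _ b => b.avoids a

/-- Needed for filling tables: the value to be stored does not depend on how much of the table has
been written. -/
theorem Expr.eval_congr {a : Fin 16} {π : Fin 16 → ℕ} {A B : Arrays} (hAB : ∀ b, b ≠ a → B b = A b)
    {e : Expr} (he : e.avoids a) (ρ : ℕ → ℕ) : e.eval π B ρ = e.eval π A ρ := by
  induction e generalizing ρ with
  | lit | par | var => rfl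
  | add x y ihx ihy | sub x y ihx ihy =>
    simp only [Expr.avoids, Bool.and_eq_true] at he
    simp only [Expr.eval, ihx he.1, ihy he.2]
  | ite c x y ihc ihx ihy =>
    simp only [Expr.avoids, Bool.and_eq_true] at he
    simp only [Expr.eval, ihc he.1.1, ihx he.1.2, ihy he.2]
  | get b e ih =>
    simp only [Expr.avoids, Bool.and_eq_true, bne_iff_ne] at he
    simp only [Expr.eval, ih he.2, hAB b he.1]
  | sum r x b ih => simp only [Expr.eval, ih he]

/-- The expression does not depend on the variable `x`. -/
def Expr.indep (x : ℕ) : Expr → Prop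
  | .lit _ | .par _ => True
  | .var y => y ≠ x
  | .add a b | .sub a b => a.indep x ∧ b.indep x
  | .ite c a b => c.indep x ∧ a.indep x ∧ b.indep x
  | .get _ e => e.indep x
  | .sum _ y b => y = x ∨ b.indep x

theorem Expr.eval_update {π : Fin 16 → ℕ} {A : Arrays} {e : Expr} {x : ℕ} (he : e.indep x)
    (ρ : ℕ → ℕ) (j : ℕ) : e.eval π A (update ρ x j) = e.eval π A ρ := by
  induction e generalizing ρ with
  | lit | par => rfl
  | var y => exact update_of_ne he _ _
  | add a b iha ihb | sub a b iha ihb => simp only [Expr.eval, iha he.1, ihb he.2]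
  | ite c a b ihc iha ihb => simp only [Expr.eval, ihc he.1, iha he.2.1, ihb he.2.2]
  | get a e ih => simp only [Expr.eval, ih he]
  | sum r y b ih =>
    simp only [Expr.eval]
    refine Finset.sum_congr rfl fun i _ => ?_
    by_cases hy : y = x
    · rw [hy, update_idem]
    · rw [update_comm (Ne.symm hy), ih (he.resolve_left hy)]

/-- The command writes to the array `a`. -/
def Cmd.writes (a : Fin 16) : Cmd → Bool
  | .skip => false
  | .store b _ _ => b == a
  | .seq p q => p.writes a || q.writes a
  | .ite _ p q => p.writes a || q.writes a
  | .loop _ _ p => p.writes a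
  | .letin _ _ p => p.writes a

theorem Cmd.run_eq_of_not_writes {a : Fin 16} {π : Fin 16 → ℕ} {p : Cmd} (h : p.writes a = false)
    (ρ : ℕ → ℕ) (A : Arrays) : p.run π ρ A a = A a := by
  induction p generalizing ρ A with
  | skip => rfl
  | store b i v =>
    have : a ≠ b := by
      rintro rfl
      simp [Cmd.writes] at h
    simp [Cmd.run, setArr, this]
  | seq p q ihp ihq =>
    simp only [Cmd.writes, Bool.or_eq_false_iff] at h
    simp only [Cmd.run, ihq h.2, ihp h.1]
  | ite c p q ihp ihq =>
    simp only [Cmd.writes, Bool.or_eq_false_iff] at h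
    simp only [Cmd.run]
    split_ifs
    · exact ihp h.1 _ _
    · exact ihq h.2 _ _
  | loop r x p ih =>
    simp only [Cmd.run]
    exact iter_induction (fun _ (B : Arrays) => B a = A a) rfl fun j _ B hB => (ih h _ _).trans hB
  | letin x e p ih => exact ih h _ _

/-! ### Logical connectives, counting and search as expressions -/

def Expr.Holds (e : Expr) (π : Fin 16 → ℕ) (A : Arrays) (ρ : ℕ → ℕ) : Prop := e.eval π A ρ ≠ 0

def eNot (a : Expr) : Expr := .sub (.lit 1) a
def eAnd (a b : Expr) : Expr := .ite a b (.lit 0)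
def eOr (a b : Expr) : Expr := .ite a (.lit 1) b
def eLe (a b : Expr) : Expr := .sub (.lit 1) (.sub a b)
def eEq (a b : Expr) : Expr := eAnd (eLe a b) (eLe b a)
def eInd (a : Expr) : Expr := .ite a (.lit 1) (.lit 0)
def eExists (r : Fin 16) (x : ℕ) (e : Expr) : Expr := .sum r x e
def eCount (r : Fin 16) (x : ℕ) (e : Expr) : Expr := .sum r x (eInd e)
/-- The product of an expression, independent of the variable `99`, and a parameter. -/
def eMul (e : Expr) (r : Fin 16) : Expr := .sum r 99 e

section

variable {π : Fin 16 → ℕ} {A : Arrays} {ρ : ℕ → ℕ} {a b e : Expr}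

theorem holds_not : (eNot a).Holds π A ρ ↔ ¬ a.Holds π A ρ := by
  simp only [Expr.Holds, eNot, Expr.eval]
  omega

theorem holds_and : (eAnd a b).Holds π A ρ ↔ a.Holds π A ρ ∧ b.Holds π A ρ := by
  simp only [Expr.Holds, eAnd, Expr.eval]
  split_ifs with h <;> simp [h]

theorem holds_or : (eOr a b).Holds π A ρ ↔ a.Holds π A ρ ∨ b.Holds π A ρ := by
  simp only [Expr.Holds, eOr, Expr.eval]
  split_ifs with h <;> simp [h]

theorem holds_le : (eLe a b).Holds π A ρ ↔ a.eval π A ρ ≤ b.eval π A ρ := by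
  simp only [Expr.Holds, eLe, Expr.eval]
  omega

theorem holds_eq : (eEq a b).Holds π A ρ ↔ a.eval π A ρ = b.eval π A ρ := by
  rw [eEq, holds_and, holds_le, holds_le]
  omega

theorem holds_exists {r : Fin 16} {x : ℕ} :
    (eExists r x e).Holds π A ρ ↔ ∃ j < π r, e.Holds π A (update ρ x j) := by
  simp [Expr.Holds, eExists, Expr.eval, Finset.sum_eq_zero_iff]

theorem holds_exists_fin {r : Fin 16} {x n : ℕ} (hn : π r = n) :
    (eExists r x e).Holds π A ρ ↔ ∃ j : Fin n, e.Holds π A (update ρ x j) := by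
  rw [holds_exists, Fin.exists_iff, hn]
  simp

open Classical in
theorem eval_ind : (eInd e).eval π A ρ = if e.Holds π A ρ then 1 else 0 := by
  simp only [eInd, Expr.eval, Expr.Holds]
  congr

theorem holds_ind : (eInd e).Holds π A ρ ↔ e.Holds π A ρ := by
  classical
  rw [Expr.Holds, eval_ind]
  split_ifs with h <;> simp [h]

open Classical in
theorem eval_count {r : Fin 16} {x : ℕ} : (eCount r x e).eval π A ρ =
    ((Finset.range (π r)).filter fun j => e.Holds π A (update ρ x j)).card := by
  simp only [eCount, Expr.eval, eval_ind, Finset.card_filter]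

open Classical in
theorem eval_count_fin {r : Fin 16} {x n : ℕ} (hn : π r = n) : (eCount r x e).eval π A ρ =
    (Finset.univ.filter fun j : Fin n => e.Holds π A (update ρ x j)).card := by
  simp only [eCount, Expr.eval, eval_ind, Finset.card_filter, hn, Finset.sum_range]

open Classical in
theorem eval_ite {c : Expr} : (Expr.ite c a b).eval π A ρ =
    if c.Holds π A ρ then a.eval π A ρ else b.eval π A ρ := by
  simp only [Expr.eval, Expr.Holds]
  congr

theorem eval_mul {r : Fin 16} (he : e.indep 99) :
    (eMul e r).eval π A ρ = e.eval π A ρ * π r := by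
  simp [eMul, Expr.eval, Expr.eval_update he, mul_comm]

end

/-- The least value of `z` below the parameter `r` for which `e` holds, or the value of `r` if there
is none. The variable `y` is auxiliary. -/
def eFirst (r : Fin 16) (y z : ℕ) (e : Expr) : Expr :=
  eCount r y (eNot (eExists r z (eAnd (eLe (.var z) (.var y)) e)))

/-- The numbers below the bound with no witness at or below them form an initial segment, whose
length is the least witness or, if there is none, the bound itself. -/
theorem eval_first {π : Fin 16 → ℕ} {A : Arrays} {ρ : ℕ → ℕ} {e : Expr} {r : Fin 16} {y z : ℕ}
    (hyz : y ≠ z) (Q : ℕ → Prop)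
    (hQ : ∀ i j, e.Holds π A (update (update ρ y i) z j) ↔ Q j) :
    ((∃ j < π r, Q j) → (eFirst r y z e).eval π A ρ < π r ∧ Q ((eFirst r y z e).eval π A ρ)) ∧
    ((∀ j < π r, ¬ Q j) → (eFirst r y z e).eval π A ρ = π r) := by
  classical
  have h : (eFirst r y z e).eval π A ρ =
      ((Finset.range (π r)).filter fun i => ¬ ∃ j < π r, j ≤ i ∧ Q j).card := by
    rw [eFirst, eval_count]
    congr 1
    refine Finset.filter_congr fun i _ => ?_
    simp only [holds_not, holds_exists, holds_and, holds_le, hQ, Expr.eval, update_self,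
      update_of_ne hyz]
  constructor
  · intro hex
    have h2 : ((Finset.range (π r)).filter fun i => ¬ ∃ j < π r, j ≤ i ∧ Q j) =
        Finset.range (Nat.find hex) := by
      ext i
      simp only [Finset.mem_filter, Finset.mem_range]
      constructor
      · rintro ⟨h1, h2⟩
        by_contra hlt
        exact h2 ⟨_, (Nat.find_spec hex).1, by omega, (Nat.find_spec hex).2⟩
      · intro hi
        refine ⟨hi.trans (Nat.find_spec hex).1, ?_⟩
        rintro ⟨j, h1, h2, h3⟩
        exact Nat.find_min hex (lt_of_le_of_lt h2 hi) ⟨h1, h3⟩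
    rw [h, h2, Finset.card_range]
    exact Nat.find_spec hex
  · intro hno
    rw [h, Finset.filter_true_of_mem, Finset.card_range]
    rintro i - ⟨j, h1, -, h3⟩
    exact hno j h1 h3

/-! ### Filling tables -/

/-- From `A` to `B` only the array `a` changes, and exactly at the places in `S`, where it becomes
equal to `g`. -/
structure Fills (a : Fin 16) (S : Set ℕ) (g : ℕ → ℕ) (A B : Arrays) : Prop where
  other : ∀ b, b ≠ a → B b = A b
  mem : ∀ x ∈ S, B a x = g x
  not_mem : ∀ x ∉ S, B a x = A a x

theorem fills_store {A : Arrays} {a : Fin 16} {g : ℕ → ℕ} {i v : ℕ} (h : v = g i) :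
    Fills a {i} g A (setArr A a i v) where
  other b hb := by simp [setArr, hb]
  mem x hx := by
    obtain rfl : x = i := hx
    simp [setArr, h]
  not_mem x hx := by
    have : x ≠ i := hx
    simp [setArr, this]

/-- All iterations write values of the same function `g`, so overlapping or repeated stores do no
harm. Each iteration may rely only on the arrays other than `a`. -/
theorem fills_iter {A : Arrays} {a : Fin 16} {g : ℕ → ℕ} {S : ℕ → Set ℕ}
    {f : ℕ → Arrays → Arrays} {m : ℕ}
    (h : ∀ j < m, ∀ B : Arrays, (∀ b, b ≠ a → B b = A b) → Fills a (S j) g B (f j B)) :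
    Fills a {x | ∃ j < m, x ∈ S j} g A (iter f A m) := by
  refine iter_induction (fun m B => Fills a {x | ∃ j < m, x ∈ S j} g A B)
    ⟨fun _ _ => rfl, fun x hx => ?_, fun _ _ => rfl⟩ fun j hj B hB => ?_
  · obtain ⟨j, hj, -⟩ := hx
    omega
  · have hf := h j hj B hB.other
    refine ⟨fun b hb => (hf.other b hb).trans (hB.other b hb), fun x hx => ?_, fun x hx => ?_⟩
    · by_cases hxj : x ∈ S j
      · exact hf.mem x hxj
      · obtain ⟨i, hi, hxi⟩ := hx
        have hne : i ≠ j := fun e => hxj (e ▸ hxi)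
        rw [hf.not_mem x hxj]
        exact hB.mem x ⟨i, by omega, hxi⟩
    · rw [hf.not_mem x fun hxj => hx ⟨j, by omega, hxj⟩]
      exact hB.not_mem x fun ⟨i, hi, hxi⟩ => hx ⟨i, by omega, hxi⟩

def idx2 (r : Fin 16) (x y : ℕ) : Expr := .add (eMul (.var x) r) (.var y)

def idx3 (x y z : ℕ) : Expr := .add (eMul (idx2 2 x y) 2) (.var z)

theorem eval_idx2 {π : Fin 16 → ℕ} {A : Arrays} {ρ : ℕ → ℕ} (r : Fin 16) {x : ℕ} (y : ℕ)
    (hx : x ≠ 99) : (idx2 r x y).eval π A ρ = ρ x * π r + ρ y := by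
  simp only [idx2, Expr.eval]
  rw [eval_mul (by simpa [Expr.indep] using hx), Expr.eval]

theorem eval_idx3 {π : Fin 16 → ℕ} {A : Arrays} {ρ : ℕ → ℕ} {x y : ℕ} (z : ℕ)
    (hx : x ≠ 99) (hy : y ≠ 99) :
    (idx3 x y z).eval π A ρ = (ρ x * π 2 + ρ y) * π 2 + ρ z := by
  simp only [idx3, Expr.eval]
  rw [eval_mul (by simpa [Expr.indep, idx2, eMul] using hy), eval_idx2 _ _ hx]

/-- Set the array `a` to `e` on all values of `x` below the parameter `r`. -/
def tab1 (a : Fin 16) (r : Fin 16) (x : ℕ) (e : Expr) : Cmd := .loop r x (.store a (.var x) e)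

/-- Tabulate `e` in the array `a`, for `x` and `y` below the parameters `r` and `q`. -/
def tab2 (a : Fin 16) (r q : Fin 16) (x y : ℕ) (e : Expr) : Cmd :=
  .loop r x (.loop q y (.store a (idx2 q x y) e))

/-- Tabulate `e` in the array `a`, for `x`, `y` and `z` below the parameters `1`, `2` and `2`. -/
def tab3 (a : Fin 16) (x y z : ℕ) (e : Expr) : Cmd :=
  .loop 1 x (.loop 2 y (.loop 2 z (.store a (idx3 x y z) e)))

theorem mul_add_div_of_lt {n v : ℕ} (i : ℕ) (h : v < n) : (i * n + v) / n = i := by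
  rw [mul_comm, Nat.mul_add_div (by omega), Nat.div_eq_of_lt h, add_zero]

theorem mul_add_mod_of_lt' {n v : ℕ} (i : ℕ) (h : v < n) : (i * n + v) % n = v := by
  rw [mul_comm, Nat.mul_add_mod, Nat.mod_eq_of_lt h]

section

variable {π : Fin 16 → ℕ} (ρ : ℕ → ℕ) (A : Arrays) {a : Fin 16} {e : Expr}

theorem run_tab1 (he : e.avoids a) {r : Fin 16} {x : ℕ} :
    ∀ i < π r, (tab1 a r x e).run π ρ A a i = e.eval π A (update ρ x i) := by
  have h : Fills a {x | ∃ i < π r, x ∈ ({i} : Set ℕ)} (fun i => e.eval π A (update ρ x i)) A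
      ((tab1 a r x e).run π ρ A) := by
    refine fills_iter fun i hi B hB => ?_
    simp only [Cmd.run, Expr.eval, update_self]
    exact fills_store (Expr.eval_congr hB he _)
  exact fun i hi => h.mem i ⟨i, hi, rfl⟩

theorem run_tab2 (he : e.avoids a) {r q : Fin 16} {x y : ℕ} (hx : x ≠ 99) (hxy : x ≠ y) :
    ∀ i < π r, ∀ j < π q, (tab2 a r q x y e).run π ρ A a (i * π q + j) =
      e.eval π A (update (update ρ x i) y j) := by
  have h : Fills a {z | ∃ i < π r, z ∈ {z | ∃ j < π q, z ∈ ({i * π q + j} : Set ℕ)}}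
      (fun z => e.eval π A (update (update ρ x (z / π q)) y (z % π q))) A
      ((tab2 a r q x y e).run π ρ A) := by
    refine fills_iter fun i hi B hB => fills_iter fun j hj B' hB' => ?_
    simp only [Cmd.run, eval_idx2 _ _ hx, update_self, update_of_ne hxy]
    refine fills_store ?_
    rw [mul_add_div_of_lt _ hj, mul_add_mod_of_lt' _ hj,
      Expr.eval_congr (fun b hb => (hB' b hb).trans (hB b hb)) he]
  intro i hi j hj
  rw [h.mem _ ⟨i, hi, j, hj, rfl⟩, mul_add_div_of_lt _ hj, mul_add_mod_of_lt' _ hj]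

theorem run_tab3 (he : e.avoids a) {x y z : ℕ} (hx : x ≠ 99) (hy : y ≠ 99) (hxy : x ≠ y)
    (hxz : x ≠ z) (hyz : y ≠ z) :
    ∀ i < π 1, ∀ j < π 2, ∀ k < π 2,
      (tab3 a x y z e).run π ρ A a ((i * π 2 + j) * π 2 + k) =
      e.eval π A (update (update (update ρ x i) y j) z k) := by
  have h : Fills a {w | ∃ i < π 1, w ∈ {w | ∃ j < π 2, w ∈ {w | ∃ k < π 2,
        w ∈ ({(i * π 2 + j) * π 2 + k} : Set ℕ)}}}
      (fun w => e.eval π A (update (update (update ρ x (w / π 2 / π 2)) y (w / π 2 % π 2)) z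
        (w % π 2))) A ((tab3 a x y z e).run π ρ A) := by
    refine fills_iter fun i hi B hB => fills_iter fun j hj B' hB' =>
      fills_iter fun k hk B'' hB'' => ?_
    simp only [Cmd.run, eval_idx3 _ hx hy, update_self, update_of_ne hxy, update_of_ne hxz,
      update_of_ne hyz]
    refine fills_store ?_
    rw [mul_add_div_of_lt _ hk, mul_add_mod_of_lt' _ hk, mul_add_div_of_lt _ hj,
      mul_add_mod_of_lt' _ hj, Expr.eval_congr
        (fun b hb => ((hB'' b hb).trans (hB' b hb)).trans (hB b hb)) he]
  intro i hi j hj k hk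
  rw [h.mem _ ⟨i, hi, j, hj, k, hk, rfl⟩, mul_add_div_of_lt _ hk, mul_add_mod_of_lt' _ hk,
    mul_add_div_of_lt _ hj, mul_add_mod_of_lt' _ hj]

end

/-- The Floyd-Warshall recursion: `S k` allows the first `k` vertices as intermediate stops. The
core is that `S k` is closed under composition at any vertex below `k`, by induction on `k`; for `k
= n` this is transitivity. -/
theorem warshall {n : ℕ} {r : Fin n → Fin n → Prop} {S : ℕ → Fin n → Fin n → Prop}
    (h0 : ∀ u v, S 0 u v ↔ u = v ∨ r u v)
    (hs : ∀ (k : Fin n) u v, S (k + 1) u v ↔ S k u v ∨ S k u k ∧ S k k v) (u v : Fin n) :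
    S n u v ↔ Relation.ReflTransGen r u v := by
  have sound : ∀ k ≤ n, ∀ u v, S k u v → Relation.ReflTransGen r u v := by
    intro k
    induction k with
    | zero =>
      intro _ u v h
      rcases (h0 u v).1 h with rfl | h
      · exact .refl
      · exact .single h
    | succ k ih =>
      intro hk u v h
      rcases (hs ⟨k, hk⟩ u v).1 h with h | ⟨h, h'⟩
      · exact ih (by omega) u v h
      · exact (ih (by omega) _ _ h).trans (ih (by omega) _ _ h')
  have mono : ∀ k ≤ n, ∀ u v, u = v ∨ r u v → S k u v := by
    intro k
    induction k with
    | zero => exact fun _ u v h => (h0 u v).2 h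
    | succ k ih => exact fun hk u v h => (hs ⟨k, hk⟩ u v).2 (.inl (ih (by omega) u v h))
  have trans : ∀ k ≤ n, ∀ u w v, w.val < k → S k u w → S k w v → S k u v := by
    intro k
    induction k with
    | zero => exact fun _ u w v h => absurd h (Nat.not_lt_zero _)
    | succ k ih =>
      intro hk u w v hw h h'
      have ih := ih (by omega)
      have hs := hs ⟨k, hk⟩
      simp only at hs
      rw [hs] at h h' ⊢
      by_cases hwk : w.val < k
      · rcases h with h | ⟨h, h₁⟩ <;> rcases h' with h' | ⟨h', h₂⟩
        · exact .inl (ih u w v hwk h h')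
        · exact .inr ⟨ih u w _ hwk h h', h₂⟩
        · exact .inr ⟨h, ih _ w v hwk h₁ h'⟩
        · exact .inr ⟨h, h₂⟩
      · obtain rfl : w = ⟨k, hk⟩ := Fin.ext (by simp only; omega)
        refine .inr ⟨?_, ?_⟩
        · rcases h with h | ⟨h, -⟩ <;> exact h
        · rcases h' with h' | ⟨-, h'⟩ <;> exact h'
  refine ⟨sound n le_rfl u v, fun h => ?_⟩
  induction h with
  | refl => exact mono n le_rfl _ _ (.inl rfl)
  | tail _ h ih => exact trans n le_rfl _ _ _ (Fin.is_lt _) ih (mono n le_rfl _ _ (.inr h))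

/-- Reflexive transitive closures of the relations given by `e` in the variables `1`, `2`, `3`. -/
def closureCmd (a : Fin 16) (e : Expr) : Cmd :=
  .seq (tab3 a 1 2 3 (eInd (eOr (eEq (.var 2) (.var 3)) e))) <|
  .loop 2 4 <| .seq
    (tab3 3 1 2 3 (eInd (eOr (.get a (idx3 1 2 3)) (eAnd (.get a (idx3 1 2 4))
      (.get a (idx3 1 4 3))))))
    (tab3 a 1 2 3 (.get 3 (idx3 1 2 3)))

theorem holds_get {π : Fin 16 → ℕ} {A : Arrays} {ρ : ℕ → ℕ} {a : Fin 16} {e : Expr} :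
    (Expr.get a e).Holds π A ρ ↔ A a (e.eval π A ρ) ≠ 0 := Iff.rfl

theorem closureCmd_spec {K n : ℕ} {π : Fin 16 → ℕ} (hK : π 1 = K) (hn : π 2 = n) (ρ : ℕ → ℕ)
    (A : Arrays) {a : Fin 16} (ha : a ≠ 3) {e : Expr} (he : e.avoids a)
    (r : Fin K → Fin n → Fin n → Prop)
    (hr : ∀ (i : Fin K) (u v : Fin n),
      e.Holds π A (update (update (update ρ 1 i) 2 u) 3 v) ↔ r i u v)
    (i : Fin K) (u v : Fin n) :
    (closureCmd a e).run π ρ A a ((i * n + u) * n + v) ≠ 0 ↔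
      Relation.ReflTransGen (r i) u v := by
  set A₀ := (tab3 a 1 2 3 (eInd (eOr (eEq (.var 2) (.var 3)) e))).run π ρ A with hA₀
  set f : ℕ → Arrays → Arrays := fun k B => (Cmd.seq
    (tab3 3 1 2 3 (eInd (eOr (.get a (idx3 1 2 3)) (eAnd (.get a (idx3 1 2 4))
      (.get a (idx3 1 4 3))))))
    (tab3 a 1 2 3 (.get 3 (idx3 1 2 3)))).run π (update ρ 4 k) B with hf
  have hrun : (closureCmd a e).run π ρ A = iter f A₀ n := by
    rw [← hn]
    rfl
  rw [hrun]
  refine warshall (r := r i) (S := fun k u v => iter f A₀ k a ((i * n + u) * n + v) ≠ 0)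
    (fun u v => ?_) (fun k u v => ?_) u v
  · have h := run_tab3 (π := π) ρ A (a := a) (e := eInd (eOr (eEq (.var 2) (.var 3)) e))
      (by simp [eInd, eOr, eEq, eAnd, eLe, Expr.avoids, he]) (x := 1) (y := 2) (z := 3)
      (by simp) (by simp) (by simp) (by simp) (by simp) i (by omega) u (by omega) v (by omega)
    rw [hn, ← hA₀] at h
    have h' := holds_ind (π := π) (A := A) (ρ := update (update (update ρ 1 i) 2 u) 3 v)
      (e := eOr (eEq (.var 2) (.var 3)) e)
    rw [Expr.Holds, ← h] at h'
    simp only [iter]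
    rw [h', holds_or, holds_eq, hr]
    simp [Expr.eval, Fin.ext_iff]
  · set B := iter f A₀ k with hB
    set B₁ := (tab3 3 1 2 3 (eInd (eOr (.get a (idx3 1 2 3)) (eAnd (.get a (idx3 1 2 4))
      (.get a (idx3 1 4 3)))))).run π (update ρ 4 k) B with hB₁
    have h₁ := run_tab3 (π := π) (update ρ 4 k) B (a := 3)
      (e := eInd (eOr (.get a (idx3 1 2 3)) (eAnd (.get a (idx3 1 2 4)) (.get a (idx3 1 4 3)))))
      (by simp [eInd, eOr, eAnd, Expr.avoids, idx3, idx2, eMul, ha]) (x := 1) (y := 2) (z := 3)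
      (by simp) (by simp) (by simp) (by simp) (by simp) i (by omega) u (by omega) v (by omega)
    have h₂ := run_tab3 (π := π) (update ρ 4 k) B₁ (a := a) (e := .get 3 (idx3 1 2 3))
      (by simp [Expr.avoids, idx3, idx2, eMul, ha.symm]) (x := 1) (y := 2) (z := 3)
      (by simp) (by simp) (by simp) (by simp) (by simp) i (by omega) u (by omega) v (by omega)
    -- Array 3 is a buffer: a round is computed completely from the old table `B` before it is
    -- copied back.
    have hstep : iter f A₀ (k + 1) a ((i * n + u) * n + v) =
        (eInd (eOr (.get a (idx3 1 2 3)) (eAnd (.get a (idx3 1 2 4))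
          (.get a (idx3 1 4 3))))).eval π B
          (update (update (update (update ρ 4 k) 1 i) 2 u) 3 v) := by
      rw [← h₁, ← hB₁]
      rw [Expr.eval, eval_idx3 _ (by simp) (by simp)] at h₂
      simp only [update_apply, hn] at h₂ ⊢
      exact h₂
    have h' := holds_ind (π := π) (A := B)
      (ρ := update (update (update (update ρ 4 k) 1 i) 2 u) 3 v)
      (e := eOr (.get a (idx3 1 2 3)) (eAnd (.get a (idx3 1 2 4)) (.get a (idx3 1 4 3))))
    rw [Expr.Holds, ← hstep] at h'
    rw [h', holds_or, holds_and, holds_get, holds_get, holds_get]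
    simp [eval_idx3, hn]

end ArrayLang

/-! ### Expressions for graphs and costs -/

namespace ArrayLang

open Function

/-- The blocks of the earlier agents have total length `(i + i * n) * n = i * (n + n * n)`, with an
indicator vector and an adjacency matrix for each; the four header words are added separately. Array
0 holds the input, 1 and 2 the closures of inner arcs and of all arcs, 4 the guessed sets, 9 the
junctions. -/
def agentOffset (i : ℕ) : Expr := eMul (.add (.var i) (eMul (.var i) 2)) 2

def vertE (i v : ℕ) : Expr := .get 0 (.add (.lit 4) (.add (agentOffset i) (.var v)))

def arcE (i u v : ℕ) : Expr :=
  .get 0 (.add (.lit 4) (.add (agentOffset i) (.add (.par 2) (idx2 2 u v))))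

def junctionTestE (i v : ℕ) : Expr :=
  eOr (eLe (.lit 2) (.sum 2 50 (arcE i 50 v))) (eLe (.lit 2) (.sum 2 50 (arcE i v 50)))

def junctionE (i v : ℕ) : Expr := .get 9 (idx2 2 i v)

def innerE (i u v : ℕ) : Expr :=
  eAnd (arcE i u v) (eAnd (eNot (junctionE i u)) (eNot (junctionE i v)))

def chainE (i u v : ℕ) : Expr := .get 1 (idx3 i u v)

def walkE (i u v : ℕ) : Expr := .get 2 (idx3 i u v)

def chosenE (i v : ℕ) : Expr := .get 4 (idx2 2 i v)

/-- Bound variables are `50` here, `40` in the cost expressions and `99` in products; the bounds on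
variable names in the lemmas below exclude capture. -/
def coveredE (i v : ℕ) : Expr := eExists 2 50 (eAnd (chosenE i 50) (walkE i 50 v))

def headE (i h : ℕ) : Expr := eAnd (vertE i h) (eNot (eExists 2 50 (innerE i 50 h)))

def leadsE (i v l : ℕ) : Expr :=
  eOr (eEq (.var v) (.var l))
    (eExists 2 50 (eAnd (chainE i v 50) (eAnd (eNot (junctionE i 50)) (arcE i 50 l))))

def itemCostE (i h v : ℕ) : Expr :=
  .ite (eAnd (headE i h) (chainE i h v))
    (eCount 2 40 (eAnd (chainE i h 40) (eAnd (chainE i 40 v) (eAnd (eNot (eEq (.var 40) (.var v)))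
      (eNot (coveredE i 40))))))
    (.add (.par 3) (.lit 1))

def substituteCostE (i h u : ℕ) : Expr :=
  .ite (eAnd (eNot (chosenE i u)) (eOr (eEq (.var u) (.var h))
      (eExists 2 40 (eAnd (chosenE i 40) (eAnd (leadsE i h 40) (leadsE i u 40))))))
    (.ite (headE i h) (eCount 2 40 (eAnd (chainE i h 40) (eNot (coveredE i 40)))) (.lit 0))
    (.add (.par 3) (.lit 1))

section

variable (I : DissatisfactionInstance)

/-! ### Correctness of the graph and cost expressions -/

structure EncodesInput (w : ℕ → ℕ) : Prop where
  vert : ∀ (i : Fin I.numAgents) (v : Fin I.numItems),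
    w (4 + ((i + i * I.numItems) * I.numItems + v)) = if v ∈ (I.graph i).verts then 1 else 0
  arc : ∀ (i : Fin I.numAgents) (u v : Fin I.numItems),
    w (4 + ((i + i * I.numItems) * I.numItems + (I.numItems + (u * I.numItems + v)))) =
      if (u, v) ∈ (I.graph i).arcs then 1 else 0

def Encodes2 (r : Fin I.numAgents → Fin I.numItems → Prop) (w : ℕ → ℕ) : Prop :=
  ∀ (i : Fin I.numAgents) (v : Fin I.numItems), w (i * I.numItems + v) ≠ 0 ↔ r i v

def Encodes3 (r : Fin I.numAgents → Fin I.numItems → Fin I.numItems → Prop) (w : ℕ → ℕ) : Prop :=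
  ∀ (i : Fin I.numAgents) (u v : Fin I.numItems), w ((i * I.numItems + u) * I.numItems + v) ≠ 0 ↔ r i u v

variable {I} {π : Fin 16 → ℕ} {A : Arrays} {ρ : ℕ → ℕ} (hn : π 2 = I.numItems)
  (h0 : EncodesInput I (A 0)) {i u v l h : ℕ} {i' : Fin I.numAgents}
  {u' v' l' h' : Fin I.numItems}

include hn

theorem eval_agentOffset (hi : i < 99) :
    (agentOffset i).eval π A ρ = (ρ i + ρ i * I.numItems) * I.numItems := by
  have hi : i ≠ 99 := by omega
  rw [agentOffset, eval_mul (by simp [Expr.indep, hi, eMul]), Expr.eval,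
    eval_mul (by simp [Expr.indep, hi]), Expr.eval, hn]

include h0

theorem holds_vert (hi : i < 99) (ei : ρ i = i') (ev : ρ v = v') :
    (vertE i v).Holds π A ρ ↔ v' ∈ (I.graph i').verts := by
  rw [vertE, holds_get, Expr.eval, Expr.eval, Expr.eval, Expr.eval, eval_agentOffset hn hi, ei, ev,
    h0.vert]
  simp

theorem eval_arc (hi : i < 99) (hu : u < 99) (ei : ρ i = i') (eu : ρ u = u') (ev : ρ v = v') :
    (arcE i u v).eval π A ρ = if (u', v') ∈ (I.graph i').arcs then 1 else 0 := by
  rw [arcE, Expr.eval, Expr.eval, Expr.eval, Expr.eval, Expr.eval, Expr.eval,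
    eval_agentOffset hn hi, eval_idx2 _ _ (by omega), hn, ei, eu, ev, h0.arc]

theorem holds_arc (hi : i < 99) (hu : u < 99) (ei : ρ i = i') (eu : ρ u = u') (ev : ρ v = v') :
    (arcE i u v).Holds π A ρ ↔ (u', v') ∈ (I.graph i').arcs := by
  rw [Expr.Holds, eval_arc hn h0 hi hu ei eu ev]
  simp

theorem holds_junctionTest (hi : i < 50) (hv : v < 50) (ei : ρ i = i') (ev : ρ v = v') :
    (junctionTestE i v).Holds π A ρ ↔ v' ∈ (I.graph i').junctions := by
  have hi' : i ≠ 50 := by omega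
  have hv' : v ≠ 50 := by omega
  have h1 : (Expr.sum 2 50 (arcE i 50 v)).eval π A ρ = (I.graph i').inDegree v' := by
    rw [Expr.eval, hn, Finset.sum_range, PrefGraph.inDegree]
    have : ∀ u' : Fin I.numItems, (arcE i 50 v).eval π A (update ρ 50 u') =
        if (u', v') ∈ (I.graph i').arcs then 1 else 0 := fun u' =>
      eval_arc hn h0 (by omega) (by omega) (by simp [hi', ei]) (by simp) (by simp [hv', ev])
    simp only [this]
    rw [Finset.sum_boole, Nat.cast_id]
    refine Finset.card_bij (fun u' _ => (u', v')) ?_ ?_ ?_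
    · intro u' hu'
      simpa using hu'
    · intro a _ b _ hab
      simpa using hab
    · rintro ⟨a, b⟩ hab
      obtain ⟨hab, rfl⟩ := Finset.mem_filter.1 hab
      exact ⟨a, by simpa using hab, rfl⟩
  have h2 : (Expr.sum 2 50 (arcE i v 50)).eval π A ρ = (I.graph i').outDegree v' := by
    rw [Expr.eval, hn, Finset.sum_range, PrefGraph.outDegree]
    have : ∀ u' : Fin I.numItems, (arcE i v 50).eval π A (update ρ 50 u') =
        if (v', u') ∈ (I.graph i').arcs then 1 else 0 := fun u' =>
      eval_arc hn h0 (by omega) (by omega) (by simp [hi', ei]) (by simp [hv', ev]) (by simp)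
    simp only [this]
    rw [Finset.sum_boole, Nat.cast_id]
    refine Finset.card_bij (fun u' _ => (v', u')) ?_ ?_ ?_
    · intro u' hu'
      simpa using hu'
    · intro a _ b _ hab
      simpa using hab
    · rintro ⟨a, b⟩ hab
      obtain ⟨hab, rfl⟩ := Finset.mem_filter.1 hab
      exact ⟨b, by simpa using hab, rfl⟩
  rw [junctionTestE, holds_or, holds_le, holds_le, h1, h2, Expr.eval, PrefGraph.junctions,
    Finset.mem_filter]
  -- The test on degrees need not check membership in the graph, because endpoints of arcs are
  -- vertices.
  refine ⟨fun h => ⟨?_, h⟩, fun h => h.2⟩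
  rcases h with h | h
  · obtain ⟨a, ha⟩ := Finset.card_pos.1 (lt_of_lt_of_le Nat.two_pos h)
    obtain ⟨hmem, rfl⟩ := Finset.mem_filter.1 ha
    exact PrefGraph.right_mem hmem
  · obtain ⟨a, ha⟩ := Finset.card_pos.1 (lt_of_lt_of_le Nat.two_pos h)
    obtain ⟨hmem, rfl⟩ := Finset.mem_filter.1 ha
    exact PrefGraph.left_mem hmem

omit h0

theorem holds_get2 {r : Fin I.numAgents → Fin I.numItems → Prop} {a : Fin 16}
    (ha : Encodes2 I r (A a)) (hi : i < 99) (ei : ρ i = i') (ev : ρ v = v') :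
    (Expr.get a (idx2 2 i v)).Holds π A ρ ↔ r i' v' := by
  rw [holds_get, eval_idx2 _ _ (by omega), hn, ei, ev]
  exact ha i' v'

theorem holds_get3 {r : Fin I.numAgents → Fin I.numItems → Fin I.numItems → Prop} {a : Fin 16}
    (ha : Encodes3 I r (A a)) (hi : i < 99) (hu : u < 99) (ei : ρ i = i') (eu : ρ u = u')
    (ev : ρ v = v') :
    (Expr.get a (idx3 i u v)).Holds π A ρ ↔ r i' u' v' := by
  rw [holds_get, eval_idx3 _ (by omega) (by omega), hn, ei, eu, ev]
  exact ha i' u' v'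

include h0

variable (h9 : Encodes2 I (fun i v => v ∈ (I.graph i).junctions) (A 9))

include h9

theorem holds_inner (hi : i < 99) (hu : u < 99) (ei : ρ i = i') (eu : ρ u = u') (ev : ρ v = v') :
    (innerE i u v).Holds π A ρ ↔ (I.graph i').Inner u' v' := by
  rw [innerE, holds_and, holds_and, holds_not, holds_not, holds_arc hn h0 hi hu ei eu ev,
    junctionE, junctionE, holds_get2 hn h9 hi ei eu, holds_get2 hn h9 hi ei ev]
  rfl

theorem holds_head (hi : i < 50) (hh : h < 50) (ei : ρ i = i') (eh : ρ h = h') :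
    (headE i h).Holds π A ρ ↔ (I.graph i').IsHead h' := by
  have hi' : i ≠ 50 := by omega
  have hh' : h ≠ 50 := by omega
  rw [headE, holds_and, holds_not, holds_exists_fin hn, holds_vert hn h0 (by omega) ei eh,
    not_exists]
  refine and_congr_right fun _ => forall_congr' fun u => not_congr ?_
  exact holds_inner hn h0 h9 (by omega) (by omega) (by simp [hi', ei]) (by simp) (by simp [hh', eh])

variable (h1 : Encodes3 I (fun i u v => (I.graph i).Chain u v) (A 1))

include h1

theorem holds_leads (hi : i < 50) (hv : v < 50) (hl : l < 50) (ei : ρ i = i') (ev : ρ v = v')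
    (el : ρ l = l') : (leadsE i v l).Holds π A ρ ↔ (I.graph i').Leads v' l' := by
  have hi' : i ≠ 50 := by omega
  have hv' : v ≠ 50 := by omega
  have hl' : l ≠ 50 := by omega
  rw [leadsE, holds_or, holds_eq, holds_exists_fin hn, Expr.eval, Expr.eval, ev, el,
    PrefGraph.Leads, Fin.ext_iff]
  refine or_congr_right (exists_congr fun t => ?_)
  have ei' : update ρ 50 (t : ℕ) i = i' := by simp [hi', ei]
  have ev' : update ρ 50 (t : ℕ) v = v' := by simp [hv', ev]
  have el' : update ρ 50 (t : ℕ) l = l' := by simp [hl', el]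
  have et' : update ρ 50 (t : ℕ) 50 = t := by simp
  rw [holds_and, holds_and, holds_not, chainE, junctionE,
    holds_get3 hn h1 (by omega) (by omega) ei' ev' et', holds_get2 hn h9 (by omega) ei' et',
    holds_arc hn h0 (by omega) (by omega) ei' et' el']

omit h0 h9 h1

variable (h2 : Encodes3 I (fun i u v => (I.graph i).Walk u v) (A 2))
  {L : Fin I.numAgents → Finset (Fin I.numItems)} (h4 : Encodes2 I (fun i v => v ∈ L i) (A 4))

include h2 h4

theorem holds_covered (hi : i < 50) (hv : v < 50) (ei : ρ i = i') (ev : ρ v = v') :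
    (coveredE i v).Holds π A ρ ↔ (I.graph i').Covered (L i') v' := by
  have hi' : i ≠ 50 := by omega
  have hv' : v ≠ 50 := by omega
  rw [coveredE, holds_exists_fin hn]
  refine exists_congr fun l => ?_
  have ei' : update ρ 50 (l : ℕ) i = i' := by simp [hi', ei]
  have ev' : update ρ 50 (l : ℕ) v = v' := by simp [hv', ev]
  have el' : update ρ 50 (l : ℕ) 50 = l := by simp
  rw [holds_and, chosenE, walkE, holds_get2 hn h4 (by omega) ei' el',
    holds_get3 hn h2 (by omega) (by omega) ei' el' ev']

include h0 h9 h1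

theorem eval_itemCost (hi : i < 40) (hh : h < 40) (hv : v < 40) (ei : ρ i = i') (eh : ρ h = h')
    (ev : ρ v = v') : (itemCostE i h v).eval π A ρ =
      (I.graph i').agentCost (L i') (π 3 + 1) h' (.inl v') := by
  classical
  have hi' : i ≠ 40 := by omega
  have hh' : h ≠ 40 := by omega
  have hv' : v ≠ 40 := by omega
  rw [itemCostE, eval_ite, PrefGraph.agentCost]
  refine if_congr ?_ ?_ rfl
  · rw [holds_and, holds_head hn h0 h9 (by omega) (by omega) ei eh, chainE,
      holds_get3 hn h1 (by omega) (by omega) ei eh ev]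
  · rw [eval_count_fin hn]
    congr 1
    refine Finset.filter_congr fun u _ => ?_
    have ei' : update ρ 40 (u : ℕ) i = i' := by simp [hi', ei]
    have eh' : update ρ 40 (u : ℕ) h = h' := by simp [hh', eh]
    have ev' : update ρ 40 (u : ℕ) v = v' := by simp [hv', ev]
    have eu' : update ρ 40 (u : ℕ) 40 = u := by simp
    rw [holds_and, holds_and, holds_and, holds_not, holds_not, holds_eq, chainE, chainE,
      holds_get3 hn h1 (by omega) (by omega) ei' eh' eu',
      holds_get3 hn h1 (by omega) (by omega) ei' eu' ev',
      holds_covered hn h2 h4 (by omega) (by omega) ei' eu', Expr.eval, Expr.eval, eu', ev',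
      ← Fin.ext_iff]

theorem eval_substituteCost (hi : i < 40) (hh : h < 40) (hu : u < 40) (ei : ρ i = i')
    (eh : ρ h = h') (eu : ρ u = u') : (substituteCostE i h u).eval π A ρ =
      (I.graph i').agentCost (L i') (π 3 + 1) h' (.inr u') := by
  classical
  have hi' : i ≠ 40 := by omega
  have hh' : h ≠ 40 := by omega
  have hu' : u ≠ 40 := by omega
  rw [substituteCostE, eval_ite, PrefGraph.agentCost]
  refine if_congr ?_ ?_ rfl
  · rw [holds_and, holds_not, holds_or, holds_eq, holds_exists_fin hn, chosenE,
      holds_get2 hn h4 (by omega) ei eu, Expr.eval, Expr.eval, eu, eh, ← Fin.ext_iff]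
    refine and_congr_right fun _ => or_congr_right (exists_congr fun l => ?_)
    have ei' : update ρ 40 (l : ℕ) i = i' := by simp [hi', ei]
    have eh' : update ρ 40 (l : ℕ) h = h' := by simp [hh', eh]
    have eu' : update ρ 40 (l : ℕ) u = u' := by simp [hu', eu]
    have el' : update ρ 40 (l : ℕ) 40 = l := by simp
    rw [holds_and, holds_and, chosenE, holds_get2 hn h4 (by omega) ei' el',
      holds_leads hn h0 h9 h1 (by omega) (by omega) (by omega) ei' eh' el',
      holds_leads hn h0 h9 h1 (by omega) (by omega) (by omega) ei' eu' el']
  · rw [eval_ite]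
    refine if_congr (holds_head hn h0 h9 (by omega) (by omega) ei eh) ?_ rfl
    rw [eval_count_fin hn]
    congr 1
    refine Finset.filter_congr fun u _ => ?_
    have ei' : update ρ 40 (u : ℕ) i = i' := by simp [hi', ei]
    have eh' : update ρ 40 (u : ℕ) h = h' := by simp [hh', eh]
    have eu' : update ρ 40 (u : ℕ) 40 = u := by simp
    rw [holds_and, holds_not, chainE, holds_get3 hn h1 (by omega) (by omega) ei' eh' eu',
      holds_covered hn h2 h4 (by omega) (by omega) ei' eu']

end

end ArrayLang

/-! ### The auction as a command -/

namespace ArrayLang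

open Function

/-- Array 13 is the cost table; array 6 holds the prices and array 7 the owners, with 0 for a free
object. -/
def costE (p o : ℕ) : Expr := .get 13 (idx2 4 p o)

/-- The scaled cost plus the price. -/
def bidE (p o : ℕ) : Expr :=
  .add (.add (eMul (costE p o) 3) (costE p o)) (.get 6 (.var o))

def unassignedE (p : ℕ) : Expr :=
  eNot (eExists 4 40 (eEq (.get 7 (.var 40)) (.add (.var p) (.lit 1))))

def cheapestE (p o : ℕ) : Expr :=
  eNot (eExists 4 45 (eNot (eLe (bidE p o) (bidE p 45))))

def auctionRound : Cmd :=
  .letin 9 (eFirst 3 41 42 (unassignedE 42)) <|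
  .ite (eLe (.add (.var 9) (.lit 1)) (.par 3))
    (.letin 10 (eFirst 4 43 44 (cheapestE 9 44)) <| .seq
      (.store 6 (.var 10) (.add (.get 6 (.var 10)) (.lit 1)))
      (.store 7 (.var 10) (.add (.var 9) (.lit 1))))
    .skip

def auctionCmd : Cmd :=
  .seq (tab1 6 4 10 (.lit 0)) <| .seq (tab1 7 4 10 (.lit 0)) <| .loop 5 16 auctionRound

def totalE : Expr :=
  .sum 3 9 <| .sum 4 10 <|
    .ite (eEq (.get 7 (.var 10)) (.add (.var 9) (.lit 1))) (costE 9 10) (.lit 0)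

section

variable {π : Fin 16 → ℕ} {A : Arrays} {ρ : ℕ → ℕ}

theorem eval_cost {p o : ℕ} (hp : p < 99) :
    (costE p o).eval π A ρ = A 13 (ρ p * π 4 + ρ o) := by
  rw [costE, Expr.eval, eval_idx2 _ _ (by omega)]

theorem eval_bid {p o : ℕ} (hp : p < 99) (ho : o < 99) :
    (bidE p o).eval π A ρ =
      A 13 (ρ p * π 4 + ρ o) * (π 3 + 1) + A 6 (ρ o) := by
  rw [bidE, Expr.eval, Expr.eval, eval_mul, eval_cost hp, Expr.eval, Expr.eval]
  · ring
  · have : o ≠ 99 := by omega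
    simp [costE, Expr.indep, idx2, eMul, this]

theorem holds_cheapest {p o : ℕ} (hp : p < 45) (ho : o < 45) :
    (cheapestE p o).Holds π A ρ ↔ ∀ o' < π 4,
      A 13 (ρ p * π 4 + ρ o) * (π 3 + 1) + A 6 (ρ o) ≤
      A 13 (ρ p * π 4 + o') * (π 3 + 1) + A 6 o' := by
  have hp' : p ≠ 45 := by omega
  have ho' : o ≠ 45 := by omega
  rw [cheapestE, holds_not, holds_exists]
  simp only [holds_not, holds_le, not_exists, not_and, not_not,
    eval_bid (show p < 99 by omega) (show o < 99 by omega),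
    eval_bid (show p < 99 by omega) (show 45 < 99 by omega), update_self, update_of_ne hp',
    update_of_ne ho']

/-- With nobody unassigned, the search for a bidder returns the bound `π 3`, which the test in the
round rejects. -/
theorem auctionRound_done (h : ∀ p < π 3, ∃ o < π 4, A 7 o = p + 1) :
    auctionRound.run π ρ A = A := by
  have h1 := (eval_first (π := π) (A := A) (ρ := ρ) (e := unassignedE 42) (r := 3) (y := 41)
    (z := 42) (by simp) (fun p => ∀ o < π 4, A 7 o ≠ p + 1) (fun i j => by
      rw [unassignedE, holds_not, holds_exists]
      push Not
      simp [holds_eq, Expr.eval])).2 (by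
        intro p hp hno
        obtain ⟨o, ho, e⟩ := h p hp
        exact hno o ho e)
  simp only [auctionRound, Cmd.run, h1]
  rw [if_neg]
  have : ¬ (eLe (.add (.var 9) (.lit 1)) (.par 3)).Holds π A (update ρ 9 (π 3)) := by
    rw [holds_le]
    simp [Expr.eval]
  exact this

theorem auctionRound_step (hO : 0 < π 4) (h : ∃ p < π 3, ∀ o < π 4, A 7 o ≠ p + 1) :
    ∃ p < π 3, (∀ o < π 4, A 7 o ≠ p + 1) ∧ ∃ o < π 4,
      (∀ o' < π 4, A 13 (p * π 4 + o) * (π 3 + 1) + A 6 o ≤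
        A 13 (p * π 4 + o') * (π 3 + 1) + A 6 o') ∧
      auctionRound.run π ρ A 6 = update (A 6) o (A 6 o + 1) ∧
      auctionRound.run π ρ A 7 = update (A 7) o (p + 1) := by
  have h1 := (eval_first (π := π) (A := A) (ρ := ρ) (e := unassignedE 42) (r := 3) (y := 41)
    (z := 42) (by simp) (fun p => ∀ o < π 4, A 7 o ≠ p + 1) (fun i j => by
      rw [unassignedE, holds_not, holds_exists]
      push Not
      simp [holds_eq, Expr.eval])).1 h
  set p := (eFirst 3 41 42 (unassignedE 42)).eval π A ρ with hp
  have hmin : ∃ o < π 4, ∀ o' < π 4, A 13 (p * π 4 + o) * (π 3 + 1) + A 6 o ≤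
      A 13 (p * π 4 + o') * (π 3 + 1) + A 6 o' := by
    obtain ⟨o, ho, h⟩ := Finset.exists_min_image (Finset.range (π 4))
      (fun o => A 13 (p * π 4 + o) * (π 3 + 1) + A 6 o) ⟨0, by simpa using hO⟩
    exact ⟨o, by simpa using ho, fun o' ho' => h o' (by simpa using ho')⟩
  have h2 := (eval_first (π := π) (A := A) (ρ := update ρ 9 p) (e := cheapestE 9 44) (r := 4)
    (y := 43) (z := 44) (by simp) (fun o => ∀ o' < π 4,
      A 13 (p * π 4 + o) * (π 3 + 1) + A 6 o ≤ A 13 (p * π 4 + o') * (π 3 + 1) + A 6 o')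
    (fun i j => by
      rw [holds_cheapest (by simp) (by simp)]
      simp)).1 hmin
  set o := (eFirst 4 43 44 (cheapestE 9 44)).eval π A (update ρ 9 p) with ho
  refine ⟨p, h1.1, h1.2, o, h2.1, h2.2, ?_⟩
  have hlt : (eLe (.add (.var 9) (.lit 1)) (.par 3)).eval π A (update ρ 9 p) ≠ 0 := by
    have : (eLe (.add (.var 9) (.lit 1)) (.par 3)).Holds π A (update ρ 9 p) := by
      rw [holds_le]
      simpa [Expr.eval] using h1.1
    exact this
  simp only [auctionRound, Cmd.run, ← hp, if_pos hlt, ← ho]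
  constructor <;> simp [setArr, Expr.eval]

/-- The auction runs on costs multiplied by `π 3 + 1` and is optimal up to `π 3`, which is less than
one unit of original cost. So its result is exactly optimal. -/
theorem auctionCmd_spec (hPO : π 3 ≤ π 4)
    (hc : ∀ p < π 3, ∀ o < π 4, A 13 (p * π 4 + o) ≤ π 3 + 1)
    (hT : π 4 * ((π 3 + 1) * (π 3 + 1) + 1) < π 5) (ρ' : ℕ → ℕ) :
    ∃ α : ℕ → ℕ, (∀ p < π 3, α p < π 4) ∧ Set.InjOn α (Set.Iio (π 3)) ∧
      totalE.eval π (auctionCmd.run π ρ A) ρ' =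
        ∑ p ∈ Finset.range (π 3), A 13 (p * π 4 + α p) ∧
      ∀ σ : ℕ → ℕ, (∀ p < π 3, σ p < π 4) → Set.InjOn σ (Set.Iio (π 3)) →
        ∑ p ∈ Finset.range (π 3), A 13 (p * π 4 + α p) ≤
          ∑ p ∈ Finset.range (π 3), A 13 (p * π 4 + σ p) := by
  classical
  set A₁ := (tab1 6 4 10 (.lit 0)).run π ρ A with hA₁
  set A₂ := (tab1 7 4 10 (.lit 0)).run π ρ A₁ with hA₂
  set f : ℕ → Arrays → Arrays := fun j B => auctionRound.run π (update ρ 16 j) B with hf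
  have hrun : auctionCmd.run π ρ A = iter f A₂ (π 5) := rfl
  have h13 : ∀ t, iter f A₂ t 13 = A 13 := by
    intro t
    refine iter_induction (fun _ (B : Arrays) => B 13 = A 13) ?_ fun j _ B hB => ?_
    · rw [hA₂, Cmd.run_eq_of_not_writes rfl, hA₁, Cmd.run_eq_of_not_writes rfl]
    · exact (Cmd.run_eq_of_not_writes rfl _ _).trans hB
  set v : ℕ → ℕ → ℕ := fun p o => A 13 (p * π 4 + o) * (π 3 + 1) with hv
  obtain ⟨hinv, hall⟩ := Auction.Invariant.terminates (P := π 3) (O := π 4)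
    (C := (π 3 + 1) * (π 3 + 1)) (v := v) hPO
    (fun p hp o ho => Nat.mul_le_mul_right _ (hc p hp o ho))
    (fun t => iter f A₂ t 6) (fun t => iter f A₂ t 7)
    (fun o ho => by
      simp only [iter]
      rw [hA₂, Cmd.run_eq_of_not_writes rfl, hA₁, run_tab1 _ _ rfl _ ho]
      rfl)
    (fun o ho => by
      simp only [iter]
      rw [hA₂, run_tab1 _ _ rfl _ ho]
      rfl)
    (fun t ht => by
      have := auctionRound_done (ρ := update ρ 16 t) ht
      simp only [iter]
      rw [hf]
      simp only at this ⊢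
      rw [this]
      exact ⟨rfl, rfl⟩)
    (fun t ht => by
      have hO : 0 < π 4 := by
        obtain ⟨p, hp, -⟩ := ht
        omega
      have := auctionRound_step (ρ := update ρ 16 t) hO ht
      rw [h13] at this
      exact this) hT
  choose! α hα using hall
  have hαinj : Set.InjOn α (Set.Iio (π 3)) := by
    intro p hp q hq e
    have h1 := (hα p hp).2
    have h2 := (hα q hq).2
    rw [e] at h1
    omega
  refine ⟨α, fun p hp => (hα p hp).1, hαinj, ?_, fun σ hσ hinj => ?_⟩
  · rw [hrun, totalE, Expr.eval]
    refine Finset.sum_congr rfl fun p hp => ?_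
    have hp : p < π 3 := by simpa using hp
    -- No two objects have the same owner, so the double sum counts one object per person.
    rw [Expr.eval, Finset.sum_eq_single (α p)]
    · rw [eval_ite, if_pos, eval_cost (by simp), h13]
      · simp
      · rw [holds_eq]
        simpa [Expr.eval] using (hα p hp).2
    · intro o ho hne
      have ho : o < π 4 := by simpa using ho
      rw [eval_ite, if_neg]
      · rfl
      · rw [holds_eq]
        simp only [Expr.eval, update_self]
        intro h
        have h : iter f A₂ (π 5) 7 o = p + 1 := by simpa using h
        exact hne (hinv.inj o ho (α p) (hα p hp).1 (by simp only [h]; omega)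
          (h.trans (hα p hp).2.symm))
    · intro h
      exact absurd (by simpa using (hα p hp).1) h
  -- An original total smaller by one would make the scaled total smaller by `π 3 + 1`.
  · have h := hinv.optimal hα hσ hinj
    simp only [hv, ← Finset.sum_mul] at h
    by_contra! hlt
    have := Nat.mul_le_mul_right (π 3 + 1) hlt
    rw [Nat.succ_mul] at this
    omega

/-- The cost of the pair of the person `9` and the object `10` in terms of the tables. -/
def pairCostE : Expr :=
  .ite (eLe (.add (.var 10) (.lit 1)) (.par 2)) (.get 5 (idx2 2 9 10))
    (.ite (eEq (.get 11 (.var 9)) (.get 11 (.sub (.var 10) (.par 2))))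
      (.get 10 (.add (eMul (.var 9) 2) (.get 12 (.sub (.var 10) (.par 2)))))
      (.add (.par 3) (.lit 1)))

/-- Objects below `n` are items, and object `n + q` is the substitute of person `q`. Arrays 11 and
12 list the agent and the vertex of each person, as expressions have no division. -/
def costTableCmd : Cmd :=
  .seq (tab3 5 1 2 3 (itemCostE 1 2 3)) <| .seq (tab3 10 1 2 3 (substituteCostE 1 2 3)) <|
    tab2 13 3 4 9 10 pairCostE

theorem pair_lt {K n i v : ℕ} (hi : i < K) (hv : v < n) : i * n + v < K * n := by
  calc i * n + v < i * n + n := by omega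
    _ = (i + 1) * n := by ring
    _ ≤ K * n := Nat.mul_le_mul_right _ hi

variable {I : DissatisfactionInstance}

/-- The number of a person. -/
def personIndex (p : Fin I.numAgents × Fin I.numItems) : ℕ := p.1 * I.numItems + p.2

/-- The number of an object. -/
def objectIndex : Fin I.numItems ⊕ (Fin I.numAgents × Fin I.numItems) → ℕ
  | .inl v => v
  | .inr q => I.numItems + personIndex q

theorem personIndex_lt (p : Fin I.numAgents × Fin I.numItems) :
    personIndex p < I.numAgents * I.numItems := pair_lt p.1.is_lt p.2.is_lt

theorem objectIndex_lt (o : Fin I.numItems ⊕ (Fin I.numAgents × Fin I.numItems)) :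
    objectIndex o < I.numItems + I.numAgents * I.numItems := by
  cases o with
  | inl v => exact Nat.lt_add_right _ v.is_lt
  | inr q => exact Nat.add_lt_add_left (personIndex_lt q) _

theorem costTableCmd_spec (h1 : π 1 = I.numAgents) (h2 : π 2 = I.numItems)
    (h3 : π 3 = I.numAgents * I.numItems) (h4 : π 4 = I.numItems + I.numAgents * I.numItems)
    (h11 : ∀ p : Fin I.numAgents × Fin I.numItems, A 11 (personIndex p) = p.1)
    (h12 : ∀ p : Fin I.numAgents × Fin I.numItems, A 12 (personIndex p) = p.2)
    (e0 : EncodesInput I (A 0)) (e9 : Encodes2 I (fun i v => v ∈ (I.graph i).junctions) (A 9))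
    (e1 : Encodes3 I (fun i u v => (I.graph i).Chain u v) (A 1))
    (e2 : Encodes3 I (fun i u v => (I.graph i).Walk u v) (A 2))
    {L : Fin I.numAgents → Finset (Fin I.numItems)} (e4 : Encodes2 I (fun i v => v ∈ L i) (A 4))
    (p : Fin I.numAgents × Fin I.numItems)
    (o : Fin I.numItems ⊕ (Fin I.numAgents × Fin I.numItems)) :
    costTableCmd.run π ρ A 13 (personIndex p * π 4 + objectIndex o) =
      I.assignmentCost L (I.numAgents * I.numItems + 1) p o := by
  classical
  obtain ⟨i, h⟩ := p
  set A₁ := (tab3 5 1 2 3 (itemCostE 1 2 3)).run π ρ A with hA₁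
  set A₂ := (tab3 10 1 2 3 (substituteCostE 1 2 3)).run π ρ A₁ with hA₂
  have hrun : costTableCmd.run π ρ A = (tab2 13 3 4 9 10 pairCostE).run π ρ A₂ := rfl
  have n1 : ∀ a, (tab3 5 1 2 3 (itemCostE 1 2 3)).writes a = false → A₁ a = A a :=
    fun a ha => Cmd.run_eq_of_not_writes ha _ _
  have n2 : ∀ a, (tab3 10 1 2 3 (substituteCostE 1 2 3)).writes a = false → A₂ a = A₁ a :=
    fun a ha => Cmd.run_eq_of_not_writes ha _ _
  rw [hrun, run_tab2 _ _ rfl (by simp) (by simp) _ (by rw [h3]; exact personIndex_lt _) _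
    (by rw [h4]; exact objectIndex_lt _)]
  set ρ' := update (update ρ 9 (personIndex (i, h))) 10 (objectIndex o) with hρ'
  have r9 : ρ' 9 = i * I.numItems + h := by simp [hρ', personIndex]
  have r10 : ρ' 10 = objectIndex o := by simp [hρ']
  rw [pairCostE, eval_ite]
  cases o with
  | inl v =>
    rw [if_pos, Expr.eval, eval_idx2 _ _ (by simp), r9, r10, n2 5 rfl, objectIndex, h2]
    · have := run_tab3 (π := π) ρ A (a := 5) (e := itemCostE 1 2 3) rfl (x := 1) (y := 2) (z := 3)
        (by simp) (by simp) (by simp) (by simp) (by simp) i (by omega) h (by omega) v (by omega)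
      rw [h2] at this
      rw [hA₁, this, eval_itemCost (i' := i) (h' := h) (v' := v) h2 e0 e9 e1 e2 e4 (by simp)
        (by simp) (by simp) (by simp) (by simp) (by simp), h3]
      rfl
    · rw [holds_le]
      simp only [Expr.eval, r10, h2]
      exact v.is_lt
  | inr q =>
    obtain ⟨j, u⟩ := q
    have hq : ρ' 10 - I.numItems = personIndex (j, u) := by
      rw [r10, objectIndex]
      omega
    have h11' : ∀ p : Fin I.numAgents × Fin I.numItems, A₂ 11 (personIndex p) = p.1 := by
      intro p
      rw [n2 11 rfl, n1 11 rfl, h11]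
    have h12' : ∀ p : Fin I.numAgents × Fin I.numItems, A₂ 12 (personIndex p) = p.2 := by
      intro p
      rw [n2 12 rfl, n1 12 rfl, h12]
    rw [if_neg, eval_ite, DissatisfactionInstance.assignmentCost]
    · refine if_congr ?_ ?_ (by simp [Expr.eval, h3])
      · rw [holds_eq]
        simp only [Expr.eval, h2, hq]
        rw [h11', r9, show i * I.numItems + h = personIndex (i, h) from rfl, h11']
        simp [Fin.ext_iff, eq_comm]
      · rw [Expr.eval, Expr.eval, eval_mul (by simp [Expr.indep])]
        simp only [Expr.eval, h2, hq]
        rw [h12', r9]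
        have e0' : EncodesInput I (A₁ 0) := by rwa [n1 0 rfl]
        have e9' : Encodes2 I (fun i v => v ∈ (I.graph i).junctions) (A₁ 9) := by rwa [n1 9 rfl]
        have e1' : Encodes3 I (fun i u v => (I.graph i).Chain u v) (A₁ 1) := by rwa [n1 1 rfl]
        have e2' : Encodes3 I (fun i u v => (I.graph i).Walk u v) (A₁ 2) := by rwa [n1 2 rfl]
        have e4' : Encodes2 I (fun i v => v ∈ L i) (A₁ 4) := by rwa [n1 4 rfl]
        have := run_tab3 (π := π) ρ A₁ (a := 10) (e := substituteCostE 1 2 3) rfl (x := 1) (y := 2)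
          (z := 3) (by simp) (by simp) (by simp) (by simp) (by simp) i (by omega) h (by omega) u
          (by omega)
        rw [h2] at this
        rw [hA₂, this, eval_substituteCost (i' := i) (h' := h) (u' := u) h2 e0' e9' e1' e2' e4'
          (by simp) (by simp) (by simp) (by simp) (by simp) (by simp), h3]
    · rw [holds_le]
      simp only [Expr.eval, r10, h2, objectIndex]
      omega

end

end ArrayLang

/-! ### The search over all sets of junctions -/

namespace ArrayLang

open Function

/-! ### Coding sets of junctions by binary digits -/

/-- The number of nonzero entries of `w` before `p`. -/
def rank (w : ℕ → ℕ) (p : ℕ) : ℕ := ((Finset.range p).filter fun q => w q ≠ 0).card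

theorem rank_succ (w : ℕ → ℕ) (p : ℕ) :
    rank w (p + 1) = rank w p + if w p ≠ 0 then 1 else 0 := by
  rw [rank, Finset.range_add_one, Finset.filter_insert]
  split_ifs with h
  · rw [Finset.card_insert_of_notMem (by simp), rank]
  · rfl

theorem rank_zero (w : ℕ → ℕ) : rank w 0 = 0 := rfl

theorem rank_mono (w : ℕ → ℕ) : Monotone (rank w) :=
  monotone_nat_of_le_succ fun p => by rw [rank_succ]; omega

/-- The binary digit of `g` that decides about `p`. -/
def digit (w : ℕ → ℕ) (g p : ℕ) : ℕ := if w p ≠ 0 then g / 2 ^ rank w p % 2 else 0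

/-- Only marked positions consume a digit, so the guesses range below 2 to the number of marks. A
new mark contributes the next higher digit. -/
theorem exists_digits (w : ℕ → ℕ) (target : ℕ → Prop) (ht : ∀ p, target p → w p ≠ 0) (m : ℕ) :
    ∃ g < 2 ^ rank w m, ∀ p < m, digit w g p ≠ 0 ↔ target p := by
  classical
  induction m with
  | zero => exact ⟨0, by simp [rank_zero], by simp⟩
  | succ m ih =>
    obtain ⟨g, hg, h⟩ := ih
    by_cases hm : w m ≠ 0
    · set b := if target m then 1 else 0 with hb
      have hb1 : b ≤ 1 := by
        rw [hb]
        split_ifs <;> simp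
      refine ⟨g + 2 ^ rank w m * b, ?_, fun p hp => ?_⟩
      · rw [rank_succ, if_pos hm, pow_succ]
        have := Nat.mul_le_mul_left (2 ^ rank w m) hb1
        omega
      · rcases Nat.lt_succ_iff_lt_or_eq.1 hp with hp | rfl
        · rw [← h p hp]
          unfold digit
          by_cases hwp : w p ≠ 0
          · rw [if_pos hwp, if_pos hwp]
            have h1 : rank w p + 1 ≤ rank w m := by
              have h2 := rank_mono w hp
              rw [Nat.succ_eq_add_one, rank_succ, if_pos hwp] at h2
              exact h2
            obtain ⟨c, hc⟩ := Nat.exists_eq_add_of_le h1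
            -- The new digit is a multiple of `2 ^ (rank w p + 1)` and cannot affect the digit at
            -- `p`.
            have : g + 2 ^ rank w m * b = g + 2 ^ rank w p * (2 * (2 ^ c * b)) := by
              rw [hc]
              ring
            rw [this, Nat.add_mul_div_left _ _ (by positivity), Nat.add_mul_mod_self_left]
          · rw [if_neg hwp, if_neg hwp]
        · unfold digit
          rw [if_pos hm, Nat.add_mul_div_left _ _ (by positivity), Nat.div_eq_of_lt hg, hb]
          split_ifs with ht <;> simp [ht]
    · refine ⟨g, by rwa [rank_succ, if_neg hm, add_zero], fun p hp => ?_⟩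
      rcases Nat.lt_succ_iff_lt_or_eq.1 hp with hp | rfl
      · exact h p hp
      · rw [digit, if_neg hm]
        exact ⟨fun h => absurd rfl h, fun h => absurd (ht _ h) hm⟩

def restE : Expr := .get 8 (.lit 0)

def halfE : Expr := eCount 6 46 (eLe (.add (.add (.var 46) (.var 46)) (.lit 2)) restE)

/-- Writes the binary digits of the variable `15` into the array `4`, at the junctions. -/
def decodeCmd : Cmd :=
  .seq (.store 8 (.lit 0) (.var 15)) <| .loop 3 9 <| .ite (.get 9 (.var 9))
    (.seq (.store 4 (.var 9) (.sub restE (.add halfE halfE))) (.store 8 (.lit 0) halfE))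
    (.store 4 (.var 9) (.lit 0))

/-- The `j` with `2 * j + 2 ≤ A 8 0` are those below half of `A 8 0`; the hypothesis puts them all
within the summation range. -/
theorem eval_half {π : Fin 16 → ℕ} {A : Arrays} (ρ : ℕ → ℕ) (h : A 8 0 ≤ π 6) :
    halfE.eval π A ρ = A 8 0 / 2 := by
  classical
  rw [halfE, eval_count]
  rw [← Finset.card_range (A 8 0 / 2)]
  congr 1
  ext j
  simp only [Finset.mem_filter, Finset.mem_range, holds_le, Expr.eval, restE, update_self]
  omega

theorem decodeCmd_spec {π : Fin 16 → ℕ} {A : Arrays} {ρ : ℕ → ℕ} (h : ρ 15 ≤ π 6) :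
    ∀ p < π 3, decodeCmd.run π ρ A 4 p = digit (A 9) (ρ 15) p := by
  set A₁ := (Cmd.store 8 (.lit 0) (.var 15)).run π ρ A with hA₁
  have h9 : A₁ 9 = A 9 := Cmd.run_eq_of_not_writes rfl _ _
  have h8 : A₁ 8 0 = ρ 15 := by simp [hA₁, Cmd.run, setArr, Expr.eval]
  set f : ℕ → Arrays → Arrays := fun j B => (Cmd.ite (.get 9 (.var 9))
    (.seq (.store 4 (.var 9) (.sub restE (.add halfE halfE))) (.store 8 (.lit 0) halfE))
    (.store 4 (.var 9) (.lit 0))).run π (update ρ 9 j) B with hf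
  have hrun : decodeCmd.run π ρ A = iter f A₁ (π 3) := rfl
  -- Entry 0 of array 8 is the guess with one binary digit removed for each junction already passed.
  have key : ∀ m, iter f A₁ m 9 = A 9 ∧ iter f A₁ m 8 0 = ρ 15 / 2 ^ rank (A 9) m ∧
      ∀ p < m, iter f A₁ m 4 p = digit (A 9) (ρ 15) p := by
    intro m
    refine iter_induction (fun m (B : Arrays) => B 9 = A 9 ∧ B 8 0 = ρ 15 / 2 ^ rank (A 9) m ∧
      ∀ p < m, B 4 p = digit (A 9) (ρ 15) p) ?_ fun j _ B ⟨hB9, hB8, hB4⟩ => ?_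
    · exact ⟨h9, by simp [h8, rank_zero], fun p hp => absurd hp (Nat.not_lt_zero p)⟩
    · have hle : B 8 0 ≤ π 6 := hB8 ▸ (Nat.div_le_self _ _).trans h
      refine ⟨(Cmd.run_eq_of_not_writes rfl _ _).trans hB9, ?_⟩
      by_cases hj : A 9 j ≠ 0
      · have hc : (Expr.get 9 (.var 9)).eval π B (update ρ 9 j) ≠ 0 := by
          simpa [Expr.eval, hB9] using hj
        set B' := setArr B 4 j ((Expr.sub restE (.add halfE halfE)).eval π B (update ρ 9 j))
          with hB'
        have hB'8 : B' 8 = B 8 := by simp [hB', setArr]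
        have hfj : f j B = setArr B' 8 0 (halfE.eval π B' (update ρ 9 j)) := by
          simp only [hf, Cmd.run, if_pos hc]
          simp [hB', Expr.eval]
        rw [hfj, eval_half _ (by rwa [hB'8]), hB'8]
        refine ⟨?_, fun p hp => ?_⟩
        · rw [rank_succ, if_pos hj, pow_succ, ← Nat.div_div_eq_div_mul, ← hB8]
          simp [setArr]
        · have : setArr B' 8 0 (B 8 0 / 2) 4 = B' 4 := by simp [setArr]
          rw [this, hB']
          by_cases hpj : p = j
          · subst hpj
            simp only [setArr, update_self, Expr.eval, eval_half _ hle]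
            rw [digit, if_pos hj, ← hB8]
            simp only [restE, Expr.eval]
            omega
          · simp only [setArr, update_self, update_of_ne hpj]
            exact hB4 p (by omega)
      · have hc : ¬ (Expr.get 9 (.var 9)).eval π B (update ρ 9 j) ≠ 0 := by
          simpa [Expr.eval, hB9] using hj
        have hfj : f j B = setArr B 4 j 0 := by
          simp only [hf, Cmd.run, if_neg hc]
          simp [Expr.eval]
        rw [hfj]
        refine ⟨?_, fun p hp => ?_⟩
        · rw [rank_succ, if_neg hj, add_zero, ← hB8]
          simp [setArr]
        · by_cases hpj : p = j
          · subst hpj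
            simp [setArr, digit, if_neg hj]
          · simp only [setArr, update_self, update_of_ne hpj]
            exact hB4 p (by omega)
  exact (key _).2.2

/-! ### Feasibility of a guess and the search -/

section

variable {I : DissatisfactionInstance}

theorem personIndex_eq (p : Fin I.numAgents × Fin I.numItems) :
    personIndex p = finProdFinEquiv p := by
  rw [personIndex, finProdFinEquiv_apply_val]
  ring

theorem personIndex_injective : Injective (personIndex (I := I)) := by
  intro p q h
  rw [personIndex_eq, personIndex_eq] at h
  exact finProdFinEquiv.injective (Fin.ext h)

theorem exists_personIndex {x : ℕ} (hx : x < I.numAgents * I.numItems) :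
    ∃ p : Fin I.numAgents × Fin I.numItems, personIndex p = x :=
  ⟨finProdFinEquiv.symm ⟨x, hx⟩, by rw [personIndex_eq, Equiv.apply_symm_apply]⟩

theorem objectIndex_injective : Injective (objectIndex (I := I)) := by
  rintro (v | q) (v' | q') h <;> simp only [objectIndex] at h
  · rw [Fin.ext h]
  · have := v.is_lt
    omega
  · have := v'.is_lt
    omega
  · rw [personIndex_injective (by omega : personIndex q = personIndex q')]

theorem exists_objectIndex {x : ℕ} (hx : x < I.numItems + I.numAgents * I.numItems) :
    ∃ o : Fin I.numItems ⊕ (Fin I.numAgents × Fin I.numItems), objectIndex o = x := by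
  by_cases h : x < I.numItems
  · exact ⟨.inl ⟨x, h⟩, rfl⟩
  · obtain ⟨q, hq⟩ := exists_personIndex (I := I) (x := x - I.numItems) (by omega)
    refine ⟨.inr q, ?_⟩
    rw [objectIndex, hq]
    omega

theorem sum_range_persons (f : ℕ → ℕ) :
    ∑ x ∈ Finset.range (I.numAgents * I.numItems), f x =
      ∑ p : Fin I.numAgents × Fin I.numItems, f (personIndex p) := by
  rw [Finset.sum_range, ← Equiv.sum_comp finProdFinEquiv]
  simp only [personIndex_eq]

theorem rank_eq_junctionNumber {w : ℕ → ℕ}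
    (h : Encodes2 I (fun i v => v ∈ (I.graph i).junctions) w) :
    rank w (I.numAgents * I.numItems) = I.junctionNumber := by
  rw [rank, Finset.card_filter, sum_range_persons, Fintype.sum_prod_type,
    DissatisfactionInstance.junctionNumber]
  refine Finset.sum_congr rfl fun i _ => ?_
  rw [← Finset.card_filter]
  congr 1
  ext v
  simp only [Finset.mem_filter, Finset.mem_univ, true_and]
  exact h i v

theorem agentCost_le {n : ℕ} (G : PrefGraph n) (L : Finset (Fin n)) {M : ℕ} (hM : n ≤ M)
    (h : Fin n) (o : Fin n ⊕ Fin n) : G.agentCost L M h o ≤ M := by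
  classical
  have hcard : ∀ s : Finset (Fin n), s.card ≤ M := fun s =>
    (Finset.card_le_univ s).trans (by simpa using hM)
  cases o with
  | inl v =>
    rw [PrefGraph.agentCost]
    split_ifs
    · exact hcard _
    · exact le_rfl
  | inr u =>
    rw [PrefGraph.agentCost]
    split_ifs
    · exact hcard _
    · exact Nat.zero_le _
    · exact le_rfl

theorem assignmentCost_le (L : Fin I.numAgents → Finset (Fin I.numItems))
    (p : Fin I.numAgents × Fin I.numItems)
    (o : Fin I.numItems ⊕ (Fin I.numAgents × Fin I.numItems)) :
    I.assignmentCost L (I.numAgents * I.numItems + 1) p o ≤ I.numAgents * I.numItems + 1 := by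
  -- The person `p` shows that there is an agent, so a single graph has at most as many vertices as
  -- there are persons.
  have hle : I.numItems ≤ I.numAgents * I.numItems + 1 := by
    have := Nat.le_mul_of_pos_left I.numItems (Fin.pos p.1)
    omega
  cases o with
  | inl v => exact agentCost_le (I.graph p.1) (L p.1) hle p.2 (.inl v)
  | inr q =>
    rw [DissatisfactionInstance.assignmentCost]
    split_ifs
    · exact agentCost_le _ _ hle _ _
    · exact le_rfl

variable {π : Fin 16 → ℕ} {A : Arrays} {ρ : ℕ → ℕ}

/-- The parameters have their intended values. -/
structure GoodParams (I : DissatisfactionInstance) (π : Fin 16 → ℕ) : Prop where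
  agents : π 1 = I.numAgents
  items : π 2 = I.numItems
  persons : π 3 = I.numAgents * I.numItems
  objects : π 4 = I.numItems + I.numAgents * I.numItems
  rounds : π 5 = π 4 * ((π 3 + 1) * (π 3 + 1) + 1) + 1

/-- The arrays that are prepared in advance have their intended values. -/
structure Prepared (I : DissatisfactionInstance) (A : Arrays) : Prop where
  input : EncodesInput I (A 0)
  chain : Encodes3 I (fun i u v => (I.graph i).Chain u v) (A 1)
  walk : Encodes3 I (fun i u v => (I.graph i).Walk u v) (A 2)
  junction : Encodes2 I (fun i v => v ∈ (I.graph i).junctions) (A 9)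
  agent : ∀ p : Fin I.numAgents × Fin I.numItems, A 11 (personIndex p) = p.1
  item : ∀ p : Fin I.numAgents × Fin I.numItems, A 12 (personIndex p) = p.2

theorem Prepared.congr {B : Arrays} (h : Prepared I A) (h0 : B 0 = A 0) (h1 : B 1 = A 1)
    (h2 : B 2 = A 2) (h9 : B 9 = A 9) (h11 : B 11 = A 11) (h12 : B 12 = A 12) : Prepared I B :=
  ⟨h0 ▸ h.input, h1 ▸ h.chain, h2 ▸ h.walk, h9 ▸ h.junction, h11 ▸ h.agent, h12 ▸ h.item⟩

/-- There is an assignment for the sets `L` whose cost is at most the threshold. -/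
def Feasible (I : DissatisfactionInstance) (L : Fin I.numAgents → Finset (Fin I.numItems)) :
    Prop :=
  ∃ σ : Fin I.numAgents × Fin I.numItems →
      Fin I.numItems ⊕ (Fin I.numAgents × Fin I.numItems), Injective σ ∧
    ((∑ p, I.assignmentCost L (I.numAgents * I.numItems + 1) p (σ p) : ℕ) : ℤ) ≤ I.threshold

/-- The numberings of persons and objects are bijections, so the auction finds a cheapest
assignment, which meets the threshold if any assignment does. -/
theorem total_le_iff (hπ : GoodParams I π) (hA : Prepared I A)
    {L : Fin I.numAgents → Finset (Fin I.numItems)} (e4 : Encodes2 I (fun i v => v ∈ L i) (A 4)) :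
    ((totalE.eval π (auctionCmd.run π ρ (costTableCmd.run π ρ A)) ρ : ℕ) : ℤ) ≤ I.threshold ↔
      Feasible I L := by
  set B := costTableCmd.run π ρ A with hB
  have hcost := costTableCmd_spec (ρ := ρ) hπ.agents hπ.items hπ.persons hπ.objects hA.agent
    hA.item hA.input hA.junction hA.chain hA.walk e4
  rw [← hB] at hcost
  obtain ⟨α, hα, hαinj, htot, hopt⟩ := auctionCmd_spec (π := π) (A := B) (ρ := ρ)
    (by rw [hπ.persons, hπ.objects]; omega)
    (fun p hp o ho => by
      rw [hπ.persons] at hp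
      rw [hπ.objects] at ho
      obtain ⟨p, rfl⟩ := exists_personIndex hp
      obtain ⟨o, rfl⟩ := exists_objectIndex ho
      rw [hcost, hπ.persons]
      exact assignmentCost_le _ _ _)
    (by rw [hπ.rounds]; omega) ρ
  rw [htot, hπ.persons, sum_range_persons]
  constructor
  · intro h
    have hex : ∀ p : Fin I.numAgents × Fin I.numItems,
        ∃ o : Fin I.numItems ⊕ (Fin I.numAgents × Fin I.numItems),
          objectIndex o = α (personIndex p) := fun p => by
      refine exists_objectIndex ?_
      rw [← hπ.objects]
      exact hα _ (by rw [hπ.persons]; exact personIndex_lt p)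
    choose σ hσ using hex
    refine ⟨σ, fun p q e => ?_, ?_⟩
    · refine personIndex_injective (hαinj ?_ ?_ ?_)
      · rw [Set.mem_Iio, hπ.persons]
        exact personIndex_lt p
      · rw [Set.mem_Iio, hπ.persons]
        exact personIndex_lt q
      · rw [← hσ, ← hσ, e]
    · simpa only [← hσ, hcost] using h
  · rintro ⟨σ, hσ, h⟩
    have hinv : ∀ x < π 3, ∃ p : Fin I.numAgents × Fin I.numItems, personIndex p = x :=
      fun x hx => exists_personIndex (by rwa [hπ.persons] at hx)
    -- This is `σ` in terms of numbers; the default value lies outside the range of persons and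
    -- plays no role.
    set τ : ℕ → ℕ := fun x =>
      if hx : x < π 3 then objectIndex (σ (hinv x hx).choose) else 0 with hτdef
    have hτ : ∀ p : Fin I.numAgents × Fin I.numItems,
        τ (personIndex p) = objectIndex (σ p) := fun p => by
      have hp : personIndex p < π 3 := by
        rw [hπ.persons]
        exact personIndex_lt p
      simp only [hτdef, dif_pos hp]
      rw [personIndex_injective (hinv _ hp).choose_spec]
    have := hopt τ (fun x hx => by
        obtain ⟨p, rfl⟩ := hinv x hx
        rw [hτ, hπ.objects]
        exact objectIndex_lt _) (fun x hx y hy e => by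
        obtain ⟨p, rfl⟩ := hinv x hx
        obtain ⟨q, rfl⟩ := hinv y hy
        rw [hτ, hτ] at e
        rw [hσ (objectIndex_injective e)])
    rw [hπ.persons, sum_range_persons, sum_range_persons] at this
    simp only [hτ, hcost] at this
    refine le_trans ?_ h
    exact_mod_cast this

/-- Treats the guess in the variable `15`, and sets the entry `1` of the array `8` in case of
success. -/
def guessCmd : Cmd :=
  .seq decodeCmd <| .seq costTableCmd <| .seq auctionCmd <|
    .ite (eLe (.add totalE (.get 0 (.lit 3))) (.get 0 (.lit 2)))
      (.store 8 (.lit 1) (.lit 1)) .skip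

/-- The sets of junctions that belong to a number. -/
def guessed (I : DissatisfactionInstance) (w : ℕ → ℕ) (g : ℕ) (i : Fin I.numAgents) :
    Finset (Fin I.numItems) :=
  Finset.univ.filter fun v => digit w g (i * I.numItems + v) ≠ 0

/-- Decoding uses entry 0 of array 8 as working space; the answer flag in entry 1 survives. -/
theorem decodeCmd_run_scalar (ρ : ℕ → ℕ) (A : Arrays) {x : ℕ} (hx : x ≠ 0) :
    decodeCmd.run π ρ A 8 x = A 8 x := by
  simp only [decodeCmd, Cmd.run]
  refine iter_induction (fun _ (B : Arrays) => B 8 x = A 8 x) ?_ fun j _ B hB => ?_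
  · simp [setArr, Expr.eval, hx]
  · rw [← hB]
    split_ifs <;> simp [setArr, Expr.eval, hx]

-- A guess can only set the flag, never clear it, so the loop over all guesses computes a
-- disjunction.
open Classical in
theorem guessCmd_spec (hπ : GoodParams I π) (hA : Prepared I A) (h2 : A 0 2 = I.threshold.toNat)
    (h3 : A 0 3 = (-I.threshold).toNat) {ρ : ℕ → ℕ} (hρ : ρ 15 ≤ π 6) :
    guessCmd.run π ρ A 8 1 = if Feasible I (guessed I (A 9) (ρ 15)) then 1 else A 8 1 := by
  set A₁ := decodeCmd.run π ρ A with hA₁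
  have hA₁P : Prepared I A₁ := hA.congr (Cmd.run_eq_of_not_writes rfl _ _)
    (Cmd.run_eq_of_not_writes rfl _ _) (Cmd.run_eq_of_not_writes rfl _ _)
    (Cmd.run_eq_of_not_writes rfl _ _) (Cmd.run_eq_of_not_writes rfl _ _)
    (Cmd.run_eq_of_not_writes rfl _ _)
  have e4 : Encodes2 I (fun i v => v ∈ guessed I (A 9) (ρ 15) i) (A₁ 4) := by
    intro i v
    rw [hA₁, decodeCmd_spec hρ _ (by rw [hπ.persons]; exact pair_lt i.is_lt v.is_lt)]
    simp [guessed]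
  have htot := total_le_iff (ρ := ρ) hπ hA₁P e4
  set A₂ := costTableCmd.run π ρ A₁ with hA₂
  set A₃ := auctionCmd.run π ρ A₂ with hA₃
  have h8 : A₃ 8 1 = A 8 1 := by
    rw [hA₃, Cmd.run_eq_of_not_writes rfl, hA₂, Cmd.run_eq_of_not_writes rfl, hA₁,
      decodeCmd_run_scalar _ _ (by simp)]
  have h0 : A₃ 0 = A 0 := by
    rw [hA₃, Cmd.run_eq_of_not_writes rfl, hA₂, Cmd.run_eq_of_not_writes rfl, hA₁,
      Cmd.run_eq_of_not_writes rfl]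
  -- The negative part of the threshold is moved to the other side, so the comparison takes place in
  -- the natural numbers.
  have hcond : (eLe (.add totalE (.get 0 (.lit 3))) (.get 0 (.lit 2))).eval π A₃ ρ ≠ 0 ↔
      Feasible I (guessed I (A 9) (ρ 15)) := by
    rw [← htot]
    refine holds_le.trans ?_
    simp only [Expr.eval, h0, h2, h3]
    omega
  have hrun : guessCmd.run π ρ A =
      if (eLe (.add totalE (.get 0 (.lit 3))) (.get 0 (.lit 2))).eval π A₃ ρ ≠ 0
      then setArr A₃ 8 1 1 else A₃ := rfl
  rw [hrun]
  by_cases hF : Feasible I (guessed I (A 9) (ρ 15))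
  · rw [if_pos (hcond.2 hF), if_pos hF]
    simp [setArr]
  · rw [if_neg (fun h => hF (hcond.1 h)), if_neg hF, h8]

open Classical in
theorem search_spec (hπ : GoodParams I π) (hA : Prepared I A) (h2 : A 0 2 = I.threshold.toNat)
    (h3 : A 0 3 = (-I.threshold).toNat) (h8 : A 8 1 = 0) (h6 : π 6 = 2 ^ I.junctionNumber)
    (ρ : ℕ → ℕ) :
    (Cmd.loop 6 15 guessCmd).run π ρ A 8 1 = if I.MinSumYes then 1 else 0 := by
  set f : ℕ → Arrays → Arrays := fun j B => guessCmd.run π (update ρ 15 j) B with hf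
  have hrun : (Cmd.loop 6 15 guessCmd).run π ρ A = iter f A (π 6) := rfl
  have key : (iter f A (π 6) 0 = A 0 ∧ iter f A (π 6) 9 = A 9 ∧ Prepared I (iter f A (π 6))) ∧
      iter f A (π 6) 8 1 = if ∃ g < π 6, Feasible I (guessed I (A 9) g) then 1 else 0 := by
    refine iter_induction (fun m (B : Arrays) => (B 0 = A 0 ∧ B 9 = A 9 ∧ Prepared I B) ∧
      B 8 1 = if ∃ g < m, Feasible I (guessed I (A 9) g) then 1 else 0) ?_
      fun j hj B ⟨⟨hB0, hB9, hB⟩, hB8⟩ => ⟨⟨?_, ?_, ?_⟩, ?_⟩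
    · exact ⟨⟨rfl, rfl, hA⟩, by simp [h8]⟩
    · exact (Cmd.run_eq_of_not_writes rfl _ _).trans hB0
    · exact (Cmd.run_eq_of_not_writes rfl _ _).trans hB9
    · exact hB.congr (Cmd.run_eq_of_not_writes rfl _ _) (Cmd.run_eq_of_not_writes rfl _ _)
        (Cmd.run_eq_of_not_writes rfl _ _) (Cmd.run_eq_of_not_writes rfl _ _)
        (Cmd.run_eq_of_not_writes rfl _ _) (Cmd.run_eq_of_not_writes rfl _ _)
    · rw [hf]
      simp only
      rw [guessCmd_spec hπ hB (by rw [hB0, h2]) (by rw [hB0, h3]) (by simpa using hj.le), hB8, hB9,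
        update_self]
      by_cases hF : Feasible I (guessed I (A 9) j)
      · rw [if_pos hF, if_pos ⟨j, by omega, hF⟩]
      · rw [if_neg hF]
        refine if_congr ⟨?_, ?_⟩ rfl rfl
        · rintro ⟨g, hg, h⟩
          exact ⟨g, by omega, h⟩
        · rintro ⟨g, hg, h⟩
          refine ⟨g, ?_, h⟩
          rcases Nat.lt_succ_iff_lt_or_eq.1 hg with hg | rfl
          · exact hg
          · exact absurd h hF
  rw [hrun, key.2]
  refine if_congr ?_ rfl rfl
  rw [I.minSumYes_iff]
  constructor
  -- Digits vanish outside the junctions, so every number codes admissible sets.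
  · rintro ⟨g, -, h⟩
    refine ⟨guessed I (A 9) g, fun i v hv => ?_, h⟩
    have hd : digit (A 9) g (i * I.numItems + v) ≠ 0 := by simpa [guessed] using hv
    refine (hA.junction i v).1 fun h0 => hd ?_
    rw [digit, if_neg (by simpa using h0)]
  -- Conversely, every family of sets of junctions is coded by some number below `2 ^ γ`.
  · rintro ⟨L, hL, h⟩
    obtain ⟨g, hg, hdig⟩ := exists_digits (A 9)
      (fun x => ∃ p : Fin I.numAgents × Fin I.numItems, personIndex p = x ∧ p.2 ∈ L p.1)
      (by
        rintro x ⟨p, rfl, hp⟩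
        exact (hA.junction p.1 p.2).2 (hL p.1 hp)) (I.numAgents * I.numItems)
    refine ⟨g, ?_, ?_⟩
    · rwa [h6, ← rank_eq_junctionNumber hA.junction]
    · have : guessed I (A 9) g = L := by
        funext i
        ext v
        simp only [guessed, Finset.mem_filter, Finset.mem_univ, true_and]
        refine (hdig _ (pair_lt i.is_lt v.is_lt)).trans ⟨?_, fun hv => ⟨(i, v), rfl, hv⟩⟩
        rintro ⟨p, hp, hv⟩
        obtain rfl : p = (i, v) := personIndex_injective hp
        exact hv
      rw [this]
      exact h

end

end ArrayLang

/-! ### Preparation -/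

namespace ArrayLang

open Function

/-- The program is not given the parameter. The last loop computes `2 ^ γ` in entry 2 of array 8 by
doubling once per junction. -/
def prepareCmd : Cmd :=
  .seq (tab2 9 1 2 1 2 (eInd (junctionTestE 1 2))) <|
  .seq (closureCmd 1 (innerE 1 2 3)) <| .seq (closureCmd 2 (arcE 1 2 3)) <|
  .seq (tab2 11 1 2 1 2 (.var 1)) <| .seq (tab2 12 1 2 1 2 (.var 2)) <|
  .seq (.store 8 (.lit 2) (.lit 1)) <| .loop 3 9 <| .ite (.get 9 (.var 9))
    (.store 8 (.lit 2) (.add (.get 8 (.lit 2)) (.get 8 (.lit 2)))) .skip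

theorem prepareCmd_spec {I : DissatisfactionInstance} {π : Fin 16 → ℕ} {A : Arrays}
    (h1 : π 1 = I.numAgents) (h2 : π 2 = I.numItems) (h3 : π 3 = I.numAgents * I.numItems)
    (h0 : EncodesInput I (A 0)) (h8 : A 8 1 = 0) (ρ : ℕ → ℕ) :
    Prepared I (prepareCmd.run π ρ A) ∧ prepareCmd.run π ρ A 0 = A 0 ∧
      prepareCmd.run π ρ A 8 1 = 0 ∧ prepareCmd.run π ρ A 8 2 = 2 ^ I.junctionNumber := by
  set A₁ := (tab2 9 1 2 1 2 (eInd (junctionTestE 1 2))).run π ρ A with hA₁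
  set A₂ := (closureCmd 1 (innerE 1 2 3)).run π ρ A₁ with hA₂
  set A₃ := (closureCmd 2 (arcE 1 2 3)).run π ρ A₂ with hA₃
  set A₄ := (tab2 11 1 2 1 2 (.var 1)).run π ρ A₃ with hA₄
  set A₅ := (tab2 12 1 2 1 2 (.var 2)).run π ρ A₄ with hA₅
  set A₆ := (Cmd.store 8 (.lit 2) (.lit 1)).run π ρ A₅ with hA₆
  set f : ℕ → Arrays → Arrays := fun j B => (Cmd.ite (.get 9 (.var 9))
    (.store 8 (.lit 2) (.add (.get 8 (.lit 2)) (.get 8 (.lit 2)))) .skip).run π (update ρ 9 j) B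
    with hf
  have hrun : prepareCmd.run π ρ A = iter f A₆ (π 3) := rfl
  have z1 : A₁ 0 = A 0 := Cmd.run_eq_of_not_writes rfl _ _
  have z2 : A₂ 0 = A 0 := (Cmd.run_eq_of_not_writes rfl _ _).trans z1
  have j1 : Encodes2 I (fun i v => v ∈ (I.graph i).junctions) (A₁ 9) := by
    intro i v
    have := run_tab2 (π := π) ρ A (a := 9) (e := eInd (junctionTestE 1 2)) rfl (r := 1) (q := 2)
      (x := 1) (y := 2) (by simp) (by simp) i (by omega) v (by omega)
    rw [h2] at this
    rw [hA₁, this]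
    exact holds_ind.trans (holds_junctionTest h2 h0 (by simp) (by simp) (by simp) (by simp))
  have c2 : Encodes3 I (fun i u v => (I.graph i).Chain u v) (A₂ 1) := by
    intro i u v
    rw [hA₂, closureCmd_spec h1 h2 ρ A₁ (by simp) rfl (fun i u v => (I.graph i).Inner u v)]
    · rfl
    · exact fun i u v => holds_inner h2 (by rwa [z1]) j1 (by simp) (by simp) (by simp) (by simp)
        (by simp)
  have w3 : Encodes3 I (fun i u v => (I.graph i).Walk u v) (A₃ 2) := by
    intro i u v
    rw [hA₃, closureCmd_spec h1 h2 ρ A₂ (by simp) rfl (fun i u v => (u, v) ∈ (I.graph i).arcs)]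
    · rfl
    · exact fun i u v => holds_arc h2 (by rwa [z2]) (by simp) (by simp) (by simp) (by simp)
        (by simp)
  have a4 : ∀ p : Fin I.numAgents × Fin I.numItems, A₄ 11 (personIndex p) = p.1 := by
    intro p
    have := run_tab2 (π := π) ρ A₃ (a := 11) (e := .var 1) rfl (r := 1) (q := 2)
      (x := 1) (y := 2) (by simp) (by simp) p.1 (by omega) p.2 (by omega)
    rw [h2] at this
    rw [hA₄, personIndex, this]
    simp [Expr.eval]
  have a5 : ∀ p : Fin I.numAgents × Fin I.numItems, A₅ 12 (personIndex p) = p.2 := by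
    intro p
    have := run_tab2 (π := π) ρ A₄ (a := 12) (e := .var 2) rfl (r := 1) (q := 2)
      (x := 1) (y := 2) (by simp) (by simp) p.1 (by omega) p.2 (by omega)
    rw [h2] at this
    rw [hA₅, personIndex, this]
    simp [Expr.eval]
  have h96 : A₆ 9 = A₁ 9 := by
    rw [hA₆, Cmd.run_eq_of_not_writes rfl, hA₅, Cmd.run_eq_of_not_writes rfl, hA₄,
      Cmd.run_eq_of_not_writes rfl, hA₃, Cmd.run_eq_of_not_writes rfl, hA₂,
      Cmd.run_eq_of_not_writes rfl]
  have h86 : A₅ 8 = A 8 := by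
    rw [hA₅, Cmd.run_eq_of_not_writes rfl, hA₄,
      Cmd.run_eq_of_not_writes rfl, hA₃, Cmd.run_eq_of_not_writes rfl, hA₂,
      Cmd.run_eq_of_not_writes rfl, hA₁, Cmd.run_eq_of_not_writes rfl]
  have hprep : Prepared I A₆ := by
    have h5 : ∀ a, a ≠ 8 → A₆ a = A₅ a := fun a ha => by
      rw [hA₆]
      simp [Cmd.run, setArr, ha]
    refine ⟨?_, ?_, ?_, h96 ▸ j1, ?_, ?_⟩
    · rwa [h5 0 (by simp), hA₅, Cmd.run_eq_of_not_writes rfl, hA₄, Cmd.run_eq_of_not_writes rfl,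
        hA₃, Cmd.run_eq_of_not_writes rfl, z2]
    · rwa [h5 1 (by simp), hA₅, Cmd.run_eq_of_not_writes rfl, hA₄, Cmd.run_eq_of_not_writes rfl,
        hA₃, Cmd.run_eq_of_not_writes rfl]
    · rwa [h5 2 (by simp), hA₅, Cmd.run_eq_of_not_writes rfl, hA₄, Cmd.run_eq_of_not_writes rfl]
    · rwa [h5 11 (by simp), hA₅, Cmd.run_eq_of_not_writes rfl]
    · rwa [h5 12 (by simp)]
  have h06 : A₆ 0 = A 0 := by
    rw [hA₆, Cmd.run_eq_of_not_writes rfl, hA₅, Cmd.run_eq_of_not_writes rfl, hA₄,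
      Cmd.run_eq_of_not_writes rfl, hA₃, Cmd.run_eq_of_not_writes rfl, z2]
  have key : (∀ a, a ≠ 8 → iter f A₆ (π 3) a = A₆ a) ∧ iter f A₆ (π 3) 8 1 = 0 ∧
      iter f A₆ (π 3) 8 2 = 2 ^ rank (A₁ 9) (π 3) := by
    refine iter_induction (fun m (B : Arrays) => (∀ a, a ≠ 8 → B a = A₆ a) ∧ B 8 1 = 0 ∧
      B 8 2 = 2 ^ rank (A₁ 9) m) ⟨fun _ _ => rfl, ?_, ?_⟩ fun j _ B ⟨hB, hB1, hB2⟩ => ?_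
    · rw [hA₆]
      simp [Cmd.run, setArr, Expr.eval, h86, h8]
    · rw [hA₆]
      simp [Cmd.run, setArr, Expr.eval, rank_zero]
    · have h9 : B 9 = A₁ 9 := (hB 9 (by simp)).trans h96
      by_cases hj : A₁ 9 j ≠ 0
      · have hc : (Expr.get 9 (.var 9)).eval π B (update ρ 9 j) ≠ 0 := by
          simpa [Expr.eval, h9] using hj
        simp only [hf, Cmd.run, if_pos hc]
        refine ⟨fun a ha => ?_, ?_, ?_⟩
        · rw [← hB a ha]
          simp [setArr, ha]
        · simp [setArr, Expr.eval, hB1]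
        · rw [rank_succ, if_pos hj, pow_succ]
          simp [setArr, Expr.eval, hB2]
          ring
      · have hc : ¬ (Expr.get 9 (.var 9)).eval π B (update ρ 9 j) ≠ 0 := by
          simpa [Expr.eval, h9] using hj
        simp only [hf, Cmd.run, if_neg hc]
        exact ⟨hB, hB1, by rw [rank_succ, if_neg hj, add_zero, hB2]⟩
  rw [hrun]
  refine ⟨hprep.congr (key.1 _ (by simp)) (key.1 _ (by simp)) (key.1 _ (by simp))
    (key.1 _ (by simp)) (key.1 _ (by simp)) (key.1 _ (by simp)), ?_, key.2.1, ?_⟩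
  · rw [key.1 0 (by simp), h06]
  · rw [key.2.2, h3, rank_eq_junctionNumber j1]

/-! ### The complete search and its bounds -/

/-- The value of `e`, or the parameter `0` if that is smaller. -/
def eMin (e : Expr) : Expr := .sub (.par 0) (.sub (.par 0) e)

/-- One more than `O * (C + 1)`, where `C = (P + 1) * (P + 1)` bounds the scaled costs. -/
def roundsE : Expr :=
  .add (eMul (.add (.add (eMul (.add (.par 3) (.lit 1)) 3) (.add (.par 3) (.lit 1)))
    (.lit 1)) 4) (.lit 1)

/-- The index in a `set` phase is shifted by one. Parameters 1 to 6 become the numbers of agents,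
items, persons, objects, auction rounds and guesses. -/
def searchPhases : List Phase :=
  [.set 0 (eMin (.get 0 (.lit 0))), .set 1 (eMin (.get 0 (.lit 1))), .set 2 (eMul (.par 1) 2),
    .set 3 (.add (.par 2) (.par 3)), .set 4 roundsE, .cmd prepareCmd, .set 5 (.get 8 (.lit 2)),
    .cmd (.loop 6 15 guessCmd)]

open Classical in
theorem searchPhases_spec {I : DissatisfactionInstance} {b : ℕ} {A : Arrays}
    (hin : EncodesInput I (A 0)) (hK : A 0 0 = I.numAgents) (hn : A 0 1 = I.numItems)
    (h2 : A 0 2 = I.threshold.toNat) (h3 : A 0 3 = (-I.threshold).toNat) (h8 : A 8 1 = 0)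
    (hKb : I.numAgents ≤ b) (hnb : I.numItems ≤ b)
    (hO : I.numItems + I.numAgents * I.numItems < b) :
    (runPhases searchPhases (fun r => if r = 0 then b else 0, A)).2 8 1 =
      (if I.MinSumYes then 1 else 0) ∧
    (runPhases searchPhases (fun r => if r = 0 then b else 0, A)).1 0 = b ∧
    BoundedBy (b * (b * b + 1) + 1 + 2 ^ I.junctionNumber) searchPhases
      (fun r => if r = 0 then b else 0, A) := by
  -- The first part bounds the number of auction rounds, as both `n + P` and `P + 1` are at most
  -- `b`; the last summand is the number of guesses.
  set N := b * (b * b + 1) + 1 + 2 ^ I.junctionNumber with hN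
  set π₀ : Fin 16 → ℕ := fun r => if r = 0 then b else 0 with hπ₀
  set P := I.numAgents * I.numItems with hP
  set π₁ := update π₀ 1 I.numAgents with hπ₁
  set π₂ := update π₁ 2 I.numItems with hπ₂
  set π₃ := update π₂ 3 P with hπ₃
  set π₄ := update π₃ 4 (I.numItems + P) with hπ₄
  set π₅ := update π₄ 5 ((I.numItems + P) * ((P + 1) * (P + 1) + 1) + 1) with hπ₅
  have e₁ : Phase.run (.set 0 (eMin (.get 0 (.lit 0)))) (π₀, A) = (π₁, A) := by
    have : (eMin (.get 0 (.lit 0))).eval π₀ A (fun _ => 0) = I.numAgents := by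
      simp only [eMin, Expr.eval, hK, hπ₀, if_pos]
      omega
    simp only [Phase.run, this]
    rfl
  have e₂ : Phase.run (.set 1 (eMin (.get 0 (.lit 1)))) (π₁, A) = (π₂, A) := by
    have : (eMin (.get 0 (.lit 1))).eval π₁ A (fun _ => 0) = I.numItems := by
      have : π₁ 0 = b := by simp [hπ₁, hπ₀]
      simp only [eMin, Expr.eval, hn, this]
      omega
    simp only [Phase.run, this]
    rfl
  have e₃ : Phase.run (.set 2 (eMul (.par 1) 2)) (π₂, A) = (π₃, A) := by
    have : (eMul (.par 1) 2).eval π₂ A (fun _ => 0) = P := by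
      rw [eval_mul (by simp [Expr.indep])]
      simp [Expr.eval, hπ₂, hπ₁, hP]
    simp only [Phase.run, this]
    rfl
  have e₄ : Phase.run (.set 3 (.add (.par 2) (.par 3))) (π₃, A) = (π₄, A) := by
    have : (Expr.add (.par 2) (.par 3)).eval π₃ A (fun _ => 0) = I.numItems + P := by
      simp [Expr.eval, hπ₃, hπ₂]
    simp only [Phase.run, this]
    rfl
  have e₅ : Phase.run (.set 4 roundsE) (π₄, A) = (π₅, A) := by
    have : roundsE.eval π₄ A (fun _ => 0) =
        (I.numItems + P) * ((P + 1) * (P + 1) + 1) + 1 := by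
      have h3 : π₄ 3 = P := by simp [hπ₄, hπ₃]
      have h4 : π₄ 4 = I.numItems + P := by simp [hπ₄]
      simp only [roundsE, Expr.eval]
      rw [eval_mul (by simp [Expr.indep, eMul])]
      simp only [Expr.eval]
      rw [eval_mul (by simp [Expr.indep])]
      simp only [Expr.eval, h3, h4]
      ring
    simp only [Phase.run, this]
    rfl
  have g1 : π₅ 1 = I.numAgents := by simp [hπ₅, hπ₄, hπ₃, hπ₂, hπ₁]
  have g2 : π₅ 2 = I.numItems := by simp [hπ₅, hπ₄, hπ₃, hπ₂]
  have g3 : π₅ 3 = P := by simp [hπ₅, hπ₄, hπ₃]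
  have g4 : π₅ 4 = I.numItems + P := by simp [hπ₅, hπ₄]
  have g5 : π₅ 5 = (I.numItems + P) * ((P + 1) * (P + 1) + 1) + 1 := by simp [hπ₅]
  obtain ⟨p1, p2, p3, p4⟩ := prepareCmd_spec g1 g2 g3 hin h8 (fun _ => 0)
  set B := prepareCmd.run π₅ (fun _ => 0) A with hB
  set π₆ := update π₅ 6 (2 ^ I.junctionNumber) with hπ₆
  have e₇ : Phase.run (.set 5 (.get 8 (.lit 2))) (π₅, B) = (π₆, B) := by
    simp only [Phase.run, Expr.eval, p4]
    rfl
  have hgood : GoodParams I π₆ := by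
    constructor <;> simp [hπ₆, g1, g2, g3, g4, g5, hP]
  have hrun : runPhases searchPhases (π₀, A) =
      (π₆, (Cmd.loop 6 15 guessCmd).run π₆ (fun _ => 0) B) := by
    simp only [searchPhases, runPhases, e₁, e₂, e₃, e₄, e₅]
    rw [show Phase.run (.cmd prepareCmd) (π₅, A) = (π₅, B) from rfl, e₇]
    rfl
  refine ⟨?_, ?_, ?_⟩
  · rw [hrun]
    exact search_spec hgood p1 (by rw [p2, h2]) (by rw [p2, h3]) p3 (by simp [hπ₆]) _
  · rw [hrun]
    simp [hπ₆, hπ₅, hπ₄, hπ₃, hπ₂, hπ₁, hπ₀]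
  · have hupd : ∀ (π : Fin 16 → ℕ) (r : Fin 16) (x : ℕ), (∀ q, π q ≤ N) → x ≤ N →
        ∀ q, update π r x q ≤ N := by
      intro π r x h hx q
      by_cases hq : q = r
      · simpa [hq] using hx
      · simpa [update_of_ne hq] using h q
    have hbN : b ≤ N := by
      have : b * 1 ≤ b * (b * b + 1) := Nat.mul_le_mul_left _ (by omega)
      omega
    have hT : (I.numItems + P) * ((P + 1) * (P + 1) + 1) + 1 ≤ N := by
      have : (I.numItems + P) * ((P + 1) * (P + 1) + 1) ≤ b * (b * b + 1) :=
        Nat.mul_le_mul (by omega) (Nat.add_le_add_right (Nat.mul_le_mul (by omega) (by omega)) _)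
      omega
    have b0 : ∀ q, π₀ q ≤ N := fun q => by
      simp only [hπ₀]
      split_ifs <;> omega
    have b1 := hupd π₀ 1 _ b0 (show I.numAgents ≤ N by omega)
    have b2 := hupd _ 2 _ b1 (show I.numItems ≤ N by omega)
    have b3 := hupd _ 3 _ b2 (show P ≤ N by omega)
    have b4 := hupd _ 4 _ b3 (show I.numItems + P ≤ N by omega)
    have b5 := hupd _ 5 _ b4 hT
    have b6 := hupd _ 6 _ b5 (show 2 ^ I.junctionNumber ≤ N by omega)
    simp only [searchPhases, BoundedBy, e₁, e₂, e₃, e₄, e₅]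
    rw [show Phase.run (.cmd prepareCmd) (π₅, A) = (π₅, B) from rfl, e₇]
    exact ⟨b0, b1, b2, b3, b4, b5, b5, b6, b6⟩

end ArrayLang

/-! ### Input and output -/

namespace ArrayLang

open Function RAM

/-- The arrays that hold the first `i` words of the input in array `0`. -/
def inputArrays (w : ℕ → ℕ) (i : ℕ) : Arrays := fun a x => if a = 0 ∧ x < i then w x else 0

/-- Copies the input to array `0`. -/
def copyProgram : Program :=
  .seq (.move (scr 0) (2 * (0 : Fin 16))) <| .seq (.const (scr 1) 0) <| .seq (.const (scr 2) 1) <|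
  .seq (.move (scr 3) (2 * (0 : Fin 16))) <| .seq (.const (scr 4) 16) <|
  .loop (scr 0) <| .seq (.load (scr 5) (scr 1)) <| .seq (.store (scr 3) (scr 5)) <|
    .seq (.add (scr 1) (scr 1) (scr 2)) <| .seq (.add (scr 3) (scr 3) (scr 4))
      (.sub (scr 0) (scr 0) (scr 2))

theorem copyProgram_spec {s : State} {w : ℕ → ℕ} {b : ℕ}
    (h : Represents s (fun r => if r = 0 then b else 0) (fun _ => 0) (inputArrays w 0))
    (hw : ∀ y < b, s.mem y = w y) :
    ∃ s', Runs copyProgram s s' (b * 6 + 6) ∧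
      Represents s' (fun r => if r = 0 then b else 0) (fun _ => 0) (inputArrays w b) := by
  set π₀ : Fin 16 → ℕ := fun r => if r = 0 then b else 0 with hπ₀
  -- With `i` words copied, register 1 points to the source cell `i` and register 3 to the target
  -- cell `b + 16 * i`. Targets lie behind the input, so no unread word is overwritten.
  let Inv : ℕ → State → Prop := fun m s' => ∃ i, i + m = b ∧
    Represents s' π₀ (fun _ => 0) (inputArrays w i) ∧ (∀ y < b, s'.mem y = w y) ∧
    s'.reg (scr 0) = m ∧ s'.reg (scr 1) = i ∧ s'.reg (scr 2) = 1 ∧ s'.reg (scr 3) = b + 16 * i ∧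
    s'.reg (scr 4) = 16
  have hstep : ∀ m s', Inv (m + 1) s' → ∃ s'', Inv m s'' ∧
      Runs (.seq (.load (scr 5) (scr 1)) <| .seq (.store (scr 3) (scr 5)) <|
        .seq (.add (scr 1) (scr 1) (scr 2)) <| .seq (.add (scr 3) (scr 3) (scr 4))
        (.sub (scr 0) (scr 0) (scr 2))) s' s'' 5 := by
    rintro m s' ⟨i, hi, hrep, hmem, r0, r1, r2, r3, r4⟩
    refine ⟨_, ⟨i + 1, by omega, ?_, ?_, ?_, ?_, ?_, ?_, ?_⟩, (runs_load _ _ _).seq <|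
      (runs_store _ _ _).seq <| (runs_add _ _ _ _).seq <| (runs_add _ _ _ _).seq
      (runs_sub _ _ _ _)⟩
    · refine Represents.setReg_scr (.setReg_scr (.setReg_scr ?_ _ _) _ _) _ _
      rw [reg_setReg, scr_setReg_scr _ _ (by omega), r3, r1, hmem i (by omega)]
      have hA : inputArrays w (i + 1) = setArr (inputArrays w i) 0 i (w i) := by
        funext a x
        by_cases ha : a = 0
        · subst ha
          by_cases hx : x = i
          · simp [inputArrays, setArr, hx]
          · show (if (0 : Fin 16) = 0 ∧ x < i + 1 then w x else 0) = _
            rw [setArr, update_self, update_of_ne hx]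
            exact if_congr (and_congr_right fun _ => by omega) rfl rfl
        · simp [inputArrays, setArr, ha]
      rw [hA]
      exact (hrep.setReg_scr 5 (w i)).setMem 0 i (w i)
    · intro y hy
      simp only [mem_setReg, State.setMem]
      rw [scr_setReg_scr _ _ (by omega), r3, update_of_ne (by omega), hmem y hy]
    all_goals
      simp [scr_setReg_scr, r0, r1, r2, r3, r4]
    ring
  have hinit : Inv b (((((s.setReg (scr 0) b).setReg (scr 1) 0).setReg (scr 2) 1).setReg (scr 3)
      b).setReg (scr 4) 16) := by
    refine ⟨0, by omega, ?_, ?_, ?_, ?_, ?_, ?_, ?_⟩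
    · exact ((((h.setReg_scr _ _).setReg_scr _ _).setReg_scr _ _).setReg_scr _ _).setReg_scr _ _
    · exact hw
    all_goals simp [scr_setReg_scr]
  obtain ⟨s₁, ⟨i, hi, hrep, -⟩, hrun⟩ := runs_loop (r := scr 0) Inv
    (fun j s' h => by obtain ⟨i, -, -, -, h, -⟩ := h; exact h) hstep _ _ hinit
  obtain rfl : i = b := by omega
  refine ⟨s₁, Runs.mono (.seq (s₁ := s.setReg (scr 0) i) ?_ <| .seq (runs_const _ _ _) <|
    .seq (runs_const _ _ _) <| .seq ?_ <| .seq (runs_const _ _ _) hrun)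
    (show 1 + (1 + (1 + (1 + (1 + (i * 6 + 1))))) ≤ i * 6 + 6 by omega), hrep⟩
  · have := runs_move s (scr 0) (2 * (0 : Fin 16))
    rwa [h.par 0] at this
  · have := runs_move (((s.setReg (scr 0) i).setReg (scr 1) 0).setReg (scr 2) 1) (scr 3)
      (2 * (0 : Fin 16))
    rwa [par_setReg_scr, par_setReg_scr, par_setReg_scr, h.par 0] at this

/-- The arrays start right behind the input, where the memory is zero. -/
theorem represents_init (w : List ℕ) :
    Represents (init w) (fun r => if r = 0 then w.length else 0) (fun _ => 0)
      (inputArrays (fun y => w.getD y 0) 0) where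
  par r := by
    refine if_congr ⟨fun h => Fin.ext ?_, ?_⟩ rfl rfl
    · simp only [Fin.val_zero]
      omega
    · rintro rfl
      rfl
  var x := by
    show (if 2 * x + 1 = 0 then w.length else 0) = 0
    exact if_neg (by omega)
  arr a x := by
    show w.getD (w.length + (16 * x + a)) 0 = if a = 0 ∧ x < 0 then w.getD x 0 else 0
    rw [if_neg (fun h => absurd h.2 (Nat.not_lt_zero _)), List.getD_eq_default _ _ (by omega)]

/-! ### Length and layout of the encoded input -/

theorem length_le_bitLength (w : List ℕ) : w.length ≤ bitLength w := by
  induction w with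
  | nil => simp [bitLength]
  | cons x w ih =>
    simp only [bitLength, List.map_cons, List.sum_cons, List.length_cons] at ih ⊢
    omega

theorem length_flatMap_of_length {α : Type*} {f : α → List ℕ} {m : ℕ}
    (hf : ∀ a, (f a).length = m) (l : List α) : (l.flatMap f).length = l.length * m := by
  induction l with
  | nil => simp
  | cons a l ih =>
    rw [List.flatMap_cons, List.length_append, hf, ih, List.length_cons]
    ring

theorem getD_flatMap_of_length {α : Type*} {f : α → List ℕ} {m : ℕ}
    (hf : ∀ a, (f a).length = m) (l : List α) {i j : ℕ} (hi : i < l.length) (hj : j < m) :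
    (l.flatMap f).getD (i * m + j) 0 = (f l[i]).getD j 0 := by
  induction l generalizing i with
  | nil => simp at hi
  | cons a l ih =>
    rw [List.flatMap_cons]
    cases i with
    | zero => rw [zero_mul, zero_add, List.getD_append _ _ _ _ (by rw [hf]; exact hj)]; rfl
    | succ i =>
      have hi : i < l.length := by simpa using hi
      rw [List.getD_append_right _ _ _ _ (by rw [hf, Nat.succ_mul]; omega), hf]
      have : (i + 1) * m + j - m = i * m + j := by
        rw [Nat.succ_mul]
        omega
      rw [this, ih hi]
      rfl

section

variable (I : DissatisfactionInstance)

theorem length_encode :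
    I.encode.length = 4 + I.numAgents * (I.numItems + I.numItems * I.numItems) := by
  rw [DissatisfactionInstance.encode, List.length_append,
    length_flatMap_of_length (m := I.numItems + I.numItems * I.numItems)]
  · simp
  · intro i
    rw [List.length_append, length_flatMap_of_length (m := I.numItems)] <;> simp

theorem encodesInput_encode : EncodesInput I (fun y => I.encode.getD y 0) := by
  have hrow : ∀ (i : Fin I.numAgents) (u : Fin I.numItems), ((List.finRange I.numItems).map
      fun v => if (u, v) ∈ (I.graph i).arcs then 1 else 0).length = I.numItems := by simp
  have hblock : ∀ i : Fin I.numAgents,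
      (((List.finRange I.numItems).map fun v => if v ∈ (I.graph i).verts then 1 else 0) ++
      (List.finRange I.numItems).flatMap fun u =>
        (List.finRange I.numItems).map fun v =>
          if (u, v) ∈ (I.graph i).arcs then 1 else 0).length =
        I.numItems + I.numItems * I.numItems := by
    intro i
    rw [List.length_append, length_flatMap_of_length (hrow i)]
    simp
  have hget : ∀ (i : Fin I.numAgents) (j : ℕ), j < I.numItems + I.numItems * I.numItems →
      I.encode.getD (4 + ((i + i * I.numItems) * I.numItems + j)) 0 =
      (((List.finRange I.numItems).map fun v => if v ∈ (I.graph i).verts then 1 else 0) ++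
      (List.finRange I.numItems).flatMap fun u =>
        (List.finRange I.numItems).map fun v =>
          if (u, v) ∈ (I.graph i).arcs then 1 else 0).getD j 0 := by
    intro i j hj
    rw [DissatisfactionInstance.encode, List.getD_append_right _ _ _ _ (by simp)]
    have : 4 + ((i + i * I.numItems) * I.numItems + j) - [I.numAgents, I.numItems,
        I.threshold.toNat, (-I.threshold).toNat].length =
        i * (I.numItems + I.numItems * I.numItems) + j := by
      simp only [List.length_cons, List.length_nil]
      rw [Nat.add_sub_cancel_left]
      ring
    rw [this, getD_flatMap_of_length hblock _ (by simp) hj]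
    simp
  constructor
  · intro i v
    rw [hget i v (by omega), List.getD_append _ _ _ _ (by simp)]
    simp
  · intro i u v
    have huv := pair_lt u.is_lt v.is_lt
    rw [hget i _ (by omega), List.getD_append_right _ _ _ _ (by simp)]
    simp only [List.length_map, List.length_finRange, Nat.add_sub_cancel_left]
    rw [getD_flatMap_of_length (hrow i) _ (by simp) v.is_lt]
    simp

/-- Without agents or without items nothing can be undominated, so only the sign of the threshold
matters. -/
theorem minSumYes_iff_of_empty (h : I.numAgents * (I.numItems + I.numItems * I.numItems) = 0) :
    I.MinSumYes ↔ (-I.threshold).toNat = 0 := by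
  classical
  have hsum : ∀ π : Fin I.numAgents → Finset (Fin I.numItems),
      ∑ i, (I.graph i).dissatisfaction (π i) = 0 := by
    intro π
    refine Finset.sum_eq_zero fun i _ => ?_
    have hn : I.numItems = 0 := by
      rcases Nat.mul_eq_zero.1 h with h | h
      · exact absurd i.is_lt (by omega)
      · omega
    refine Nat.le_zero.1 ((Finset.card_filter_le _ _).trans ((Finset.card_le_univ _).trans ?_))
    simp [hn]
  unfold DissatisfactionInstance.MinSumYes
  simp only [hsum]
  constructor
  · rintro ⟨π, -, h⟩
    simp at h
    omega
  · intro h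
    exact ⟨fun _ => ∅, fun _ _ _ => Finset.disjoint_empty_left _, by simp; omega⟩

end

/-! ### The decision program -/

/-- The decision program, where `p` is the program for the search. -/
def decisionProgram (p : Program) : Program :=
  .seq (.const (scr 0) 4) <| .seq (.sub (scr 0) (2 * (0 : Fin 16)) (scr 0)) <|
  .ite (scr 0)
    (.seq copyProgram <| .seq p <| .seq (.const (scr 0) 1) <| .seq (addressProgram 8 0)
      (.load 0 (scr 0)))
    (.seq (.const (scr 0) 3) <| .seq (.load (scr 0) (scr 0)) <| .seq (.const (scr 1) 1)
      (.sub 0 (scr 1) (scr 0)))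

open Classical in
theorem exists_decision_program : ∃ (p : Program) (T : ℕ → ℕ), PolyBounded T ∧
    ∀ I : DissatisfactionInstance, ∃ s,
      Runs p (init I.encode) s (T (I.encode.length * (I.encode.length * I.encode.length + 1) + 1 +
        2 ^ I.junctionNumber)) ∧ s.reg 0 = if I.MinSumYes then 1 else 0 := by
  obtain ⟨p, T, hT, hp⟩ := exists_program_phases searchPhases
  refine ⟨decisionProgram p, fun N => 1 + (1 + (N * 6 + 6 + (T N + (1 + (7 + 1))) + 4 + 1)),
    (PolyBounded.const 1).add ((PolyBounded.const 1).add (((((PolyBounded.id.mul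
      (.const 6)).add (.const 6)).add (hT.add (.const _))).add (.const 4)).add (.const 1))),
    fun I => ?_⟩
  set b := I.encode.length with hb
  set N := b * (b * b + 1) + 1 + 2 ^ I.junctionNumber with hN
  have hlen := length_encode I
  have hrep := represents_init I.encode
  rw [← hb] at hlen hrep
  have hrep' := (hrep.setReg_scr 0 4).setReg_scr 0 (b - 4)
  set s₀ := ((init I.encode).setReg (scr 0) 4).setReg (scr 0) (b - 4) with hs₀
  have hsub : Runs (.sub (scr 0) (2 * (0 : Fin 16)) (scr 0)) ((init I.encode).setReg (scr 0) 4) s₀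
      1 := by
    have := runs_sub ((init I.encode).setReg (scr 0) 4) (scr 0) (2 * (0 : Fin 16)) (scr 0)
    rwa [par_setReg_scr, hrep.par 0, reg_setReg] at this
  have h0 : s₀.reg (scr 0) = b - 4 := reg_setReg _ _ _
  have hmem : s₀.mem = fun y => I.encode.getD y 0 := rfl
  -- The input has length 4 exactly in this degenerate case. It is treated apart because the input
  -- length then need not bound the numbers of agents and items, and with them the loops.
  by_cases hz : I.numAgents * (I.numItems + I.numItems * I.numItems) = 0
  · have hr1 := runs_load (s₀.setReg (scr 0) 3) (scr 0) (scr 0)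
    rw [reg_setReg, mem_setReg, hmem] at hr1
    refine ⟨_, Runs.seq (runs_const _ _ _) (Runs.seq hsub (.ite (fun h => absurd ?_ h) fun _ =>
      Runs.mono (Runs.seq (runs_const _ _ _) (Runs.seq hr1 (Runs.seq (runs_const _ _ _)
        (runs_sub _ _ _ _)))) ?_)), ?_⟩
    · omega
    · omega
    · rw [reg_setReg, reg_setReg, scr_setReg_scr _ _ (by omega), reg_setReg]
      have : I.encode.getD 3 0 = (-I.threshold).toNat := by simp [DissatisfactionInstance.encode]
      show 1 - I.encode.getD 3 0 = _
      rw [this]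
      split_ifs with hyes
      · rw [(minSumYes_iff_of_empty I hz).1 hyes]
      · have := mt (minSumYes_iff_of_empty I hz).2 hyes
        omega
  · have hpos := Nat.pos_of_ne_zero hz
    have hKpos : 0 < I.numAgents := Nat.pos_of_mul_pos_right hpos
    have hnpos : 0 < I.numItems := by
      by_contra hn
      have hn : I.numItems = 0 := by omega
      simp [hn] at hz
    obtain ⟨s₁, r₁, rep₁⟩ := copyProgram_spec (b := b) hrep' (fun y _ => by rw [hmem])
    set A := inputArrays (fun y => I.encode.getD y 0) b with hA
    have hA0 : A 0 = fun y => I.encode.getD y 0 := by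
      funext y
      simp only [hA, inputArrays, true_and]
      split_ifs with hy
      · rfl
      · exact (List.getD_eq_default _ _ (by omega)).symm
    have hK : I.numAgents ≤ I.numAgents * (I.numItems + I.numItems * I.numItems) :=
      Nat.le_mul_of_pos_right _ (by omega)
    -- With at least one agent and one item, the adjacency matrices make the input longer than the
    -- number of objects.
    have hO : I.numItems + I.numAgents * I.numItems ≤
        I.numAgents * (I.numItems + I.numItems * I.numItems) := by
      have h1 : I.numItems ≤ I.numItems * I.numItems := Nat.le_mul_of_pos_left _ hnpos
      have h2 : I.numItems * I.numItems ≤ I.numAgents * (I.numItems * I.numItems) :=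
        Nat.le_mul_of_pos_left _ hKpos
      rw [mul_add]
      omega
    obtain ⟨q1, q2, q3⟩ := searchPhases_spec (I := I) (b := b) (A := A)
      (hA0 ▸ encodesInput_encode I) (by rw [hA0]; rfl) (by rw [hA0]; rfl) (by rw [hA0]; rfl)
      (by rw [hA0]; rfl) (by simp [hA, inputArrays]) (by omega) (by omega) (by omega)
    obtain ⟨s₂, r₂, rep₂⟩ := hp s₁ _ A N rep₁ q3
    obtain ⟨s₃, r₃, rep₃, -, v₃⟩ := addressProgram_spec 8 0 (rep₂.setReg_scr 0 1)
    have hbN : b ≤ N := by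
      have : b * 1 ≤ b * (b * b + 1) := Nat.mul_le_mul_left _ (by omega)
      have := Nat.one_le_two_pow (n := I.junctionNumber)
      rw [hN]
      omega
    have hne : s₀.reg (scr 0) ≠ 0 := by omega
    refine ⟨_, Runs.seq (runs_const _ _ _) (Runs.seq hsub (.ite (fun _ =>
      Runs.mono (Runs.seq r₁ (Runs.seq r₂ (Runs.seq (runs_const _ _ _) (Runs.seq r₃
        (runs_load _ _ _))))) ?_) fun h => absurd h hne)), ?_⟩
    · omega
    · rw [reg_setReg, v₃, rep₃.arr, reg_setReg, q1]

theorem computable_mul_pow (c d : ℕ) : Computable fun g : ℕ => c * (5 * 2 ^ g) ^ d := by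
  have hpow : Primrec₂ ((· ^ ·) : ℕ → ℕ → ℕ) := Primrec₂.unpaired'.1 Nat.Primrec.pow
  exact (Primrec.nat_mul.comp (.const c) (hpow.comp (Primrec.nat_mul.comp (.const 5)
    (hpow.comp (.const 2) .id)) (.const d))).to_comp

end ArrayLang

open ArrayLang in
theorem mainTheorem10 : FixedParameterTractable minSumDissatisfaction := by
  classical
  obtain ⟨p, T, ⟨c, d, hT⟩, hp⟩ := exists_decision_program
  refine ⟨p, fun g => c * (5 * 2 ^ g) ^ d, 3 * d, computable_mul_pow c d, fun I => ?_⟩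
  obtain ⟨s, ⟨t, ht, hexec⟩, hs⟩ := hp I
  refine ⟨t, s, hexec, ?_, fun h => hs.trans (if_pos h), fun h => hs.trans (if_neg h)⟩
  refine (ht.trans (hT _)).trans ?_
  show _ ≤ c * (5 * 2 ^ I.junctionNumber) ^ d * RAM.bitLength I.encode ^ (3 * d)
  have hb : I.encode.length ≤ RAM.bitLength I.encode := length_le_bitLength _
  have hb1 : 1 ≤ RAM.bitLength I.encode := by
    have := length_encode I
    omega
  set B := RAM.bitLength I.encode
  set b := I.encode.length
  set g := 2 ^ I.junctionNumber with hg
  have hg1 : 1 ≤ g := Nat.one_le_two_pow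
  -- After expansion with `b ≤ B` the left side is `B ^ 3 + B + 1 + g + 1`, and each of the five
  -- summands is at most `g * B ^ 3`.
  have h1 : b * (b * b + 1) + 1 + g + 1 ≤ 5 * g * B ^ 3 := by
    have h2 : b * (b * b + 1) ≤ B * (B * B + 1) :=
      Nat.mul_le_mul hb (Nat.add_le_add_right (Nat.mul_le_mul hb hb) 1)
    have h3 : B * (B * B + 1) = B ^ 3 + B := by ring
    have h4 : B ≤ B ^ 3 := Nat.le_self_pow (by simp) B
    have h5 : B ^ 3 ≤ g * B ^ 3 := Nat.le_mul_of_pos_left _ hg1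
    have h6 : g ≤ g * B ^ 3 := Nat.le_mul_of_pos_right _ (by omega)
    rw [mul_assoc]
    omega
  calc c * (b * (b * b + 1) + 1 + g + 1) ^ d ≤ c * (5 * g * B ^ 3) ^ d := by gcongr
    _ = c * (5 * g) ^ d * B ^ (3 * d) := by rw [mul_pow, ← pow_mul, mul_assoc]
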